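/- **Conventions.** Let $R$ be a finite-dimensional unital real algebra and $G$ an abelian group. A *division grading* of $R$ by $G$ is a decomposition $R=\bigoplus_{g\in G}R_g$ into subspaces with $R_gR_h\subseteq R_{gh}$ in which every nonzero homogeneous element is invertible; the support is assumed to be all of $G$. Two graded algebras $R=\bigoplus_{g\in G}R_g$ and $R'=\bigoplus_{g'\in G'}R'_{g'}$ are *weakly isomorphic* if there are an algebra isomorphism $\varphi:R\to R'$ and a group isomorphism $\alpha:G\to G'$ with $\varphi(R_g)=R'_{\alpha(g)}$ for all $g\in G$. A grading $\Gamma$ of $R$ is a *coarsening* of a grading $\Gamma'$ of $R$ if every component of $\Gamma'$ lies in a component of $\Gamma$. The tensor product of a $G$-graded and an $H$-graded algebra is graded by $G\times H$ via $(R\otimes S)_{(g,h)}=R_g\otimes S_h$. Put $A=\begin{pmatrix}1&0\\0&-1\end{pmatrix}$, $B=\begin{pmatrix}0&1\\1&0\end{pmatrix}$, $C=\begin{pmatrix}0&1\\-1&0\end{pmatrix}$. Let $M_2^{(4)}$ be $M_2(\mathbb R)$ graded by $\mathbb Z_2\times\mathbb Z_2$ with components $\langle I\rangle,\langle A\rangle,\langle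 B\rangle,\langle C\rangle$ in degrees $(0,0),(1,0),(0,1),(1,1)$; let $M_2^{(2)}$ be $M_2(\mathbb R)$ graded by $\mathbb Z_2$ with components $\langle I,C\rangle,\langle A,B\rangle$; let $\mathbb H^{(4)}$ be the real quaternions graded by $\mathbb Z_2\times\mathbb Z_2$ with components $\langle 1\rangle,\langle i\rangle,\langle j\rangle,\langle k\rangle$ in the same degrees; and let $\mathbb H^{(2)}$ be the real quaternions graded by $\mathbb Z_2$ with components $\langle 1,i\rangle,\langle j,k\rangle$. For $p,m\ge 0$, let $C^{\mathrm{gr}}(p,m)$ be the real Clifford algebra with pairwise anticommuting generators $e_1,\dots,e_{p+m}$, $e_s^2=-1$ for $s\le p$ and $e_s^2=1$ for $s>p$, graded by $\mathbb Z_2^{p+m}$ so that the degrees of $e_1,\dots,e_{p+m}$ form the standard basis. **Proposition.** Let $D$ be a finite-dimensional real division algebra with centre $\mathbb R$, and let $R=M_n(D)$. 1. $R$ has a division grading by an abelian group with all homogeneous components of dimension $2$ if and only if $n=2^k$ for some integer $k\ge 0$ and $R\neq\mathbb R$ (that is, not both $n=1$ and $D=\mathbb R$). 2. Let $R$ be given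 such a grading. If $n\ne 1$, then for some integer $k\ge 0$ it is weakly isomorphic to (i) $M_2^{(2)}\otimes (M_2^{(4)})^{\otimes k}$ or (ii) $M_2^{(2)}\otimes (M_2^{(4)})^{\otimes k}\otimes\mathbb H^{(4)}$. If $n=1$, then it is weakly isomorphic to $\mathbb H^{(2)}$. 3. All these gradings are coarsenings of division gradings with one-dimensional components (hence fine) that are weakly isomorphic to Clifford gradings: for every $k\ge 0$, the grading (i) is a coarsening of a grading of the same algebra that is weakly isomorphic to $C^{\mathrm{gr}}(k+1,k+1)$, the grading (ii) is a coarsening of one that is weakly isomorphic to $C^{\mathrm{gr}}(k+3,k+1)$, and $\mathbb H^{(2)}$ is a coarsening of one that is weakly isomorphic to $C^{\mathrm{gr}}(2,0)$. -/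

import Mathlib

open scoped TensorProduct Quaternion

namespace RealDivGrading

section General

variable {G H R S : Type*}

/-- A division grading of a unital real algebra `R` by an abelian group `G` (written additively):
`R` is the direct sum of the subspaces `𝒜 g`, `1 ∈ 𝒜 0`, `𝒜 g * 𝒜 h ⊆ 𝒜 (g + h)`, and every
nonzero homogeneous element is invertible. -/
structure IsDivisionGrading [AddCommGroup G] [Ring R] [Algebra ℝ R]
    (𝒜 : G → Submodule ℝ R) : Prop where
  gradedMonoid : SetLike.GradedMonoid 𝒜
  isInternal : haveI : DecidableEq G := Classical.decEq G
    DirectSum.IsInternal 𝒜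
  isUnit_of_mem : ∀ (g : G) (x : R), x ∈ 𝒜 g → x ≠ 0 → IsUnit x

/-- Weak isomorphism of gradings: an isomorphism `φ` of algebras and an isomorphism `α` of the
grading groups such that `φ (𝒜 g) = ℬ (α g)` for all `g`. -/
def WeaklyIsomorphic [AddCommGroup G] [AddCommGroup H] [Ring R] [Algebra ℝ R] [Ring S]
    [Algebra ℝ S] (𝒜 : G → Submodule ℝ R) (ℬ : H → Submodule ℝ S) : Prop :=
  ∃ (α : G ≃+ H) (φ : R ≃ₐ[ℝ] S), ∀ g : G, (𝒜 g).map φ.toLinearMap = ℬ (α g)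

/-- `𝒜` is a coarsening of `ℬ` (equivalently `ℬ` is a refinement of `𝒜`), two gradings of the same
algebra: every component of `ℬ` is contained in a component of `𝒜`. -/
def IsCoarsening [Ring R] [Algebra ℝ R] (𝒜 : G → Submodule ℝ R) (ℬ : H → Submodule ℝ R) : Prop :=
  ∀ h : H, ∃ g : G, ℬ h ≤ 𝒜 g

/-- The tensor product of a `G`-grading of `R` and an `H`-grading of `S`: the `G × H`-grading of
`R ⊗ S` whose `(g, h)`-component is `𝒜 g ⊗ ℬ h`, the span of all `x ⊗ y`, `x ∈ 𝒜 g`, `y ∈ ℬ h`. -/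
def tensorGrading [Ring R] [Algebra ℝ R] [Ring S] [Algebra ℝ S]
    (𝒜 : G → Submodule ℝ R) (ℬ : H → Submodule ℝ S) (p : G × H) : Submodule ℝ (R ⊗[ℝ] S) :=
  Submodule.map₂ (TensorProduct.mk ℝ R S) (𝒜 p.1) (ℬ p.2)

/-- The `k`-th tensor power of a `G`-grading of `R`: the `G ^ k`-grading of `R ⊗ ⋯ ⊗ R` whose
`g`-component is `𝒜 (g 0) ⊗ ⋯ ⊗ 𝒜 (g (k - 1))`. For `k = 0` it is `ℝ`, trivially graded. -/
def tensorPowerGrading [Ring R] [Algebra ℝ R] (𝒜 : G → Submodule ℝ R) (k : ℕ)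
    (g : Fin k → G) : Submodule ℝ (⨂[ℝ] _ : Fin k, R) :=
  Submodule.span ℝ {t | ∃ x : Fin k → R, (∀ i, x i ∈ 𝒜 (g i)) ∧ t = PiTensorProduct.tprod ℝ x}

end General

/-! ### The four-dimensional building blocks -/

/-- The Sylvester matrices of order two. -/
noncomputable def sylA : Matrix (Fin 2) (Fin 2) ℝ := !![1, 0; 0, -1]

noncomputable def sylB : Matrix (Fin 2) (Fin 2) ℝ := !![0, 1; 1, 0]

noncomputable def sylC : Matrix (Fin 2) (Fin 2) ℝ := !![0, 1; -1, 0]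

/-- `M₂⁽⁴⁾`: the grading of `M₂(ℝ)` by `ℤ₂ × ℤ₂` with components `⟨I⟩, ⟨A⟩, ⟨B⟩, ⟨C⟩`. -/
noncomputable def m2Four (g : ZMod 2 × ZMod 2) : Submodule ℝ (Matrix (Fin 2) (Fin 2) ℝ) :=
  if g = (0, 0) then Submodule.span ℝ {1}
  else if g = (1, 0) then Submodule.span ℝ {sylA}
  else if g = (0, 1) then Submodule.span ℝ {sylB}
  else Submodule.span ℝ {sylC}

/-- `M₂⁽²⁾`: the grading of `M₂(ℝ)` by `ℤ₂` with components `⟨I, C⟩` and `⟨A, B⟩`. -/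
noncomputable def m2Two (g : ZMod 2) : Submodule ℝ (Matrix (Fin 2) (Fin 2) ℝ) :=
  if g = 0 then Submodule.span ℝ {1, sylC} else Submodule.span ℝ {sylA, sylB}

/-- The quaternion units. -/
noncomputable def qI : ℍ[ℝ] := ⟨0, 1, 0, 0⟩

noncomputable def qJ : ℍ[ℝ] := ⟨0, 0, 1, 0⟩

noncomputable def qK : ℍ[ℝ] := ⟨0, 0, 0, 1⟩

/-- `ℍ⁽⁴⁾`: the grading of `ℍ` by `ℤ₂ × ℤ₂` with components `⟨1⟩, ⟨i⟩, ⟨j⟩, ⟨k⟩`. -/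
noncomputable def hFour (g : ZMod 2 × ZMod 2) : Submodule ℝ ℍ[ℝ] :=
  if g = (0, 0) then Submodule.span ℝ {1}
  else if g = (1, 0) then Submodule.span ℝ {qI}
  else if g = (0, 1) then Submodule.span ℝ {qJ}
  else Submodule.span ℝ {qK}

/-- `ℍ⁽²⁾`: the grading of `ℍ` by `ℤ₂` with components `⟨1, i⟩` and `⟨j, k⟩`. -/
noncomputable def hTwo (g : ZMod 2) : Submodule ℝ ℍ[ℝ] :=
  if g = 0 then Submodule.span ℝ {1, qI} else Submodule.span ℝ {qJ, qK}

/-! ### The two families of gradings with two-dimensional components -/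

/-- `M₂⁽²⁾ ⊗ (M₂⁽⁴⁾)^{⊗ k}`. -/
noncomputable abbrev typeI (k : ℕ) :=
  tensorGrading m2Two (tensorPowerGrading m2Four k)

/-- `M₂⁽²⁾ ⊗ (M₂⁽⁴⁾)^{⊗ k} ⊗ ℍ⁽⁴⁾`. -/
noncomputable abbrev typeII (k : ℕ) :=
  tensorGrading (typeI k) hFour

/-! ### Fine Clifford gradings -/

/-- The quadratic form `x₁² + ⋯ + x_p² - y₁² - ⋯ - y_m²` on `ℝ ^ (p + m)`. -/
noncomputable def stdForm (p m : ℕ) : QuadraticForm ℝ (Fin p ⊕ Fin m → ℝ) :=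
  QuadraticMap.weightedSumSquares ℝ (Sum.elim (fun _ => (1 : ℝ)) (fun _ => (-1 : ℝ)))

/-- The Clifford algebra `C(p, m)` with the convention `x * x = -q(x)`, where `q` has positive
inertia index `p` and negative inertia index `m`. Mathlib's convention is `x * x = Q(x)`. -/
abbrev Cl (p m : ℕ) := CliffordAlgebra (-stdForm p m)

/-- The generator `e_i` of `C(p, m)`. -/
noncomputable def gen (p m : ℕ) (i : Fin p ⊕ Fin m) : Cl p m :=
  CliffordAlgebra.ι (-stdForm p m) (Pi.single i 1)

/-- The fine Clifford grading `C^gr(p, m)`: the grading of `C(p, m)` by `ℤ₂ ^ (p + m)` in which the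
degrees of the generators `e_i` form the standard basis; the component of degree `g` is spanned by
all monomials `e_{i₁} ⋯ e_{i_r}` of degree `g`. -/
noncomputable def cliffordGrading (p m : ℕ) (g : Fin p ⊕ Fin m → ZMod 2) :
    Submodule ℝ (Cl p m) :=
  Submodule.span ℝ {t | ∃ l : List (Fin p ⊕ Fin m),
    (l.map fun i => (Pi.single i 1 : Fin p ⊕ Fin m → ZMod 2)).sum = g ∧
      t = (l.map (gen p m)).prod}

/-- `𝒜` is a coarsening of a division grading of `R` with one-dimensional components that is weakly
isomorphic to the fine Clifford grading `C^gr(p, m)`. -/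
def IsCoarseningOfClifford {G R : Type*} [Ring R] [Algebra ℝ R] (𝒜 : G → Submodule ℝ R)
    (p m : ℕ) : Prop :=
  ∃ ℬ : (Fin p ⊕ Fin m → ZMod 2) → Submodule ℝ R,
    IsDivisionGrading ℬ ∧ (∀ h, Module.finrank ℝ (ℬ h) = 1) ∧
      WeaklyIsomorphic ℬ (cliffordGrading p m) ∧ IsCoarsening 𝒜 ℬ

end RealDivGrading

namespace RealDivGrading

/-! The identity component is a two-dimensional real algebra whose nonzero elements are invertible,
hence a copy of ℂ spanned by `1` and some `i` with `i² = -1`. Every component is a line over it, so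
right multiplication by `i` on a component agrees with left multiplication by `i` or by `-i`: each
component commutes or anticommutes with `i`. Since the algebra is central, some homogeneous `u`
anticommutes with `i`, and conjugation by `u` is complex conjugation on ℂ.

Let `T` be the group of degrees of components commuting with `i`. Conjugation by `u` is semilinear
on such a component and has a fixed vector there, by the argument of Hilbert's Theorem 90
(`exists_isFixed`). Fixed vectors are unique up to real scalars, commute or anticommute pairwise,
and have real squares. Normalising the squares to `±1` turns `T` into a vector space over ℤ/2 with a
quadratic form (sign of the square) whose polar form is the commutation sign; centrality makes it
nondegenerate (`exists_quadraticSystem`).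

Such a form is an orthogonal sum of hyperbolic planes and at most one anisotropic plane
(`exists_normal_form`). A hyperbolic plane yields a factor `M₂⁽⁴⁾`, an anisotropic one a factor
`ℍ⁽⁴⁾`. The pair `i, u` yields `M₂⁽²⁾` if `u² = 1`. If `T ≠ 0`, this can be arranged by multiplying
`u` by a fixed element of square `-1`; if `T = 0` and `u² = -1`, the whole algebra is `ℍ⁽²⁾`. The
size `n` separates the cases: for `n = 1` there are no square roots of `1` other than `±1`, while
for `n ≠ 1` the matrix algebra has nilpotents and is not ℍ.

For existence, `n` is forced to be a power of two because the dimension is twice the order of an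
elementary 2-group. Conversely, Frobenius' theorem leaves `D = ℝ` or `D = ℍ`; one starts from
`M₂⁽²⁾` or `ℍ⁽²⁾` and tensors with `M₂⁽⁴⁾`.

For the coarsenings, the models carry generators of Jordan–Wigner type: strings `B ⊗ ⋯ ⊗ B ⊗ M ⊗ 1 ⊗
⋯ ⊗ 1` with `M = A` or `C` anticommute pairwise, and a counting of dimensions identifies the algebra
they generate with the Clifford algebra. These strings are homogeneous, so every monomial line lies
in a component. -/

theorem exists_ne_zero_of_finrank_eq_two {ι M : Type*} [AddCommGroup M] [Module ℝ M]
    {𝒜 : ι → Submodule ℝ M} (h2 : ∀ g, Module.finrank ℝ (𝒜 g) = 2) (g : ι) :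
    ∃ x ∈ 𝒜 g, x ≠ 0 := by
  by_contra! hc
  have := h2 g
  rw [(Submodule.eq_bot_iff _).2 hc, finrank_bot] at this
  omega

theorem one_ne_zero_of_finrank_eq_two {ι A : Type*} [Zero ι] [Ring A] [Algebra ℝ A]
    {𝒜 : ι → Submodule ℝ A} (h2 : ∀ g, Module.finrank ℝ (𝒜 g) = 2) : (1 : A) ≠ 0 := by
  obtain ⟨x, -, hx0⟩ := exists_ne_zero_of_finrank_eq_two h2 0
  exact fun h => hx0 (by rw [← one_mul x, h, zero_mul])

/-! ### The identity component as a copy of ℂ. -/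

section Structure

variable {G R : Type*} [AddCommGroup G] [Ring R] [Algebra ℝ R] {𝒜 : G → Submodule ℝ R}

namespace IsDivisionGrading

theorem mul_mem (h : IsDivisionGrading 𝒜) {g g' : G} {x y : R} (hx : x ∈ 𝒜 g) (hy : y ∈ 𝒜 g') :
    x * y ∈ 𝒜 (g + g') :=
  h.gradedMonoid.mul_mem hx hy

theorem one_mem (h : IsDivisionGrading 𝒜) : (1 : R) ∈ 𝒜 0 :=
  h.gradedMonoid.one_mem

theorem pow_mem (h : IsDivisionGrading 𝒜) {g : G} {x : R} (hx : x ∈ 𝒜 g) (n : ℕ) :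
    x ^ n ∈ 𝒜 (n • g) :=
  haveI := h.gradedMonoid
  SetLike.pow_mem_graded n hx

theorem iSup_eq_top (h : IsDivisionGrading 𝒜) : iSup 𝒜 = ⊤ :=
  letI : DecidableEq G := Classical.decEq G
  h.isInternal.submodule_iSup_eq_top

theorem iSupIndep (h : IsDivisionGrading 𝒜) : iSupIndep 𝒜 :=
  letI : DecidableEq G := Classical.decEq G
  h.isInternal.submodule_iSupIndep

theorem eq_of_mem_of_mem (h : IsDivisionGrading 𝒜) {g g' : G} {x : R} (hx : x ∈ 𝒜 g)
    (hx' : x ∈ 𝒜 g') (h0 : x ≠ 0) : g = g' := by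
  by_contra hne
  exact h0 ((Submodule.disjoint_def.1 (h.iSupIndep.pairwiseDisjoint hne)) x hx hx')

theorem mul_ne_zero (h : IsDivisionGrading 𝒜) {g : G} {x y : R} (hx : x ∈ 𝒜 g) (hx0 : x ≠ 0)
    (hy0 : y ≠ 0) : x * y ≠ 0 := by
  rwa [Ne, (h.isUnit_of_mem g x hx hx0).mul_right_eq_zero]

theorem mul_right_cancel (h : IsDivisionGrading 𝒜) {g : G} {x y z : R} (hx : x ∈ 𝒜 g)
    (hx0 : x ≠ 0) (hyz : y * x = z * x) : y = z :=
  (h.isUnit_of_mem g x hx hx0).mul_right_cancel hyz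

/-- An element commuting with all homogeneous elements commutes with everything. -/
theorem commute_of_homogeneous (h : IsDivisionGrading 𝒜) {w : R}
    (hw : ∀ g, ∀ x ∈ 𝒜 g, x * w = w * x) (x : R) : x * w = w * x := by
  have hx : x ∈ iSup 𝒜 := h.iSup_eq_top ▸ Submodule.mem_top
  induction hx using Submodule.iSup_induction' with
  | mem g x hx => exact hw g x hx
  | zero => simp
  | add x y _ _ hx hy => rw [add_mul, mul_add, hx, hy]

theorem exists_real_of_commute [Algebra.IsCentral ℝ R] {w : R} (hw : ∀ x : R, x * w = w * x) :
    ∃ r : ℝ, w = r • 1 := by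
  have : w ∈ Subalgebra.center ℝ R := Subalgebra.mem_center_iff.2 hw
  rw [Algebra.IsCentral.center_eq_bot, Algebra.mem_bot] at this
  obtain ⟨r, hr⟩ := this
  exact ⟨r, by rw [← hr, Algebra.algebraMap_eq_smul_one]⟩

variable [FiniteDimensional ℝ R]

theorem finite (h : IsDivisionGrading 𝒜) (h2 : ∀ g, Module.finrank ℝ (𝒜 g) = 2) : Finite G := by
  refine WellFoundedGT.finite_of_iSupIndep h.iSupIndep fun g hg => ?_
  have := h2 g
  rw [hg, finrank_bot] at this
  omega

theorem finrank_eq (h : IsDivisionGrading 𝒜) (h2 : ∀ g, Module.finrank ℝ (𝒜 g) = 2) :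
    Module.finrank ℝ R = Nat.card G * 2 := by
  let _ : DecidableEq G := Classical.decEq G
  have := h.finite h2
  let _ := Fintype.ofFinite G
  have e := LinearEquiv.ofBijective (DirectSum.coeLinearMap 𝒜) h.isInternal
  rw [← e.finrank_eq, Module.finrank_directSum]
  simp [h2, Nat.card_eq_fintype_card]

/-- Right multiplication by the invertible `y` embeds the identity component in `𝒜 g`, and the
dimensions agree. Thus each component is a line over the identity component. -/
theorem exists_mul_eq (h : IsDivisionGrading 𝒜) (h2 : ∀ g, Module.finrank ℝ (𝒜 g) = 2) {g : G}
    {x y : R} (hy : y ∈ 𝒜 g) (hy0 : y ≠ 0) (hx : x ∈ 𝒜 g) : ∃ z ∈ 𝒜 0, x = z * y := by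
  have hm : (𝒜 0).map (LinearMap.mulRight ℝ y) = 𝒜 g := by
    refine Submodule.eq_of_le_of_finrank_eq ?_ ?_
    · rintro _ ⟨z, hz, rfl⟩
      simpa using h.mul_mem hz hy
    · have hinj : Function.Injective (LinearMap.mulRight ℝ y) := fun a b hab =>
        h.mul_right_cancel hy hy0 hab
      rw [← (Submodule.equivMapOfInjective _ hinj (𝒜 0)).finrank_eq, h2, h2]
  rw [← hm] at hx
  obtain ⟨z, hz, rfl⟩ := hx
  exact ⟨z, hz, rfl⟩

end IsDivisionGrading

/-- A square root of `-1` in the identity component which, with `1`, spans it. -/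
structure IsComplexUnit (𝒜 : G → Submodule ℝ R) (i : R) : Prop where
  mem : i ∈ 𝒜 0
  sq : i * i = -1
  span : ∀ z ∈ 𝒜 0, ∃ p q : ℝ, z = p • 1 + q • i

namespace IsDivisionGrading

variable [FiniteDimensional ℝ R]

theorem exists_complexUnit (h : IsDivisionGrading 𝒜) (h2 : ∀ g, Module.finrank ℝ (𝒜 g) = 2) :
    ∃ i, IsComplexUnit 𝒜 i := by
  have h1 := one_ne_zero_of_finrank_eq_two h2
  obtain ⟨w, hw, hw1⟩ : ∃ w ∈ 𝒜 0, w ∉ Submodule.span ℝ {(1 : R)} := by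
    by_contra! hc
    have := Submodule.finrank_mono (show 𝒜 0 ≤ Submodule.span ℝ {(1 : R)} from hc)
    rw [h2, finrank_span_singleton h1] at this
    omega
  have hspan : ∀ v ∈ 𝒜 0, v ∉ Submodule.span ℝ {(1 : R)} →
      ∀ z ∈ 𝒜 0, ∃ p q : ℝ, z = p • 1 + q • v := by
    intro v hv hv1 z hz
    have hli : LinearIndependent ℝ ![v, (1 : R)] := by
      refine LinearIndependent.pair_iff.2 fun s t hst => ?_
      have hs : s = 0 := by
        by_contra hs
        refine hv1 (Submodule.mem_span_singleton.2 ⟨-(s⁻¹ * t), ?_⟩)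
        have : v = s⁻¹ • (s • v + t • (1 : R)) - (s⁻¹ * t) • (1 : R) := by
          rw [smul_add, smul_smul, smul_smul, inv_mul_cancel₀ hs]; module
        rw [this, hst]; module
      subst hs
      simpa [h1] using hst
    have hle : Submodule.span ℝ (Set.range ![v, (1 : R)]) ≤ 𝒜 0 := by
      rw [Submodule.span_le]
      rintro _ ⟨j, rfl⟩
      fin_cases j
      · exact hv
      · exact h.one_mem
    have heq := Submodule.eq_of_le_of_finrank_eq hle (by
      rw [finrank_span_eq_card hli, h2]; rfl)
    rw [← heq] at hz
    simp only [Matrix.range_cons, Matrix.range_empty, Set.union_empty, Set.singleton_union] at hz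
    obtain ⟨a, b, hab⟩ := Submodule.mem_span_pair.1 hz
    exact ⟨b, a, by rw [← hab, add_comm]⟩
  obtain ⟨a, b, hab⟩ := hspan w hw hw1 (w * w) (by simpa using h.mul_mem hw hw)
  -- Completing the square in `w² = a + b w` makes `v²` real.
  set v : R := w - (b / 2) • 1 with hv
  have hvmem : v ∈ 𝒜 0 := Submodule.sub_mem _ hw (Submodule.smul_mem _ _ h.one_mem)
  have hv1 : ∀ r : ℝ, v - r • 1 ≠ 0 := by
    intro r hr
    refine hw1 (Submodule.mem_span_singleton.2 ⟨r + b / 2, ?_⟩)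
    rw [sub_eq_zero] at hr
    rw [add_smul, ← hr, hv]; abel
  have hvv : v * v = (a + b ^ 2 / 4) • 1 := by
    simp only [hv, sub_mul, mul_sub, smul_mul_assoc, mul_smul_comm, one_mul, mul_one, hab]
    module
  -- Otherwise `v² = s²` gives `(v - s)(v + s) = 0` with both factors nonzero and homogeneous of
  -- degree zero, hence invertible.
  have hneg : a + b ^ 2 / 4 < 0 := by
    by_contra! hc
    set s := Real.sqrt (a + b ^ 2 / 4) with hs
    have hss : s * s = a + b ^ 2 / 4 := Real.mul_self_sqrt hc
    have hm : ∀ r : ℝ, v - r • 1 ∈ 𝒜 0 := fun r =>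
      Submodule.sub_mem _ hvmem (Submodule.smul_mem _ _ h.one_mem)
    refine h.mul_ne_zero (hm s) (hv1 s) (hv1 (-s)) ?_
    simp only [sub_mul, mul_sub, smul_mul_assoc, mul_smul_comm, one_mul, mul_one, hvv, ← hss]
    module
  set s := Real.sqrt (-(a + b ^ 2 / 4)) with hs
  have hss : s * s = -(a + b ^ 2 / 4) := Real.mul_self_sqrt (by linarith)
  have hs0 : s ≠ 0 := (Real.sqrt_pos.2 (by linarith)).ne'
  refine ⟨s⁻¹ • v, Submodule.smul_mem _ _ hvmem, ?_, hspan _ (Submodule.smul_mem _ _ hvmem) ?_⟩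
  · rw [smul_mul_assoc, mul_smul_comm, hvv, smul_smul, smul_smul]
    have : s⁻¹ * s⁻¹ * (a + b ^ 2 / 4) = -1 := by
      rw [show a + b ^ 2 / 4 = -(s * s) by linarith]; field_simp
    rw [this]; module
  · intro hmem
    obtain ⟨r, hr⟩ := Submodule.mem_span_singleton.1 hmem
    refine hv1 (s * r) ?_
    rw [mul_smul, hr, smul_smul, mul_inv_cancel₀ hs0, one_smul, sub_self]

end IsDivisionGrading

end Structure

/-! ### Elements fixed by conjugation with `i` and `u`. -/

/-- A nonzero homogeneous element of degree `g` commuting with `i` and `u`. -/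
structure IsFixed {G R : Type*} [Ring R] [Algebra ℝ R] (𝒜 : G → Submodule ℝ R) (i u : R) (g : G)
    (x : R) : Prop where
  mem : x ∈ 𝒜 g
  ne_zero : x ≠ 0
  comm_i : x * i = i * x
  comm_u : x * u = u * x

/-- A nonzero homogeneous element of degree `g` anticommuting with `i`. -/
structure IsConjugation {G R : Type*} [Ring R] [Algebra ℝ R] (𝒜 : G → Submodule ℝ R) (i : R) (g : G)
    (u : R) : Prop where
  mem : u ∈ 𝒜 g
  ne_zero : u ≠ 0
  anti : u * i = -(i * u)

theorem exists_smul_mul_self_eq {R : Type*} [Ring R] [Algebra ℝ R] {w : R} {r : ℝ} (hr : r ≠ 0)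
    (hw : w * w = r • 1) :
    ∃ c : ℝ, c ≠ 0 ∧ ((c • w) * (c • w) = 1 ∨ (c • w) * (c • w) = -1) := by
  have habs : 0 < |r| := abs_pos.2 hr
  have hs : Real.sqrt |r| * Real.sqrt |r| = |r| := Real.mul_self_sqrt habs.le
  have hs0 : Real.sqrt |r| ≠ 0 := (Real.sqrt_pos.2 habs).ne'
  refine ⟨(Real.sqrt |r|)⁻¹, inv_ne_zero hs0, ?_⟩
  rw [smul_mul_assoc, mul_smul_comm, hw, smul_smul, smul_smul, ← mul_inv, hs]
  rcases abs_choice r with h | h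
  · left; rw [h, inv_mul_cancel₀ hr, one_smul]
  · right; rw [h, inv_neg, neg_mul, inv_mul_cancel₀ hr, neg_smul, one_smul]

theorem IsFixed.smul {G R : Type*} [Ring R] [Algebra ℝ R] {𝒜 : G → Submodule ℝ R} {i u : R}
    {s : G} {x : R} (hx : IsFixed 𝒜 i u s x) {c : ℝ} (hc : c ≠ 0) :
    IsFixed 𝒜 i u s (c • x) where
  mem := Submodule.smul_mem _ _ hx.mem
  ne_zero := smul_ne_zero hc hx.ne_zero
  comm_i := by rw [smul_mul_assoc, hx.comm_i, mul_smul_comm]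
  comm_u := by rw [smul_mul_assoc, hx.comm_u, mul_smul_comm]

theorem IsConjugation.smul {G R : Type*} [Ring R] [Algebra ℝ R] {𝒜 : G → Submodule ℝ R} {i : R}
    {s : G} {x : R} (hx : IsConjugation 𝒜 i s x) {c : ℝ} (hc : c ≠ 0) :
    IsConjugation 𝒜 i s (c • x) where
  mem := Submodule.smul_mem _ _ hx.mem
  ne_zero := smul_ne_zero hc hx.ne_zero
  anti := by rw [smul_mul_assoc, hx.anti, mul_smul_comm, smul_neg]

theorem IsConjugation.mul_commute {G R : Type*} [Ring R] [Algebra ℝ R]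
    {𝒜 : G → Submodule ℝ R} {i u : R} {g₀ g : G} (hu : IsConjugation 𝒜 i g₀ u) {y : R}
    (hy : IsConjugation 𝒜 i g y) : u * y * i = i * (u * y) := by
  rw [mul_assoc, hy.anti, mul_neg, ← mul_assoc, hu.anti, neg_mul, neg_neg, mul_assoc]

theorem pow_mul_eq {R : Type*} [Ring R] [Algebra ℝ R] {r : ℝ} {a x : R} (hax : a * x = r • (x * a)) (n : ℕ) :
    a ^ n * x = r ^ n • (x * a ^ n) := by
  induction n with
  | zero => simp
  | succ n ih =>
    rw [pow_succ, mul_assoc, hax, mul_smul_comm, ← mul_assoc, ih, smul_mul_assoc, smul_smul,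
      mul_assoc, ← pow_succ']

/-- Conjugation by `u` acts on the identity component as complex conjugation. -/
theorem IsConjugation.mul_smul_add {G R : Type*} [Ring R] [Algebra ℝ R]
    {𝒜 : G → Submodule ℝ R} {g₀ : G} {i u : R} (hu : IsConjugation 𝒜 i g₀ u) (p q : ℝ) :
    u * (p • (1 : R) + q • i) = (p • (1 : R) - q • i) * u := by
  rw [mul_add, sub_mul, mul_smul_comm, mul_smul_comm, hu.anti, smul_mul_assoc, smul_mul_assoc,
    one_mul, mul_one, smul_neg, sub_eq_add_neg]

section Structure

variable {G R : Type*} [AddCommGroup G] [Ring R] [Algebra ℝ R] {𝒜 : G → Submodule ℝ R} {i u : R}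
  {g₀ : G}

theorem IsComplexUnit.eq_zero (hi : IsComplexUnit 𝒜 i) (h1 : (1 : R) ≠ 0) {p q : ℝ}
    (h : p • (1 : R) + q • i = 0) : p = 0 ∧ q = 0 := by
  have : (p ^ 2 + q ^ 2) • (1 : R) = (p • 1 - q • i) * (p • (1 : R) + q • i) := by
    simp only [sub_mul, mul_add, smul_mul_assoc, mul_smul_comm, one_mul, mul_one, hi.sq]
    module
  rw [h, mul_zero, smul_eq_zero, or_iff_left h1] at this
  constructor <;> nlinarith [sq_nonneg p, sq_nonneg q]

theorem IsComplexUnit.commute_of_mem (hi : IsComplexUnit 𝒜 i) {x z : R} (hx : x * i = i * x)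
    (hz : z ∈ 𝒜 0) : x * z = z * x := by
  obtain ⟨p, q, rfl⟩ := hi.span z hz
  simp only [mul_add, add_mul, mul_smul_comm, smul_mul_assoc, mul_one, one_mul, hx]

theorem IsFixed.mul (h : IsDivisionGrading 𝒜) {s t : G} {x y : R} (hx : IsFixed 𝒜 i u s x)
    (hy : IsFixed 𝒜 i u t y) : IsFixed 𝒜 i u (s + t) (x * y) where
  mem := h.mul_mem hx.mem hy.mem
  ne_zero := h.mul_ne_zero hx.mem hx.ne_zero hy.ne_zero
  comm_i := by rw [mul_assoc, hy.comm_i, ← mul_assoc, hx.comm_i, mul_assoc]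
  comm_u := by rw [mul_assoc, hy.comm_u, ← mul_assoc, hx.comm_u, mul_assoc]

theorem IsDivisionGrading.pow_card_mem [Finite G] (h : IsDivisionGrading 𝒜) {g : G} {x : R} (hx : x ∈ 𝒜 g) :
    x ^ Nat.card G ∈ 𝒜 0 := by
  simpa [card_nsmul_eq_zero'] using h.pow_mem hx (Nat.card G)

/-- The power `a ^ |G|` has degree zero, so it commutes with `x`, which commutes with `i`; moving it
past `x` also produces the factor `r ^ |G|`. This is the only source of the constraints `|r| = 1`
below. -/
theorem IsDivisionGrading.pow_card_eq_one [Finite G] (h : IsDivisionGrading 𝒜) (hi : IsComplexUnit 𝒜 i) {r : ℝ}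
    {s : G} {a x : R} (ha : a ∈ 𝒜 s) (ha0 : a ≠ 0) (hx0 : x ≠ 0)
    (hxi : x * i = i * x) (hax : a * x = r • (x * a)) : r ^ Nat.card G = 1 := by
  have h1 := pow_mul_eq hax (Nat.card G)
  rw [← hi.commute_of_mem hxi (h.pow_card_mem ha)] at h1
  have h0 : x * a ^ Nat.card G ≠ 0 := by
    rwa [Ne, ((h.isUnit_of_mem s a ha ha0).pow _).mul_left_eq_zero]
  by_contra hne
  refine h0 ((smul_eq_zero.1 (?_ : (1 - r ^ Nat.card G) • (x * a ^ Nat.card G) = 0)).resolve_left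
    (sub_ne_zero.2 (Ne.symm hne)))
  rw [sub_smul, one_smul, ← h1, sub_self]

theorem IsDivisionGrading.exists_real_of_commute_conjugation (h : IsDivisionGrading 𝒜)
    (h2 : ∀ g, Module.finrank ℝ (𝒜 g) = 2) (hi : IsComplexUnit 𝒜 i)
    (hu : IsConjugation 𝒜 i g₀ u) {z : R} (hz : z ∈ 𝒜 0) (hzu : u * z = z * u) :
    ∃ p : ℝ, z = p • 1 := by
  obtain ⟨p, q, rfl⟩ := hi.span z hz
  rw [hu.mul_smul_add] at hzu
  have h0 := sub_eq_zero.2 (h.mul_right_cancel hu.mem hu.ne_zero hzu)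
  have : (0 : ℝ) • (1 : R) + (-2 * q) • i = 0 := by rw [← h0]; module
  have hq : q = 0 := by
    linarith [(hi.eq_zero (one_ne_zero_of_finrank_eq_two h2) this).2]
  exact ⟨p, by rw [hq, zero_smul, add_zero]⟩

variable [FiniteDimensional ℝ R]

namespace IsDivisionGrading

/-- Writing `y * i = z * y` with `z` in the identity component, `i² = -1` forces `z² = -1`, and in ℂ
this means `z = ±i`. The sign is the same on the whole component, a line over ℂ. -/
theorem commute_or_anticommute (h : IsDivisionGrading 𝒜)
    (h2 : ∀ g, Module.finrank ℝ (𝒜 g) = 2) (hi : IsComplexUnit 𝒜 i) (g : G) :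
    (∀ x ∈ 𝒜 g, x * i = i * x) ∨ (∀ x ∈ 𝒜 g, x * i = -(i * x)) := by
  obtain ⟨y, hy, hy0⟩ := exists_ne_zero_of_finrank_eq_two h2 g
  obtain ⟨z, hz, hyz⟩ := h.exists_mul_eq h2 hy hy0 (by simpa using h.mul_mem hy hi.mem)
  obtain ⟨p, q, rfl⟩ := hi.span z hz
  have hzz : (p • (1 : R) + q • i) * (p • (1 : R) + q • i) = -1 := by
    refine h.mul_right_cancel hy hy0 ?_
    rw [mul_assoc, ← hyz, ← mul_assoc, ← hyz, mul_assoc, hi.sq]; simp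
  have hpq : (p ^ 2 - q ^ 2 + 1) • (1 : R) + (2 * p * q) • i = 0 := by
    rw [← sub_eq_zero] at hzz
    rw [← hzz]
    simp only [add_mul, mul_add, smul_mul_assoc, mul_smul_comm, one_mul, mul_one, hi.sq]
    module
  obtain ⟨e1, e2⟩ := hi.eq_zero (one_ne_zero_of_finrank_eq_two h2) hpq
  have hp : p = 0 := by
    rcases mul_eq_zero.1 e2 with e | e
    · linarith
    · subst e; nlinarith [sq_nonneg p]
  subst hp
  have key : ∀ x ∈ 𝒜 g, x * i = q • (i * x) := by
    intro x hx
    obtain ⟨w, hw, rfl⟩ := h.exists_mul_eq h2 hy hy0 hx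
    rw [mul_assoc, hyz, ← mul_assoc i, hi.commute_of_mem rfl hw, ← mul_assoc]
    simp [mul_assoc]
  rcases mul_self_eq_one_iff.1 (show q * q = 1 by nlinarith) with rfl | rfl
  · left; simpa using key
  · right; simpa using key

/-- If no component anticommuted with `i`, then `i` would be central and hence real. -/
theorem exists_conjugation [Algebra.IsCentral ℝ R] (h : IsDivisionGrading 𝒜)
    (h2 : ∀ g, Module.finrank ℝ (𝒜 g) = 2) (hi : IsComplexUnit 𝒜 i) :
    ∃ g u, IsConjugation 𝒜 i g u := by
  by_contra! hc
  have h1 := one_ne_zero_of_finrank_eq_two h2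
  obtain ⟨r, hr⟩ := exists_real_of_commute (w := i) (h.commute_of_homogeneous fun g => by
    rcases h.commute_or_anticommute h2 hi g with hg | hg
    · exact hg
    · obtain ⟨y, hy, hy0⟩ := exists_ne_zero_of_finrank_eq_two h2 g
      exact absurd ⟨hy, hy0, hg y hy⟩ (hc g y))
  have := (hi.eq_zero h1 (p := r) (q := -1) (by rw [hr]; module)).2
  norm_num at this

/-- Hilbert's Theorem 90 for ℂ over ℝ: if `u * x = a * x * u` with `|a| = 1`, a suitable complex
multiple of `x` commutes with `u`. -/
theorem exists_isFixed (h : IsDivisionGrading 𝒜) (h2 : ∀ g, Module.finrank ℝ (𝒜 g) = 2)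
    (hi : IsComplexUnit 𝒜 i) (hu : IsConjugation 𝒜 i g₀ u) {g : G} {x : R} (hx : x ∈ 𝒜 g)
    (hx0 : x ≠ 0) (hxi : x * i = i * x) : ∃ y, IsFixed 𝒜 i u g y := by
  have := h.finite h2
  obtain ⟨a, ha, hax⟩ := h.exists_mul_eq h2 (h.mul_mem hx hu.mem)
    (h.mul_ne_zero hx hx0 hu.ne_zero) (add_comm g₀ g ▸ h.mul_mem hu.mem hx)
  obtain ⟨p, q, rfl⟩ := hi.span a ha
  have hnorm : (p • (1 : R) - q • i) * (p • (1 : R) + q • i) = (p ^ 2 + q ^ 2) • (1 : R) := by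
    simp only [sub_mul, mul_add, smul_mul_assoc, mul_smul_comm, one_mul, mul_one, hi.sq]
    module
  -- Moving `u` past `x` twice multiplies by `a` and its conjugate, so `u²` moves past `x` at the
  -- cost of the real number `|a|²`, which is then a root of unity.
  have huux : u * u * x = (p ^ 2 + q ^ 2) • (x * (u * u)) := by
    rw [mul_assoc, hax, ← mul_assoc, hu.mul_smul_add, mul_assoc, ← mul_assoc u, hax, mul_assoc, ← mul_assoc,
      hnorm, smul_mul_assoc, one_mul, mul_assoc]
  have hr : p ^ 2 + q ^ 2 = 1 := by
    have := h.pow_card_eq_one hi (h.mul_mem hu.mem hu.mem)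
      (h.mul_ne_zero hu.mem hu.ne_zero hu.ne_zero) hx0 hxi huux
    exact (pow_eq_one_iff_of_nonneg (by positivity) Nat.card_pos.ne').1 this
  -- The multiplier `1 + a` works unless it vanishes; for `a = -1` the multiplier `i` does.
  by_cases hp : p = -1 ∧ q = 0
  · obtain ⟨rfl, rfl⟩ := hp
    have hux : u * x = -(x * u) := by simpa using hax
    have hi0 : i ≠ 0 := by
      rintro rfl
      exact one_ne_zero_of_finrank_eq_two h2 (by simpa using hi.sq)
    refine ⟨i * x, by simpa using h.mul_mem hi.mem hx, h.mul_ne_zero hi.mem hi0 hx0, ?_, ?_⟩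
    · rw [mul_assoc, hxi]
    · rw [← mul_assoc u, hu.anti, neg_mul, mul_assoc i u, hux, mul_assoc, mul_neg, neg_neg]
  · set b : R := (1 + p) • 1 + q • i with hb
    have hbmem : b ∈ 𝒜 0 := Submodule.add_mem _ (Submodule.smul_mem _ _ h.one_mem)
      (Submodule.smul_mem _ _ hi.mem)
    have hb0 : b ≠ 0 := by
      intro h0
      obtain ⟨e1, e2⟩ := hi.eq_zero (one_ne_zero_of_finrank_eq_two h2) h0
      exact hp ⟨by linarith, e2⟩
    refine ⟨b * x, by simpa using h.mul_mem hbmem hx, h.mul_ne_zero hbmem hb0 hx0, ?_, ?_⟩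
    · rw [mul_assoc, hxi, ← mul_assoc, ← hi.commute_of_mem rfl hbmem, mul_assoc]
    · rw [← mul_assoc u, hb, hu.mul_smul_add, mul_assoc _ u, hax, ← mul_assoc _ _ (x * u), mul_assoc _ x]
      congr 1
      -- With `b = 1 + a` and `|a| = 1`, the conjugate of `b` times `a` equals `a + |a|² = b`.
      have : ((1 + p) • (1 : R) - q • i) * (p • (1 : R) + q • i) =
          (p • (1 : R) + q • i) + (p ^ 2 + q ^ 2) • (1 : R) := by
        simp only [sub_mul, mul_add, smul_mul_assoc, mul_smul_comm, one_mul, mul_one, hi.sq]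
        module
      rw [this, hr]; module

/-- The elements `i`, `u` and the fixed elements generate the algebra: a component commuting with
`i` is ℂ times a fixed element, and `u` carries every other component into one of these. So such a
`w` is central. -/
theorem exists_real_of_commute_isFixed [Algebra.IsCentral ℝ R] (h : IsDivisionGrading 𝒜)
    (h2 : ∀ g, Module.finrank ℝ (𝒜 g) = 2) (hi : IsComplexUnit 𝒜 i)
    (hu : IsConjugation 𝒜 i g₀ u) {w : R} (hwi : i * w = w * i) (hwu : u * w = w * u)
    (hw : ∀ g x, IsFixed 𝒜 i u g x → x * w = w * x) : ∃ r : ℝ, w = r • 1 := by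
  have key : ∀ g, ∀ y ∈ 𝒜 g, y ≠ 0 → y * i = i * y → y * w = w * y := by
    intro g y hy hy0 hyi
    obtain ⟨x, hx⟩ := h.exists_isFixed h2 hi hu hy hy0 hyi
    obtain ⟨z, hz, rfl⟩ := h.exists_mul_eq h2 hx.mem hx.ne_zero hy
    rw [mul_assoc, hw g x hx, ← mul_assoc, ← hi.commute_of_mem hwi.symm hz, mul_assoc]
  refine exists_real_of_commute (h.commute_of_homogeneous fun g y hy => ?_)
  by_cases hy0 : y = 0
  · simp [hy0]
  rcases h.commute_or_anticommute h2 hi g with hg | hg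
  · exact key g y hy hy0 (hg y hy)
  · have := key _ _ (h.mul_mem hu.mem hy) (h.mul_ne_zero hu.mem hu.ne_zero hy0)
      (IsConjugation.mul_commute hu ⟨hy, hy0, hg y hy⟩)
    rw [mul_assoc, ← mul_assoc w, ← hwu, mul_assoc] at this
    exact (h.isUnit_of_mem _ _ hu.mem hu.ne_zero).mul_left_cancel this

/-- The commutator of two fixed elements lies in the identity component and commutes with `u`, so it
is real; it is also a root of unity. -/
theorem isFixed_commute_or_anticommute (h : IsDivisionGrading 𝒜)
    (h2 : ∀ g, Module.finrank ℝ (𝒜 g) = 2) (hi : IsComplexUnit 𝒜 i)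
    (hu : IsConjugation 𝒜 i g₀ u) {s t : G} {x y : R} (hx : IsFixed 𝒜 i u s x)
    (hy : IsFixed 𝒜 i u t y) : x * y = y * x ∨ x * y = -(y * x) := by
  have := h.finite h2
  obtain ⟨z, hz, hxy⟩ := h.exists_mul_eq h2 (hy.mul h hx).mem (hy.mul h hx).ne_zero
    (add_comm s t ▸ (hx.mul h hy).mem)
  have hzu : u * z = z * u := by
    refine h.mul_right_cancel (hy.mul h hx).mem (hy.mul h hx).ne_zero ?_
    rw [mul_assoc, ← hxy, ← (hx.mul h hy).comm_u, hxy, mul_assoc, (hy.mul h hx).comm_u, mul_assoc]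
  obtain ⟨p, rfl⟩ := h.exists_real_of_commute_conjugation h2 hi hu hz hzu
  have hxy' : x * y = p • (y * x) := by simpa using hxy
  have hp := h.pow_card_eq_one hi hx.mem hx.ne_zero hy.ne_zero hy.comm_i hxy'
  have : |p| = 1 := by
    have hp' : |p| ^ Nat.card G = 1 := by rw [← abs_pow, hp, abs_one]
    exact (pow_eq_one_iff_of_nonneg (abs_nonneg p) Nat.card_pos.ne').1 hp'
  rcases eq_or_eq_neg_of_abs_eq this with rfl | rfl
  · left; simpa using hxy'
  · right; simpa using hxy'

/-- The signs arising when `x` is moved past a fixed element cancel in `x²`, which is therefore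
central. -/
theorem isFixed_sq [Algebra.IsCentral ℝ R] (h : IsDivisionGrading 𝒜)
    (h2 : ∀ g, Module.finrank ℝ (𝒜 g) = 2) (hi : IsComplexUnit 𝒜 i)
    (hu : IsConjugation 𝒜 i g₀ u) {s : G} {x : R} (hx : IsFixed 𝒜 i u s x) :
    ∃ r : ℝ, r ≠ 0 ∧ x * x = r • 1 := by
  obtain ⟨r, hr⟩ := h.exists_real_of_commute_isFixed h2 hi hu (hx.mul h hx).comm_i.symm
    (hx.mul h hx).comm_u.symm fun g y hy => by
      rcases h.isFixed_commute_or_anticommute h2 hi hu hx hy with e | e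
      · rw [mul_assoc, e, ← mul_assoc, ← mul_assoc, e]
      · rw [mul_assoc, e, mul_neg, ← mul_assoc, ← mul_assoc, e, neg_mul, neg_neg]
  refine ⟨r, ?_, hr⟩
  rintro rfl
  exact (hx.mul h hx).ne_zero (by rw [hr, zero_smul])

theorem conjugation_sq [Algebra.IsCentral ℝ R] (h : IsDivisionGrading 𝒜)
    (h2 : ∀ g, Module.finrank ℝ (𝒜 g) = 2) (hi : IsComplexUnit 𝒜 i)
    (hu : IsConjugation 𝒜 i g₀ u) : ∃ r : ℝ, r ≠ 0 ∧ u * u = r • 1 := by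
  obtain ⟨r, hr⟩ := h.exists_real_of_commute_isFixed h2 hi hu
    (IsConjugation.mul_commute hu hu).symm (mul_assoc u u u).symm fun g y hy => by
      rw [← mul_assoc, hy.comm_u, mul_assoc, hy.comm_u, mul_assoc]
  refine ⟨r, ?_, hr⟩
  rintro rfl
  exact h.mul_ne_zero hu.mem hu.ne_zero hu.ne_zero (by rw [hr, zero_smul])

/-- Every component contains an element whose square is a nonzero real number, hence of degree zero.
-/
theorem add_self_eq_zero [Algebra.IsCentral ℝ R] (h : IsDivisionGrading 𝒜)
    (h2 : ∀ g, Module.finrank ℝ (𝒜 g) = 2) (g : G) : g + g = 0 := by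
  obtain ⟨i, hi⟩ := h.exists_complexUnit h2
  obtain ⟨g₀, u, hu⟩ := h.exists_conjugation h2 hi
  obtain ⟨y, hy, hy0⟩ := exists_ne_zero_of_finrank_eq_two h2 g
  obtain ⟨x, hx, r, hr0, hr⟩ : ∃ x ∈ 𝒜 g, ∃ r : ℝ, r ≠ 0 ∧ x * x = r • 1 := by
    rcases h.commute_or_anticommute h2 hi g with hg | hg
    · obtain ⟨x, hx⟩ := h.exists_isFixed h2 hi hu hy hy0 (hg y hy)
      exact ⟨x, hx.mem, h.isFixed_sq h2 hi hu hx⟩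
    · exact ⟨y, hy, h.conjugation_sq h2 hi ⟨hy, hy0, hg y hy⟩⟩
  refine h.eq_of_mem_of_mem (h.mul_mem hx hx) (hr ▸ Submodule.smul_mem _ _ h.one_mem) ?_
  rw [hr]
  exact smul_ne_zero hr0 (one_ne_zero_of_finrank_eq_two h2)

theorem isFixed_unique (h : IsDivisionGrading 𝒜)
    (h2 : ∀ g, Module.finrank ℝ (𝒜 g) = 2) (hi : IsComplexUnit 𝒜 i)
    (hu : IsConjugation 𝒜 i g₀ u) {s : G} {x y : R} (hx : IsFixed 𝒜 i u s x)
    (hy : IsFixed 𝒜 i u s y) : ∃ r : ℝ, r ≠ 0 ∧ y = r • x := by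
  obtain ⟨z, hz, hyx⟩ := h.exists_mul_eq h2 hx.mem hx.ne_zero hy.mem
  have hzu : u * z = z * u := by
    refine h.mul_right_cancel hx.mem hx.ne_zero ?_
    rw [mul_assoc, ← hyx, ← hy.comm_u, hyx, mul_assoc, hx.comm_u, mul_assoc]
  obtain ⟨p, rfl⟩ := h.exists_real_of_commute_conjugation h2 hi hu hz hzu
  rw [smul_mul_assoc, one_mul] at hyx
  refine ⟨p, ?_, hyx⟩
  rintro rfl
  exact hy.ne_zero (by rw [hyx, zero_smul])

end IsDivisionGrading

end Structure

/-! ### Nondegenerate quadratic forms over ℤ/2. -/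

section QuadraticForms

theorem zmod_two_eq (a : ZMod 2) : a = 0 ∨ a = 1 := by
  revert a; decide

variable {T : Type*} [AddCommGroup T] [Module (ZMod 2) T]

/-- A quadratic form over `ℤ/2` with nondegenerate polar form `β`. -/
structure IsNondegQuadratic (β : T →ₗ[ZMod 2] T →ₗ[ZMod 2] ZMod 2) (q : T → ZMod 2) : Prop where
  map_add : ∀ x y, q (x + y) = q x + q y + β x y
  nondeg : ∀ x, (∀ y, β x y = 0) → x = 0

variable {β : T →ₗ[ZMod 2] T →ₗ[ZMod 2] ZMod 2} {q : T → ZMod 2}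

namespace IsNondegQuadratic

theorem map_zero (h : IsNondegQuadratic β q) : q 0 = 0 := by
  have := h.map_add 0 0
  simpa using this

theorem polar_self (h : IsNondegQuadratic β q) (x : T) : β x x = 0 := by
  have := h.map_add x x
  rwa [ZModModule.add_self, h.map_zero, CharTwo.add_self_eq_zero, zero_add, eq_comm] at this

theorem polar_comm (h : IsNondegQuadratic β q) (x y : T) : β x y = β y x := by
  have h1 := h.map_add x y
  rw [add_comm x y, h.map_add y x, add_comm (q y)] at h1
  exact (add_left_cancel h1).symm

theorem map_smul_add_smul (h : IsNondegQuadratic β q) {v w : T} (hvw : β v w = 1) (a b : ZMod 2) :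
    q (a • v + b • w) = a * q v + b * q w + a * b := by
  rcases zmod_two_eq a with rfl | rfl <;> rcases zmod_two_eq b with rfl | rfl <;>
    simp [h.map_zero, h.map_add, hvw]

end IsNondegQuadratic

/-- The orthogonal complement of two vectors. -/
abbrev orthoPair (β : T →ₗ[ZMod 2] T →ₗ[ZMod 2] ZMod 2) (v w : T) : Submodule (ZMod 2) T :=
  LinearMap.ker (β v) ⊓ LinearMap.ker (β w)

/-- A nonorthogonal pair of vectors splits off. -/
def splitPair (h : IsNondegQuadratic β q) {v w : T} (hvw : β v w = 1) :
    (ZMod 2 × ZMod 2) × orthoPair β v w ≃+ T where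
  toFun x := x.1.1 • v + x.1.2 • w + x.2
  invFun x := ((β w x, β v x), ⟨x - (β w x • v + β v x • w), by
    have hwv : β w v = 1 := by rw [h.polar_comm, hvw]
    constructor <;> simp [hvw, hwv, h.polar_self]⟩)
  left_inv := by
    rintro ⟨⟨a, b⟩, ⟨s, hs⟩⟩
    have hwv : β w v = 1 := by rw [h.polar_comm, hvw]
    have h1 : β v s = 0 := hs.1
    have h2 : β w s = 0 := hs.2
    simp [hvw, hwv, h.polar_self, h1, h2]
  right_inv x := by simp
  map_add' x y := by
    simp only [Prod.fst_add, Prod.snd_add, add_smul, Submodule.coe_add]; abel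

theorem splitPair_apply (h : IsNondegQuadratic β q) {v w : T} (hvw : β v w = 1) (a b : ZMod 2)
    (s : orthoPair β v w) : splitPair h hvw ((a, b), s) = a • v + b • w + s := rfl

namespace IsNondegQuadratic

theorem map_splitPair (h : IsNondegQuadratic β q) {v w : T} (hvw : β v w = 1) (a b : ZMod 2)
    (s : orthoPair β v w) :
    q (splitPair h hvw ((a, b), s)) = a * q v + b * q w + a * b + q s := by
  have h1 : β v s = 0 := s.2.1
  have h2 : β w s = 0 := s.2.2
  rw [splitPair_apply, h.map_add, h.map_smul_add_smul hvw]
  simp [h1, h2]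

/-- The restriction of a form to the orthogonal complement of a nonorthogonal pair. -/
theorem restrict (h : IsNondegQuadratic β q) {v w : T} (hvw : β v w = 1) :
    IsNondegQuadratic (T := orthoPair β v w)
      (β.compl₁₂ (orthoPair β v w).subtype (orthoPair β v w).subtype) (fun s => q s) where
  map_add x y := h.map_add x y
  nondeg x hx := by
    have h1 : β v x = 0 := x.2.1
    have h2 : β w x = 0 := x.2.2
    rw [h.polar_comm] at h1 h2
    refine Subtype.ext (h.nondeg x fun y => ?_)
    obtain ⟨⟨⟨a, b⟩, s⟩, rfl⟩ := (splitPair h hvw).surjective y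
    have h3 : β x s = 0 := hx s
    rw [splitPair_apply]
    simp [h1, h2, h3]

theorem exists_pair (h : IsNondegQuadratic β q) {v : T} (hv : v ≠ 0) : ∃ w, β v w = 1 := by
  by_contra! hc
  exact hv (h.nondeg v fun y => (zmod_two_eq _).resolve_right (hc y))

end IsNondegQuadratic

/-- Splitting off the first coordinate. -/
def finSuccAddEquiv (k : ℕ) (X : Type*) [AddCommGroup X] : (Fin (k + 1) → X) ≃+ X × (Fin k → X) where
  toFun v := (v 0, fun j => v j.succ)
  invFun p := Fin.cons p.1 p.2
  left_inv v := by funext j; refine Fin.cases ?_ (fun j => ?_) j <;> simp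
  right_inv p := by simp
  map_add' _ _ := rfl

/-- Nondegenerate quadratic forms over `ℤ/2` are orthogonal sums of hyperbolic planes and at most one
anisotropic plane. -/
theorem IsNondegQuadratic.exists_normal_form (n : ℕ) : ∀ {T : Type*} [AddCommGroup T]
    [Module (ZMod 2) T] [Finite T] {β : T →ₗ[ZMod 2] T →ₗ[ZMod 2] ZMod 2} {q : T → ZMod 2}
    (_ : IsNondegQuadratic β q) (_ : Nat.card T = n),
    ∃ k, (∃ e : (Fin k → ZMod 2 × ZMod 2) ≃+ T, ∀ v, q (e v) = ∑ j, (v j).1 * (v j).2) ∨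
      (∃ e : (Fin k → ZMod 2 × ZMod 2) × (ZMod 2 × ZMod 2) ≃+ T, ∀ v w,
        q (e (v, w)) = ∑ j, (v j).1 * (v j).2 + (w.1 + w.2 + w.1 * w.2)) := by
  induction n using Nat.strong_induction_on with
  | _ n ih =>
  intro T _ _ _ β q h hn
  by_cases hT : Subsingleton T
  · refine ⟨0, Or.inl ⟨⟨⟨fun _ => 0, fun _ => 0, fun _ => Subsingleton.elim _ _,
      fun _ => Subsingleton.elim _ _⟩, fun _ _ => Subsingleton.elim _ _⟩, fun v => ?_⟩⟩
    simpa using h.map_zero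
  rw [not_subsingleton_iff_nontrivial] at hT
  -- Isotropic vectors are used up first, so the anisotropic plane can occur only once, at the
  -- bottom of the induction.
  by_cases hiso : ∃ v : T, v ≠ 0 ∧ q v = 0
  · obtain ⟨v, hv, hqv⟩ := hiso
    obtain ⟨w, hvw, hqw⟩ : ∃ w, β v w = 1 ∧ q w = 0 := by
      obtain ⟨w, hw⟩ := h.exists_pair hv
      rcases zmod_two_eq (q w) with h0 | h1
      · exact ⟨w, hw, h0⟩
      -- If `q w = 1`, replacing `w` by `v + w` keeps the pairing with `v` and changes `q` by `q v +
      -- β v w = 1`.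
      · refine ⟨v + w, by rw [_root_.map_add, h.polar_self, hw, zero_add], ?_⟩
        rw [h.map_add, hqv, h1, hw]; decide
    have hcard : Nat.card (orthoPair β v w) < n := by
      have h1 := Nat.card_congr (splitPair h hvw).toEquiv
      rw [Nat.card_prod, Nat.card_prod, Nat.card_zmod, hn] at h1
      have : 0 < Nat.card (orthoPair β v w) := Nat.card_pos
      omega
    have hq : ∀ a s, q (splitPair h hvw (a, s)) = a.1 * a.2 + q s := by
      rintro ⟨a, b⟩ s
      rw [h.map_splitPair, hqv, hqw]; simp
    obtain ⟨k, ⟨e, he⟩ | ⟨e, he⟩⟩ := ih _ hcard (h.restrict hvw) rfl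
    · refine ⟨k + 1, Or.inl ⟨(finSuccAddEquiv k _).trans
        (((AddEquiv.refl _).prodCongr e).trans (splitPair h hvw)), fun x => ?_⟩⟩
      rw [Fin.sum_univ_succ, ← he]
      exact hq _ _
    · refine ⟨k + 1, Or.inr ⟨((finSuccAddEquiv k _).prodCongr (AddEquiv.refl _)).trans
        (AddEquiv.prodAssoc.trans
          (((AddEquiv.refl _).prodCongr e).trans (splitPair h hvw))), fun x y => ?_⟩⟩
      rw [Fin.sum_univ_succ, add_assoc, ← he]
      exact hq _ _
  · push Not at hiso
    obtain ⟨v, hv⟩ := exists_ne (0 : T)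
    obtain ⟨w, hvw⟩ := h.exists_pair hv
    have hq1 : ∀ x : T, x ≠ 0 → q x = 1 := fun x hx => (zmod_two_eq _).resolve_left (hiso x hx)
    have hw : w ≠ 0 := by rintro rfl; simp at hvw
    -- An anisotropic form lives on a plane at most: for nonzero `s` orthogonal to `v` and `w`, the
    -- vector `v + s` would be isotropic since `1 + 1 + 0 = 0`, and it is nonzero because it pairs
    -- with `w` to `1`.
    have hsub : ∀ s : orthoPair β v w, s = 0 := by
      intro s
      by_contra hs
      have h1 : β v s = 0 := s.2.1
      refine hiso (v + s) ?_ ?_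
      · intro h0
        have : β (v + s) w = 0 := by rw [h0]; simp
        rw [_root_.map_add, LinearMap.add_apply, hvw, h.polar_comm, show β w s = 0 from s.2.2] at this
        exact absurd this (by decide)
      · rw [h.map_add, h1, hq1 v hv, hq1 s (by simpa using hs)]; decide
    have : Subsingleton (orthoPair β v w) := ⟨fun a b => (hsub a).trans (hsub b).symm⟩
    let e₀ : (Fin 0 → ZMod 2 × ZMod 2) × (ZMod 2 × ZMod 2) ≃+
        (ZMod 2 × ZMod 2) × orthoPair β v w :=
      { toFun := fun x => (x.2, 0)
        invFun := fun x => (0, x.1)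
        left_inv := fun x => Prod.ext (Subsingleton.elim _ _) rfl
        right_inv := fun x => Prod.ext rfl (Subsingleton.elim _ _)
        map_add' := fun x y => Prod.ext rfl (Subsingleton.elim _ _) }
    refine ⟨0, Or.inr ⟨e₀.trans (splitPair h hvw), fun x y => ?_⟩⟩
    change q (splitPair h hvw ((y.1, y.2), 0)) = _
    rw [h.map_splitPair, hq1 v hv, hq1 w hw]
    simp [h.map_zero]

end QuadraticForms

/-! ### Homomorphisms out of the building blocks and their tensor products. -/

section Homs

variable {R : Type*} [Ring R] [Algebra ℝ R]

/-- The homomorphism `M₂(ℝ) → R` sending `A` to `a` and `B` to `b`. -/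
noncomputable def m2Hom (a b : R) (ha : a * a = 1) (hb : b * b = 1) (hab : b * a = -(a * b)) :
    Matrix (Fin 2) (Fin 2) ℝ →ₐ[ℝ] R :=
  AlgHom.ofLinearMap
    { toFun := fun M => ((M 0 0 + M 1 1) / 2) • 1 + ((M 0 0 - M 1 1) / 2) • a +
        ((M 0 1 + M 1 0) / 2) • b + ((M 0 1 - M 1 0) / 2) • (a * b)
      map_add' := fun M N => by simp only [Matrix.add_apply]; module
      map_smul' := fun r M => by
        simp only [Matrix.smul_apply, smul_eq_mul, RingHom.id_apply]; module }
    (by simp)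
    (by
      intro M N
      have h1 : a * (a * b) = b := by rw [← mul_assoc, ha, one_mul]
      have h2 : b * (a * b) = -a := by rw [← mul_assoc, hab, neg_mul, mul_assoc, hb, mul_one]
      have h3 : a * b * a = -b := by rw [mul_assoc, hab, mul_neg, h1]
      have h4 : a * b * b = a := by rw [mul_assoc, hb, mul_one]
      have h5 : a * b * (a * b) = -1 := by rw [mul_assoc, h2, mul_neg, ha]
      simp only [LinearMap.coe_mk, AddHom.coe_mk, Matrix.mul_apply, Fin.sum_univ_two, add_mul,
        mul_add, smul_mul_assoc, mul_smul_comm, one_mul, mul_one, ha, hb, hab, h1, h2, h3, h4, h5]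
      module)

section

variable {a b : R} {ha : a * a = 1} {hb : b * b = 1} {hab : b * a = -(a * b)}

theorem m2Hom_apply (M : Matrix (Fin 2) (Fin 2) ℝ) :
    m2Hom a b ha hb hab M = ((M 0 0 + M 1 1) / 2) • 1 + ((M 0 0 - M 1 1) / 2) • a +
        ((M 0 1 + M 1 0) / 2) • b + ((M 0 1 - M 1 0) / 2) • (a * b) := rfl

theorem m2Hom_sylA : m2Hom a b ha hb hab sylA = a := by
  simp [m2Hom_apply, sylA]

theorem m2Hom_sylB : m2Hom a b ha hb hab sylB = b := by
  simp [m2Hom_apply, sylB]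

theorem m2Hom_sylC : m2Hom a b ha hb hab sylC = a * b := by
  simp [m2Hom_apply, sylC]

theorem commute_m2Hom {z : R} (hza : Commute z a) (hzb : Commute z b)
    (M : Matrix (Fin 2) (Fin 2) ℝ) : Commute z (m2Hom a b ha hb hab M) := by
  rw [m2Hom_apply]
  exact ((((Commute.one_right z).smul_right _).add_right (hza.smul_right _)).add_right
    (hzb.smul_right _)).add_right ((hza.mul_right hzb).smul_right _)

end

/-- The homomorphism `ℍ → R` sending `i` to `a` and `j` to `b`. -/
noncomputable def hHom (a b : R) (ha : a * a = -1) (hb : b * b = -1) (hab : b * a = -(a * b)) :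
    ℍ[ℝ] →ₐ[ℝ] R :=
  QuaternionAlgebra.lift (R := ℝ) (c₁ := -1) (c₂ := 0) (c₃ := -1)
    { i := a
      j := b
      k := a * b
      i_mul_i := by rw [ha]; module
      j_mul_j := by rw [hb]; module
      i_mul_j := rfl
      j_mul_i := by rw [hab]; module }

section

variable {a b : R} {ha : a * a = -1} {hb : b * b = -1} {hab : b * a = -(a * b)}

theorem hHom_apply (x : ℍ[ℝ]) :
    hHom a b ha hb hab x = x.re • 1 + x.imI • a + x.imJ • b + x.imK • (a * b) := by
  change algebraMap ℝ R x.re + _ + _ + _ = _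
  rw [Algebra.algebraMap_eq_smul_one]

theorem hHom_qI : hHom a b ha hb hab qI = a := by
  rw [hHom_apply]; simp [qI]

theorem hHom_qJ : hHom a b ha hb hab qJ = b := by
  rw [hHom_apply]; simp [qJ]

theorem hHom_qK : hHom a b ha hb hab qK = a * b := by
  rw [hHom_apply]; simp [qK]

theorem commute_hHom {z : R} (hza : Commute z a) (hzb : Commute z b) (x : ℍ[ℝ]) :
    Commute z (hHom a b ha hb hab x) := by
  rw [hHom_apply]
  exact ((((Commute.one_right z).smul_right _).add_right (hza.smul_right _)).add_right
    (hzb.smul_right _)).add_right ((hza.mul_right hzb).smul_right _)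

end

/-- This gives multiplicativity of `powHom`: only factors with different indices have to be
interchanged. -/
theorem prod_ofFn_mul {M : Type*} [Monoid M] : ∀ {k : ℕ} (x y : Fin k → M),
    (∀ j l, j ≠ l → Commute (y j) (x l)) →
    (List.ofFn fun j => x j * y j).prod = (List.ofFn x).prod * (List.ofFn y).prod
  | 0, _, _, _ => by simp
  | k + 1, x, y, h => by
    rw [List.ofFn_succ, List.ofFn_succ, List.ofFn_succ, List.prod_cons, List.prod_cons,
      List.prod_cons, prod_ofFn_mul (fun j => x j.succ) (fun j => y j.succ)
        fun j l hjl => h _ _ (by simpa using hjl)]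
    have : Commute (y 0) (List.ofFn fun j : Fin k => x j.succ).prod :=
      Commute.list_prod_right _ _ fun z hz => by
        obtain ⟨j, rfl⟩ := List.mem_ofFn.1 hz
        exact h _ _ (Fin.succ_ne_zero j).symm
    rw [mul_assoc, mul_assoc, ← mul_assoc (y 0), this.eq, mul_assoc]

variable {M : Type*} [Ring M] [Algebra ℝ M] {k : ℕ}

/-- The homomorphism from a tensor power given by pairwise commuting homomorphisms. -/
noncomputable def powHom (f : Fin k → M →ₐ[ℝ] R)
    (hf : ∀ j l, j ≠ l → ∀ x y, Commute (f j x) (f l y)) : (⨂[ℝ] _ : Fin k, M) →ₐ[ℝ] R :=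
  PiTensorProduct.liftAlgHom
    ((MultilinearMap.mkPiAlgebraFin ℝ k R).compLinearMap fun j => (f j).toLinearMap)
    (by simp)
    (fun x y => by
      simp only [MultilinearMap.compLinearMap_apply, MultilinearMap.mkPiAlgebraFin_apply,
        Pi.mul_apply, AlgHom.toLinearMap_apply, map_mul]
      exact prod_ofFn_mul _ _ fun j l hjl => hf j l hjl _ _)

theorem powHom_tprod (f : Fin k → M →ₐ[ℝ] R)
    (hf : ∀ j l, j ≠ l → ∀ x y, Commute (f j x) (f l y)) (x : Fin k → M) :
    powHom f hf (PiTensorProduct.tprod ℝ x) = (List.ofFn fun j => f j (x j)).prod := by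
  simp [powHom]

theorem commute_powHom {f : Fin k → M →ₐ[ℝ] R}
    {hf : ∀ j l, j ≠ l → ∀ x y, Commute (f j x) (f l y)} {z : R}
    (hz : ∀ j x, Commute z (f j x)) (t : ⨂[ℝ] _ : Fin k, M) : Commute z (powHom f hf t) := by
  induction t using PiTensorProduct.induction_on with
  | smul_tprod r x =>
    rw [map_smul, powHom_tprod]
    refine (Commute.list_prod_right _ _ fun w hw => ?_).smul_right r
    obtain ⟨j, rfl⟩ := List.mem_ofFn.1 hw
    exact hz j _
  | add x y hx hy => rw [map_add]; exact hx.add_right hy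

theorem commute_tensorLift {S S' : Type*} [Ring S] [Algebra ℝ S] [Ring S'] [Algebra ℝ S']
    {f : S →ₐ[ℝ] R} {g : S' →ₐ[ℝ] R} {hfg : ∀ x y, Commute (f x) (g y)} {z : R}
    (hf : ∀ x, Commute z (f x)) (hg : ∀ x, Commute z (g x)) (t : S ⊗[ℝ] S') :
    Commute z (Algebra.TensorProduct.lift f g hfg t) := by
  induction t using TensorProduct.induction_on with
  | zero => rw [map_zero]; exact Commute.zero_right z
  | tmul x y => rw [Algebra.TensorProduct.lift_tmul]; exact (hf x).mul_right (hg y)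
  | add x y hx hy => rw [map_add]; exact hx.add_right hy

/-! ### Homomorphisms and gradings -/

variable {G : Type*} [AddCommGroup G] {𝒜 : G → Submodule ℝ R}

theorem powHom_mem {H : Type*} (h : SetLike.GradedMonoid 𝒜) {ℬ : H → Submodule ℝ M}
    {f : Fin k → M →ₐ[ℝ] R} {hf : ∀ j l, j ≠ l → ∀ x y, Commute (f j x) (f l y)}
    {σ : Fin k → H → G} (hσ : ∀ j g, ∀ x ∈ ℬ g, f j x ∈ 𝒜 (σ j g)) (g : Fin k → H)
    {t : ⨂[ℝ] _ : Fin k, M} (ht : t ∈ tensorPowerGrading ℬ k g) :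
    powHom f hf t ∈ 𝒜 (∑ j, σ j (g j)) := by
  have : tensorPowerGrading ℬ k g ≤ (𝒜 (∑ j, σ j (g j))).comap (powHom f hf).toLinearMap := by
    refine Submodule.span_le.2 ?_
    rintro _ ⟨x, hx, rfl⟩
    simp only [Submodule.comap_coe, Set.mem_preimage, AlgHom.toLinearMap_apply, SetLike.mem_coe,
      powHom_tprod]
    rw [← List.sum_ofFn]
    exact SetLike.list_prod_ofFn_mem_graded _ _ fun j => hσ j _ _ (hx j)
  exact this ht

theorem tensorLift_mem {S S' H H' : Type*} [Ring S] [Algebra ℝ S] [Ring S'] [Algebra ℝ S']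
    (h : SetLike.GradedMonoid 𝒜) {ℬ : H → Submodule ℝ S} {ℬ' : H' → Submodule ℝ S'}
    {f : S →ₐ[ℝ] R} {f' : S' →ₐ[ℝ] R} {hf : ∀ x y, Commute (f x) (f' y)} {σ : H → G} {σ' : H' → G}
    (hσ : ∀ g, ∀ x ∈ ℬ g, f x ∈ 𝒜 (σ g)) (hσ' : ∀ g, ∀ x ∈ ℬ' g, f' x ∈ 𝒜 (σ' g)) (g : H × H')
    {t : S ⊗[ℝ] S'} (ht : t ∈ tensorGrading ℬ ℬ' g) :
    Algebra.TensorProduct.lift f f' hf t ∈ 𝒜 (σ g.1 + σ' g.2) := by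
  have : tensorGrading ℬ ℬ' g ≤
      (𝒜 (σ g.1 + σ' g.2)).comap (Algebra.TensorProduct.lift f f' hf).toLinearMap := by
    refine Submodule.map₂_le.2 fun x hx y hy => ?_
    simp only [Submodule.mem_comap, AlgHom.toLinearMap_apply, TensorProduct.mk_apply,
      Algebra.TensorProduct.lift_tmul]
    exact h.mul_mem (hσ _ _ hx) (hσ' _ _ hy)
  exact this ht

end Homs

/-! ### Bases of the building blocks -/

/-- The homogeneous basis vectors `I, A, B, C` of `M₂⁽⁴⁾`. -/
noncomputable def m2Unit (p : ZMod 2 × ZMod 2) : Matrix (Fin 2) (Fin 2) ℝ :=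
  if p = (0, 0) then 1 else if p = (1, 0) then sylA else if p = (0, 1) then sylB else sylC

/-- The homogeneous basis vectors `1, i, j, k` of `ℍ⁽⁴⁾`. -/
noncomputable def hUnit (p : ZMod 2 × ZMod 2) : ℍ[ℝ] :=
  if p = (0, 0) then 1 else if p = (1, 0) then qI else if p = (0, 1) then qJ else qK

theorem m2Four_eq (p : ZMod 2 × ZMod 2) : m2Four p = Submodule.span ℝ {m2Unit p} := by
  unfold m2Four m2Unit; split_ifs <;> rfl

theorem hFour_eq (p : ZMod 2 × ZMod 2) : hFour p = Submodule.span ℝ {hUnit p} := by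
  unfold hFour hUnit; split_ifs <;> rfl

theorem sylA_mul_self : sylA * sylA = 1 := by
  ext i j; fin_cases i <;> fin_cases j <;> simp [sylA, Matrix.mul_apply]

theorem sylB_mul_self : sylB * sylB = 1 := by
  ext i j; fin_cases i <;> fin_cases j <;> simp [sylB, Matrix.mul_apply]

theorem sylC_mul_self : sylC * sylC = -1 := by
  ext i j; fin_cases i <;> fin_cases j <;> simp [sylC, Matrix.mul_apply]

theorem sylA_mul_sylB : sylA * sylB = sylC := by
  ext i j; fin_cases i <;> fin_cases j <;> simp [sylA, sylB, sylC, Matrix.mul_apply]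

theorem sylB_mul_sylA : sylB * sylA = -sylC := by
  ext i j; fin_cases i <;> fin_cases j <;> simp [sylA, sylB, sylC, Matrix.mul_apply]

/-- The standard basis of the quaternions. -/
abbrev quaternionBasis : QuaternionAlgebra.Basis ℍ[ℝ] (-1 : ℝ) 0 (-1) :=
  QuaternionAlgebra.Basis.self ℝ

theorem qI_mul_self : qI * qI = -1 :=
  quaternionBasis.i_mul_i.trans (by module)

theorem qJ_mul_self : qJ * qJ = -1 :=
  quaternionBasis.j_mul_j.trans (by module)

theorem qK_mul_self : qK * qK = -1 :=
  quaternionBasis.k_mul_k.trans (by module)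

theorem qI_mul_qJ : qI * qJ = qK :=
  quaternionBasis.i_mul_j

theorem qJ_mul_qI : qJ * qI = -qK :=
  quaternionBasis.j_mul_i.trans (by simp only [zero_smul, zero_sub]; rfl)

theorem isUnit_of_mul_self {M : Type*} [Ring M] {x : M} (h : x * x = 1 ∨ x * x = -1) :
    IsUnit x := by
  rcases h with h | h
  · exact ⟨⟨x, x, h, h⟩, rfl⟩
  · exact ⟨⟨x, -x, by rw [mul_neg, h, neg_neg], by rw [neg_mul, h, neg_neg]⟩, rfl⟩

theorem isUnit_sylA : IsUnit sylA := isUnit_of_mul_self (Or.inl sylA_mul_self)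

theorem isUnit_m2Unit (p : ZMod 2 × ZMod 2) : IsUnit (m2Unit p) := by
  unfold m2Unit
  split_ifs
  · exact isUnit_one
  · exact isUnit_sylA
  · exact isUnit_of_mul_self (Or.inl sylB_mul_self)
  · exact isUnit_of_mul_self (Or.inr sylC_mul_self)

theorem isUnit_hUnit (p : ZMod 2 × ZMod 2) : IsUnit (hUnit p) := by
  unfold hUnit
  split_ifs
  · exact isUnit_one
  · exact isUnit_of_mul_self (Or.inr qI_mul_self)
  · exact isUnit_of_mul_self (Or.inr qJ_mul_self)
  · exact isUnit_of_mul_self (Or.inr qK_mul_self)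

theorem isUnit_tmul {S S' : Type*} [Ring S] [Algebra ℝ S] [Ring S'] [Algebra ℝ S'] {x : S} {y : S'}
    (hx : IsUnit x) (hy : IsUnit y) : IsUnit (x ⊗ₜ[ℝ] y) := by
  have h1 := hx.map (Algebra.TensorProduct.includeLeft (R := ℝ) (S := ℝ) (A := S) (B := S'))
  have h2 := hy.map (Algebra.TensorProduct.includeRight (R := ℝ) (A := S) (B := S'))
  simpa using h1.mul h2

theorem isUnit_tprod {M : Type*} [Ring M] [Algebra ℝ M] {k : ℕ} {x : Fin k → M}
    (hx : ∀ j, IsUnit (x j)) : IsUnit (PiTensorProduct.tprod ℝ x) :=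
  (Pi.isUnit_iff.2 hx).map (PiTensorProduct.tprodMonoidHom ℝ)

theorem tmul_mem_tensorGrading {G H S S' : Type*} [Ring S] [Algebra ℝ S] [Ring S'] [Algebra ℝ S']
    {𝒜 : G → Submodule ℝ S} {ℬ : H → Submodule ℝ S'} {g : G} {h : H} {x : S} {y : S'}
    (hx : x ∈ 𝒜 g) (hy : y ∈ ℬ h) : x ⊗ₜ[ℝ] y ∈ tensorGrading 𝒜 ℬ (g, h) :=
  Submodule.apply_mem_map₂ _ hx hy

theorem tprod_mem_tensorPowerGrading {G S : Type*} [Ring S] [Algebra ℝ S]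
    {𝒜 : G → Submodule ℝ S} {k : ℕ} {g : Fin k → G} {x : Fin k → S} (hx : ∀ j, x j ∈ 𝒜 (g j)) :
    PiTensorProduct.tprod ℝ x ∈ tensorPowerGrading 𝒜 k g :=
  Submodule.subset_span ⟨x, hx, rfl⟩

instance (k : ℕ) : Module.Finite ℝ (⨂[ℝ] _ : Fin k, Matrix (Fin 2) (Fin 2) ℝ) :=
  Module.Finite.of_basis (Basis.piTensorProduct fun _ => Matrix.stdBasis ℝ (Fin 2) (Fin 2))

theorem finrank_m2 : Module.finrank ℝ (Matrix (Fin 2) (Fin 2) ℝ) = 4 := by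
  simp [Module.finrank_matrix]

theorem finrank_tensorPower (k : ℕ) :
    Module.finrank ℝ (⨂[ℝ] _ : Fin k, Matrix (Fin 2) (Fin 2) ℝ) = 4 ^ k := by
  rw [Module.finrank_eq_card_basis
    (Basis.piTensorProduct fun _ => Matrix.stdBasis ℝ (Fin 2) (Fin 2))]
  simp

theorem finrank_typeI (k : ℕ) : Module.finrank ℝ
    (Matrix (Fin 2) (Fin 2) ℝ ⊗[ℝ] (⨂[ℝ] _ : Fin k, Matrix (Fin 2) (Fin 2) ℝ)) = 4 * 4 ^ k := by
  rw [Module.finrank_tensorProduct, finrank_m2, finrank_tensorPower]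

theorem finrank_typeII (k : ℕ) : Module.finrank ℝ
    ((Matrix (Fin 2) (Fin 2) ℝ ⊗[ℝ] (⨂[ℝ] _ : Fin k, Matrix (Fin 2) (Fin 2) ℝ)) ⊗[ℝ] ℍ[ℝ]) =
      4 * 4 ^ k * 4 := by
  rw [Module.finrank_tensorProduct, finrank_typeI, Quaternion.finrank_eq_four]

/-- The sign `(-1) ^ a`. -/
noncomputable def sgn (a : ZMod 2) : ℝ := if a = 0 then 1 else -1

theorem sgn_zero : sgn 0 = 1 := rfl

theorem sgn_one : sgn 1 = -1 := if_neg (by decide)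

theorem sgn_add (a b : ZMod 2) : sgn (a + b) = sgn a * sgn b := by
  have h2 : (1 + 1 : ZMod 2) = 0 := by decide
  rcases zmod_two_eq a with rfl | rfl <;> rcases zmod_two_eq b with rfl | rfl <;>
    simp [sgn_zero, sgn_one, h2]

theorem sgn_mul_self (a : ZMod 2) : sgn a * sgn a = 1 := by
  rw [← sgn_add, CharTwo.add_self_eq_zero, sgn_zero]

theorem sgn_injective : Function.Injective sgn := by
  intro a b hab
  rcases zmod_two_eq a with rfl | rfl <;> rcases zmod_two_eq b with rfl | rfl <;>
    first | rfl | (rw [sgn_zero, sgn_one] at hab; norm_num at hab)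

theorem eq_zero_of_eq_neg {R : Type*} [AddCommGroup R] [Module ℝ R] {x : R} (hx : x = -x) :
    x = 0 := by
  have : (2 : ℝ) • x = 0 := by
    rw [two_smul]; nth_rewrite 1 [hx]; exact neg_add_cancel x
  exact (smul_eq_zero.1 this).resolve_left two_ne_zero

/-! ### The quadratic form attached to a division grading. -/

section Structure

variable {G R : Type*} [AddCommGroup G] [Ring R] [Algebra ℝ R] {𝒜 : G → Submodule ℝ R} {i u : R}
  {g₀ : G}

/-- A family `X t`, `t ∈ T`, of fixed homogeneous elements whose squares and commutation signs are
given by a quadratic form `q` and its polar form `β`. -/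
structure IsQuadraticSystem (𝒜 : G → Submodule ℝ R) (i u : R) (T : AddSubgroup G)
    [Module (ZMod 2) T] (X : T → R) (β : T →ₗ[ZMod 2] T →ₗ[ZMod 2] ZMod 2) (q : T → ZMod 2) :
    Prop where
  form : IsNondegQuadratic β q
  fixed : ∀ t : T, IsFixed 𝒜 i u (t : G) (X t)
  sq : ∀ t : T, X t * X t = sgn (q t) • 1
  comm : ∀ s t : T, X s * X t = sgn (β s t) • (X t * X s)

namespace IsDivisionGrading

variable [FiniteDimensional ℝ R]

/-- A single nonzero element decides the sign of its component, since it cannot both commute and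
anticommute with the invertible `i`. -/
theorem commute_of_exists (h : IsDivisionGrading 𝒜)
    (h2 : ∀ g, Module.finrank ℝ (𝒜 g) = 2) (hi : IsComplexUnit 𝒜 i) {g : G} {x : R}
    (hx : x ∈ 𝒜 g) (hx0 : x ≠ 0) (hxi : x * i = i * x) : ∀ y ∈ 𝒜 g, y * i = i * y := by
  refine (h.commute_or_anticommute h2 hi g).resolve_right fun hg => ?_
  have h0 := eq_zero_of_eq_neg (hxi.symm.trans (hg x hx))
  rw [(isUnit_of_mul_self (Or.inr hi.sq)).mul_right_eq_zero] at h0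
  exact hx0 h0

variable [Algebra.IsCentral ℝ R]

/-- The degrees of the homogeneous elements commuting with `i`. -/
def commSubgroup (h : IsDivisionGrading 𝒜) (h2 : ∀ g, Module.finrank ℝ (𝒜 g) = 2)
    (hi : IsComplexUnit 𝒜 i) : AddSubgroup G where
  carrier := {g | ∀ x ∈ 𝒜 g, x * i = i * x}
  zero_mem' := fun _ hx => (hi.commute_of_mem rfl hx).symm
  add_mem' := by
    intro s t hs ht
    obtain ⟨x, hx, hx0⟩ := exists_ne_zero_of_finrank_eq_two h2 s
    obtain ⟨y, hy, hy0⟩ := exists_ne_zero_of_finrank_eq_two h2 t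
    refine h.commute_of_exists h2 hi (h.mul_mem hx hy) (h.mul_ne_zero hx hx0 hy0) ?_
    rw [mul_assoc, ht y hy, ← mul_assoc, hs x hx, mul_assoc]
  neg_mem' := by
    intro s hs
    rwa [neg_eq_of_add_eq_zero_left (h.add_self_eq_zero h2 s)]

theorem mem_commSubgroup (h : IsDivisionGrading 𝒜) (h2 : ∀ g, Module.finrank ℝ (𝒜 g) = 2)
    (hi : IsComplexUnit 𝒜 i) {g : G} {x : R} (hx : IsFixed 𝒜 i u g x) :
    g ∈ h.commSubgroup h2 hi :=
  h.commute_of_exists h2 hi hx.mem hx.ne_zero hx.comm_i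

theorem exists_isFixed_sq (h : IsDivisionGrading 𝒜) (h2 : ∀ g, Module.finrank ℝ (𝒜 g) = 2)
    (hi : IsComplexUnit 𝒜 i) (hu : IsConjugation 𝒜 i g₀ u) {g : G} {x : R}
    (hx : IsFixed 𝒜 i u g x) : ∃ y, IsFixed 𝒜 i u g y ∧ (y * y = 1 ∨ y * y = -1) := by
  obtain ⟨r, hr0, hr⟩ := h.isFixed_sq h2 hi hu hx
  obtain ⟨c, hc, hcx⟩ := exists_smul_mul_self_eq hr0 hr
  exact ⟨c • x, hx.smul hc, hcx⟩

/-- Source of nondegeneracy: a fixed element commuting with all fixed elements is central, hence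
real. -/
theorem degree_eq_zero_of_commute (h : IsDivisionGrading 𝒜)
    (h2 : ∀ g, Module.finrank ℝ (𝒜 g) = 2) (hi : IsComplexUnit 𝒜 i)
    (hu : IsConjugation 𝒜 i g₀ u) {g : G} {x : R} (hx : IsFixed 𝒜 i u g x)
    (hc : ∀ t y, IsFixed 𝒜 i u t y → y * x = x * y) : g = 0 := by
  obtain ⟨r, hr⟩ := h.exists_real_of_commute_isFixed h2 hi hu hx.comm_i.symm hx.comm_u.symm hc
  exact h.eq_of_mem_of_mem hx.mem (hr ▸ Submodule.smul_mem _ _ h.one_mem) hx.ne_zero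

theorem exists_quadraticSystem (h : IsDivisionGrading 𝒜)
    (h2 : ∀ g, Module.finrank ℝ (𝒜 g) = 2) (hi : IsComplexUnit 𝒜 i)
    (hu : IsConjugation 𝒜 i g₀ u) : ∃ (_ : Module (ZMod 2) (h.commSubgroup h2 hi))
      (X : h.commSubgroup h2 hi → R)
      (β : h.commSubgroup h2 hi →ₗ[ZMod 2] h.commSubgroup h2 hi →ₗ[ZMod 2] ZMod 2)
      (q : h.commSubgroup h2 hi → ZMod 2),
      IsQuadraticSystem 𝒜 i u (h.commSubgroup h2 hi) X β q := by
  set T := h.commSubgroup h2 hi with hT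
  let hmod : Module (ZMod 2) T := AddCommGroup.zmodModule fun x => by
    rw [two_nsmul]; exact Subtype.ext (h.add_self_eq_zero h2 x)
  have hX : ∀ t : T, ∃ y, IsFixed 𝒜 i u t y ∧ ∃ a, y * y = sgn a • 1 := by
    intro t
    obtain ⟨x, hx, hx0⟩ := exists_ne_zero_of_finrank_eq_two h2 t
    obtain ⟨y, hy⟩ := h.exists_isFixed h2 hi hu hx hx0 (t.2 x hx)
    obtain ⟨z, hz, hzz⟩ := h.exists_isFixed_sq h2 hi hu hy
    refine ⟨z, hz, ?_⟩
    rcases hzz with e | e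
    · exact ⟨0, by rw [e, sgn_zero, one_smul]⟩
    · exact ⟨1, by rw [e, sgn_one, neg_smul, one_smul]⟩
  choose X hXf q hq using hX
  have hb : ∀ s t : T, ∃ b, X s * X t = sgn b • (X t * X s) := by
    intro s t
    rcases h.isFixed_commute_or_anticommute h2 hi hu (hXf s) (hXf t) with e | e
    · exact ⟨0, by rw [e, sgn_zero, one_smul]⟩
    · exact ⟨1, by rw [e, sgn_one, neg_smul, one_smul]⟩
  choose b hb using hb
  have h0 : ∀ s t : T, X s * X t ≠ 0 := fun s t => ((hXf s).mul h (hXf t)).ne_zero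
  have hsgn : ∀ {a c : ZMod 2} {x : R}, x ≠ 0 → sgn a • x = sgn c • x → a = c :=
    fun hx hac => sgn_injective (smul_left_injective ℝ hx hac)
  have hsymm : ∀ s t, b s t = b t s := by
    intro s t
    refine hsgn (h0 t s) ?_
    rw [← hb s t, hb t s, smul_smul, sgn_mul_self, one_smul]
  have hprod : ∀ s t : T, ∃ r : ℝ, r ≠ 0 ∧ X (s + t) = r • (X s * X t) := fun s t =>
    h.isFixed_unique h2 hi hu ((hXf s).mul h (hXf t)) (hXf (s + t))
  -- `X (s + s')` is a real multiple of `X s * X s'`, and scalars do not affect commutation signs.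
  have hadd : ∀ s s' t, b (s + s') t = b s t + b s' t := by
    intro s s' t
    obtain ⟨r, hr0, hr⟩ := hprod s s'
    refine hsgn (h0 t (s + s')) ?_
    rw [← hb, hr, smul_mul_assoc, mul_assoc, hb s' t, mul_smul_comm, ← mul_assoc, hb s t,
      smul_mul_assoc, mul_smul_comm, mul_assoc, smul_smul, smul_smul, smul_smul, sgn_add]
    congr 1; ring
  let β : T →ₗ[ZMod 2] T →ₗ[ZMod 2] ZMod 2 :=
    ((AddMonoidHom.mk' (fun s => (AddMonoidHom.mk' (b s) fun t t' => by
      rw [hsymm, hadd, hsymm, hsymm t']).toZModLinearMap 2) fun s s' => by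
        ext t; exact hadd s s' t).toZModLinearMap 2)
  have hβ : ∀ s t, β s t = b s t := fun _ _ => rfl
  refine ⟨hmod, X, β, q, ⟨fun s t => ?_, fun s hs => ?_⟩, hXf, hq, hb⟩
  · obtain ⟨r, hr0, hr⟩ := hprod s t
    have h1 : (1 : R) ≠ 0 := one_ne_zero_of_finrank_eq_two h2
    -- Squaring `X (s + t) = r X s X t` and interchanging the two inner factors gives the quadratic
    -- identity up to the positive factor `r²`, which does not affect the sign.
    have e : sgn (q (s + t)) = r * r * (sgn (b s t) * (sgn (q s) * sgn (q t))) := by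
      refine smul_left_injective ℝ h1 ?_
      change sgn (q (s + t)) • (1 : R) = _ • (1 : R)
      rw [← hq, hr, smul_mul_assoc, mul_smul_comm, smul_smul, mul_assoc (X s), ← mul_assoc (X t),
        hb t s, hsymm t s, smul_mul_assoc, mul_smul_comm, mul_assoc (X s), hq t, mul_smul_comm,
        mul_smul_comm, mul_one, hq s, smul_smul, smul_smul, smul_smul]
      congr 1; ring
    rw [← sgn_add, ← sgn_add] at e
    have hr2 : 0 < r * r := mul_self_pos.2 hr0
    have : sgn (q (s + t)) = sgn (b s t + (q s + q t)) := by
      revert e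
      rcases zmod_two_eq (q (s + t)) with e1 | e1 <;>
        rcases zmod_two_eq (b s t + (q s + q t)) with e2 | e2 <;>
          rw [e1, e2] <;> first | exact fun _ => rfl | (rw [sgn_zero, sgn_one]; intro e; linarith)
    rw [sgn_injective this, hβ, add_comm]
  · refine Subtype.ext (h.degree_eq_zero_of_commute h2 hi hu (hXf s) fun t y hy => ?_)
    obtain ⟨r, hr0, hr⟩ := h.isFixed_unique h2 hi hu (hXf ⟨t, h.mem_commSubgroup h2 hi hy⟩) hy
    have := hb s ⟨t, h.mem_commSubgroup h2 hi hy⟩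
    rw [show b s _ = 0 from hs _, sgn_zero, one_smul] at this
    rw [hr, smul_mul_assoc, mul_smul_comm, this]

/-- The grading group is the direct sum of `⟨g₀⟩` and the degrees of elements commuting with
`i`. -/
theorem exists_addEquiv (h : IsDivisionGrading 𝒜) (h2 : ∀ g, Module.finrank ℝ (𝒜 g) = 2)
    (hi : IsComplexUnit 𝒜 i) (hu : IsConjugation 𝒜 i g₀ u) : ∃ τ : ZMod 2 →+ G, τ 1 = g₀ ∧
      ∃ α : ZMod 2 × h.commSubgroup h2 hi ≃+ G, ∀ p, α p = τ p.1 + p.2 := by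
  let _ : Module (ZMod 2) G := AddCommGroup.zmodModule fun x => by
    rw [two_nsmul]; exact h.add_self_eq_zero h2 x
  have hg₀ : g₀ ∉ h.commSubgroup h2 hi := by
    intro hg
    have h0 := eq_zero_of_eq_neg ((hg u hu.mem).symm.trans hu.anti)
    rw [(isUnit_of_mul_self (Or.inr hi.sq)).mul_right_eq_zero] at h0
    exact hu.ne_zero h0
  let τ : ZMod 2 →+ G := (LinearMap.toSpanSingleton (ZMod 2) G g₀).toAddMonoidHom
  have hτ : τ 1 = g₀ := one_smul (ZMod 2) g₀
  refine ⟨τ, hτ, AddEquiv.ofBijective (τ.coprod (h.commSubgroup h2 hi).subtype) ⟨?_, ?_⟩,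
    fun _ => rfl⟩
  · rw [injective_iff_map_eq_zero]
    rintro ⟨a, t⟩ hat
    change τ a + t = 0 at hat
    rcases zmod_two_eq a with rfl | rfl
    · rw [map_zero, zero_add] at hat
      exact Prod.ext rfl (Subtype.ext hat)
    · rw [hτ] at hat
      exact absurd (eq_neg_of_add_eq_zero_left hat ▸ neg_mem t.2) hg₀
  · intro g
    rcases h.commute_or_anticommute h2 hi g with hg | hg
    · exact ⟨(0, ⟨g, hg⟩), by simp⟩
    · obtain ⟨y, hy, hy0⟩ := exists_ne_zero_of_finrank_eq_two h2 g
      have := h.commute_of_exists h2 hi (h.mul_mem hu.mem hy)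
        (h.mul_ne_zero hu.mem hu.ne_zero hy0) (hu.mul_commute ⟨hy, hy0, hg y hy⟩)
      refine ⟨(1, ⟨g₀ + g, this⟩), ?_⟩
      simp only [AddMonoidHom.coprod_apply, hτ, AddSubgroup.subtype_apply]
      rw [← add_assoc, h.add_self_eq_zero h2, zero_add]

/-- The conjugation `u` can be chosen with `u² = 1` unless all fixed elements are real. -/
theorem exists_conjugation_sq (h : IsDivisionGrading 𝒜)
    (h2 : ∀ g, Module.finrank ℝ (𝒜 g) = 2) (hi : IsComplexUnit 𝒜 i) :
    ∃ g u, IsConjugation 𝒜 i g u ∧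
      (u * u = 1 ∨ (u * u = -1 ∧ ∀ t x, IsFixed 𝒜 i u t x → t = 0)) := by
  obtain ⟨g₀, u', hu'⟩ := h.exists_conjugation h2 hi
  obtain ⟨r, hr0, hr⟩ := h.conjugation_sq h2 hi hu'
  obtain ⟨c, hc, hcu⟩ := exists_smul_mul_self_eq hr0 hr
  have hu := hu'.smul hc
  set u := c • u' with hu_def
  rcases hcu with huu | huu
  · exact ⟨g₀, u, hu, Or.inl huu⟩
  by_cases hT : ∀ t x, IsFixed 𝒜 i u t x → t = 0
  · exact ⟨g₀, u, hu, Or.inr ⟨huu, hT⟩⟩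
  push Not at hT
  obtain ⟨s, x', hx', hs⟩ := hT
  obtain ⟨x, hx, hxx⟩ := h.exists_isFixed_sq h2 hi hu hx'
  obtain ⟨t, y, hy, hyx⟩ : ∃ t y, IsFixed 𝒜 i u t y ∧ y * x ≠ x * y := by
    by_contra! hc
    exact hs (h.degree_eq_zero_of_commute h2 hi hu hx hc)
  obtain ⟨y', hy', hyy⟩ := h.exists_isFixed_sq h2 hi hu hy
  have hyx' : y' * x = -(x * y') := by
    refine (h.isFixed_commute_or_anticommute h2 hi hu hy' hx).resolve_left fun e => hyx ?_
    obtain ⟨r, -, rfl⟩ := h.isFixed_unique h2 hi hu hy' hy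
    rw [smul_mul_assoc, e, mul_smul_comm]
  -- Some fixed element squares to `-1`: if `x² = y'² = 1` with `x` and `y'` anticommuting, then
  -- `(y' x)² = -1`.
  obtain ⟨v, z, hz, hzz⟩ : ∃ v z, IsFixed 𝒜 i u v z ∧ z * z = -1 := by
    rcases hxx with ex | ex
    · rcases hyy with ey | ey
      · refine ⟨_, _, hy'.mul h hx, ?_⟩
        rw [mul_assoc, ← mul_assoc x, ← neg_eq_iff_eq_neg.2 hyx', neg_mul, mul_neg, mul_assoc y',
          ex, mul_one, ey]
      · exact ⟨_, _, hy', ey⟩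
    · exact ⟨_, _, hx, ex⟩
  -- As `z` commutes with `u`, `(z u)² = z² u² = (-1)(-1) = 1`, and `z u` still anticommutes with
  -- `i`.
  refine ⟨v + g₀, z * u, ⟨h.mul_mem hz.mem hu.mem, h.mul_ne_zero hz.mem hz.ne_zero hu.ne_zero, ?_⟩,
    Or.inl ?_⟩
  · rw [mul_assoc, hu.anti, mul_neg, ← mul_assoc, hz.comm_i, mul_assoc]
  · rw [mul_assoc, ← mul_assoc u, ← hz.comm_u, mul_assoc z, huu, ← mul_assoc, hzz]; simp

end IsDivisionGrading

end Structure

/-! ### A criterion for weak isomorphism with a model. -/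

section Recognition

variable {G R : Type*} [AddCommGroup G] [Ring R] [Algebra ℝ R] {𝒜 : G → Submodule ℝ R}
  [FiniteDimensional ℝ R]

/-- A homomorphism compatible with gradings whose image contains a homogeneous unit of each degree
and a complex unit is a weak isomorphism. -/
theorem IsDivisionGrading.weaklyIsomorphic (h : IsDivisionGrading 𝒜)
    (h2 : ∀ g, Module.finrank ℝ (𝒜 g) = 2) {i : R} (hi : IsComplexUnit 𝒜 i)
    {H S : Type*} [AddCommGroup H] [Ring S] [Algebra ℝ S] [FiniteDimensional ℝ S]
    {ℬ : H → Submodule ℝ S} (f : S →ₐ[ℝ] R) (α : H ≃+ G) (hf : ∀ h, ∀ x ∈ ℬ h, f x ∈ 𝒜 (α h))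
    {c : S} (hc : f c = i) (hw : ∀ h, ∃ w ∈ ℬ h, IsUnit w ∧ c * w ∈ ℬ h)
    (hrank : Module.finrank ℝ S = Nat.card H * 2) : WeaklyIsomorphic 𝒜 ℬ := by
  have h1 : (1 : R) ≠ 0 := one_ne_zero_of_finrank_eq_two h2
  have : Nontrivial R := ⟨⟨1, 0, h1⟩⟩
  have hmap : ∀ a, (ℬ a).map f.toLinearMap = 𝒜 (α a) := by
    intro a
    refine le_antisymm (Submodule.map_le_iff_le_comap.2 fun x hx => hf a x hx) fun x hx => ?_
    -- The component is the identity component times the unit `f w`, and that is spanned by `f w`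
    -- and `i * f w = f (c * w)`.
    obtain ⟨w, hw, hwu, hcw⟩ := hw a
    obtain ⟨z, hz, rfl⟩ := h.exists_mul_eq h2 (hf a w hw) (hwu.map f).ne_zero hx
    obtain ⟨p, q, rfl⟩ := hi.span z hz
    refine ⟨p • w + q • (c * w), Submodule.add_mem _ (Submodule.smul_mem _ _ hw)
      (Submodule.smul_mem _ _ hcw), ?_⟩
    simp [hc, add_mul]
  have hsurj : Function.Surjective f.toLinearMap := by
    rw [← LinearMap.range_eq_top, eq_top_iff, ← h.iSup_eq_top]
    refine iSup_le fun g => ?_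
    obtain ⟨a, rfl⟩ := α.surjective g
    rw [← hmap]
    exact LinearMap.map_le_range
  have hdim : Module.finrank ℝ S = Module.finrank ℝ R := by
    rw [hrank, h.finrank_eq h2, Nat.card_congr α.toEquiv]
  have hinj := (LinearMap.injective_iff_surjective_of_finrank_eq_finrank hdim).2 hsurj
  let e : S ≃ₐ[ℝ] R := AlgEquiv.ofBijective f ⟨hinj, hsurj⟩
  refine ⟨α.symm, e.symm, fun g => ?_⟩
  obtain ⟨a, rfl⟩ := α.surjective g
  rw [AddEquiv.symm_apply_apply, ← hmap, ← Submodule.map_comp]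
  have : e.symm.toLinearMap ∘ₗ f.toLinearMap = LinearMap.id :=
    LinearMap.ext fun x => e.symm_apply_apply x
  rw [this, Submodule.map_id]

end Recognition

/-! ### Normal forms -/

/-- The sum of `k` hyperbolic planes. -/
def hyp {k : ℕ} (v : Fin k → ZMod 2 × ZMod 2) : ZMod 2 := ∑ j, (v j).1 * (v j).2

theorem hyp_single {k : ℕ} (j : Fin k) (p : ZMod 2 × ZMod 2) :
    hyp (Pi.single j p) = p.1 * p.2 := by
  rw [hyp, Finset.sum_eq_single j]
  · rw [Pi.single_eq_same]
  · intro l _ hl; rw [Pi.single_eq_of_ne hl]; rfl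
  · simp

theorem hyp_single_add_single {k : ℕ} {j l : Fin k} (hjl : j ≠ l) (p p' : ZMod 2 × ZMod 2) :
    hyp (Pi.single j p + Pi.single l p') = p.1 * p.2 + p'.1 * p'.2 := by
  rw [← hyp_single j, ← hyp_single l, hyp, hyp, hyp, ← Finset.sum_add_distrib]
  refine Finset.sum_congr rfl fun m _ => ?_
  rw [Pi.add_apply]
  by_cases hm : m = j
  · subst hm; rw [Pi.single_eq_of_ne hjl]; simp
  · rw [Pi.single_eq_of_ne hm]; simp

theorem hyp_zero {k : ℕ} : hyp (0 : Fin k → ZMod 2 × ZMod 2) = 0 := by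
  simp [hyp]

/-! ### Matching a division grading with the three models. -/

section Classification

variable {G R : Type*} [AddCommGroup G] [Ring R] [Algebra ℝ R] {𝒜 : G → Submodule ℝ R} {i u : R}
  {g₀ : G}

/-- A family of fixed elements indexed by a group `V`, with squares and commutation signs given by
a quadratic form `Q`. -/
structure IsFixedSystem (𝒜 : G → Submodule ℝ R) (i u : R) {V : Type*} [AddCommGroup V]
    (Q : V → ZMod 2) (σ : V →+ G) (Y : V → R) : Prop where
  fixed : ∀ v, IsFixed 𝒜 i u (σ v) (Y v)
  sq : ∀ v, Y v * Y v = sgn (Q v) • 1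
  comm : ∀ v w, Y v * Y w = sgn (Q (v + w) + Q v + Q w) • (Y w * Y v)

theorem IsQuadraticSystem.isFixedSystem {T : AddSubgroup G} [Module (ZMod 2) T] {X : T → R}
    {β : T →ₗ[ZMod 2] T →ₗ[ZMod 2] ZMod 2} {q : T → ZMod 2}
    (hX : IsQuadraticSystem 𝒜 i u T X β q) {V : Type*} [AddCommGroup V] (e : V ≃+ T) :
    IsFixedSystem 𝒜 i u (fun v => q (e v)) (T.subtype.comp e.toAddMonoidHom) (fun v => X (e v)) where
  fixed v := hX.fixed (e v)
  sq v := hX.sq (e v)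
  comm v w := by
    rw [hX.comm, map_add, hX.form.map_add]
    congr 2
    -- In characteristic two the polar form is recovered as `Q (v + w) + Q v + Q w`.
    have h2 : ∀ a b c : ZMod 2, c = a + b + c + a + b := by decide
    exact h2 _ _ _

namespace IsFixedSystem

variable {V : Type*} [AddCommGroup V] {Q : V → ZMod 2} {σ : V →+ G} {Y : V → R}

theorem sq_one (hY : IsFixedSystem 𝒜 i u Q σ Y) {v : V} (hv : Q v = 0) : Y v * Y v = 1 := by
  rw [hY.sq, hv, sgn_zero, one_smul]

theorem sq_neg_one (hY : IsFixedSystem 𝒜 i u Q σ Y) {v : V} (hv : Q v = 1) :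
    Y v * Y v = -1 := by
  rw [hY.sq, hv, sgn_one, neg_smul, one_smul]

theorem commute (hY : IsFixedSystem 𝒜 i u Q σ Y) {v w : V} (h : Q (v + w) = Q v + Q w) :
    Commute (Y v) (Y w) := by
  have := hY.comm v w
  have h2 : ∀ a b : ZMod 2, a + b + a + b = 0 := by decide
  rwa [h, h2, sgn_zero, one_smul] at this

theorem anticommute (hY : IsFixedSystem 𝒜 i u Q σ Y) {v w : V} (h : Q (v + w) = Q v + Q w + 1) :
    Y w * Y v = -(Y v * Y w) := by
  have := hY.comm v w
  have h2 : ∀ a b : ZMod 2, a + b + 1 + a + b = 1 := by decide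
  rw [h, h2, sgn_one, neg_smul, one_smul] at this
  rw [this, neg_neg]

end IsFixedSystem

theorem m2Hom_mem (h : SetLike.GradedMonoid 𝒜) {a b : R} {ha : a * a = 1} {hb : b * b = 1}
    {hab : b * a = -(a * b)} {σ : ZMod 2 × ZMod 2 →+ G} (ham : a ∈ 𝒜 (σ (1, 0)))
    (hbm : b ∈ 𝒜 (σ (0, 1))) (p : ZMod 2 × ZMod 2) (x : Matrix (Fin 2) (Fin 2) ℝ)
    (hx : x ∈ m2Four p) : m2Hom a b ha hb hab x ∈ 𝒜 (σ p) := by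
  rw [m2Four_eq, Submodule.mem_span_singleton] at hx
  obtain ⟨r, rfl⟩ := hx
  rw [map_smul]
  refine Submodule.smul_mem _ _ ?_
  obtain ⟨c, d⟩ := p
  rcases zmod_two_eq c with rfl | rfl <;> rcases zmod_two_eq d with rfl | rfl
  · rw [show m2Unit (0, 0) = 1 from rfl, map_one, show ((0 : ZMod 2), (0 : ZMod 2)) = 0 from rfl,
      map_zero]
    exact h.one_mem
  · rw [show m2Unit (0, 1) = sylB from rfl, m2Hom_sylB]; exact hbm
  · rw [show m2Unit (1, 0) = sylA from rfl, m2Hom_sylA]; exact ham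
  · rw [show m2Unit (1, 1) = sylC from rfl, m2Hom_sylC,
      show ((1 : ZMod 2), (1 : ZMod 2)) = (1, 0) + (0, 1) from rfl, map_add]
    exact h.mul_mem ham hbm

theorem hHom_mem (h : SetLike.GradedMonoid 𝒜) {a b : R} {ha : a * a = -1} {hb : b * b = -1}
    {hab : b * a = -(a * b)} {σ : ZMod 2 × ZMod 2 →+ G} (ham : a ∈ 𝒜 (σ (1, 0)))
    (hbm : b ∈ 𝒜 (σ (0, 1))) (p : ZMod 2 × ZMod 2) (x : ℍ[ℝ])
    (hx : x ∈ hFour p) : hHom a b ha hb hab x ∈ 𝒜 (σ p) := by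
  rw [hFour_eq, Submodule.mem_span_singleton] at hx
  obtain ⟨r, rfl⟩ := hx
  rw [map_smul]
  refine Submodule.smul_mem _ _ ?_
  obtain ⟨c, d⟩ := p
  rcases zmod_two_eq c with rfl | rfl <;> rcases zmod_two_eq d with rfl | rfl
  · rw [show hUnit (0, 0) = 1 from rfl, map_one, show ((0 : ZMod 2), (0 : ZMod 2)) = 0 from rfl,
      map_zero]
    exact h.one_mem
  · rw [show hUnit (0, 1) = qJ from rfl, hHom_qJ]; exact hbm
  · rw [show hUnit (1, 0) = qI from rfl, hHom_qI]; exact ham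
  · rw [show hUnit (1, 1) = qK from rfl, hHom_qK,
      show ((1 : ZMod 2), (1 : ZMod 2)) = (1, 0) + (0, 1) from rfl, map_add]
    exact h.mul_mem ham hbm

/-- The image of a two-dimensional component with basis `a, b`. -/
theorem map_mem_of_mem_span_pair {G R : Type*} [Ring R] [Algebra ℝ R] {𝒜 : G → Submodule ℝ R}
    {S : Type*} [Ring S] [Algebra ℝ S] {f : S →ₐ[ℝ] R} {x y z : S}
    {g : G} (hz : z ∈ Submodule.span ℝ {x, y}) (hx : f x ∈ 𝒜 g) (hy : f y ∈ 𝒜 g) : f z ∈ 𝒜 g := by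
  obtain ⟨r, s, rfl⟩ := Submodule.mem_span_pair.1 hz
  rw [map_add, map_smul, map_smul]
  exact Submodule.add_mem _ (Submodule.smul_mem _ _ hx) (Submodule.smul_mem _ _ hy)

/-- The homomorphism `M₂(ℝ) → R` with `A ↦ u` and `C ↦ i`. -/
noncomputable abbrev conjHom (hi : IsComplexUnit 𝒜 i) (hu : IsConjugation 𝒜 i g₀ u)
    (huu : u * u = 1) : Matrix (Fin 2) (Fin 2) ℝ →ₐ[ℝ] R :=
  m2Hom u (u * i) huu
    (by rw [mul_assoc, ← mul_assoc i, ← neg_eq_iff_eq_neg.2 hu.anti, neg_mul, mul_assoc u, hi.sq,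
      mul_neg_one, mul_neg, mul_neg, neg_neg, huu])
    (by rw [mul_assoc, ← neg_eq_iff_eq_neg.2 hu.anti, mul_neg])

theorem conjHom_sylC (hi : IsComplexUnit 𝒜 i) (hu : IsConjugation 𝒜 i g₀ u) (huu : u * u = 1) :
    conjHom hi hu huu sylC = i := by
  rw [m2Hom_sylC, ← mul_assoc, huu, one_mul]

theorem conjHom_mem (h : IsDivisionGrading 𝒜) (hi : IsComplexUnit 𝒜 i)
    (hu : IsConjugation 𝒜 i g₀ u) (huu : u * u = 1) {τ : ZMod 2 →+ G} (hτ : τ 1 = g₀) (a : ZMod 2)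
    (x : Matrix (Fin 2) (Fin 2) ℝ) (hx : x ∈ m2Two a) : conjHom hi hu huu x ∈ 𝒜 (τ a) := by
  rcases zmod_two_eq a with rfl | rfl
  · rw [map_zero]
    rw [m2Two, if_pos rfl] at hx
    refine map_mem_of_mem_span_pair hx ?_ ?_
    · rw [map_one]; exact h.one_mem
    · rw [conjHom_sylC]; exact hi.mem
  · rw [hτ]
    rw [m2Two, if_neg (by decide)] at hx
    refine map_mem_of_mem_span_pair hx ?_ ?_
    · rw [m2Hom_sylA]; exact hu.mem
    · rw [m2Hom_sylB]; simpa using h.mul_mem hu.mem hi.mem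

theorem IsFixed.commute_conjHom (hi : IsComplexUnit 𝒜 i) (hu : IsConjugation 𝒜 i g₀ u)
    (huu : u * u = 1) {g : G} {y : R} (hy : IsFixed 𝒜 i u g y) (x : Matrix (Fin 2) (Fin 2) ℝ) :
    Commute y (conjHom hi hu huu x) :=
  commute_m2Hom hy.comm_u (Commute.mul_right hy.comm_u hy.comm_i) x

theorem exists_isUnit_m2Two (a : ZMod 2) : ∃ w ∈ m2Two a, IsUnit w ∧ sylC * w ∈ m2Two a := by
  rcases zmod_two_eq a with rfl | rfl
  · refine ⟨1, ?_, isUnit_one, ?_⟩ <;> rw [m2Two, if_pos rfl]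
    · exact Submodule.subset_span (by simp)
    · rw [mul_one]; exact Submodule.subset_span (by simp)
  · refine ⟨sylA, ?_, isUnit_sylA, ?_⟩ <;> rw [m2Two, if_neg (by decide)]
    · exact Submodule.subset_span (by simp)
    · have : sylC * sylA = -sylB := by
        rw [← sylA_mul_sylB, mul_assoc, sylB_mul_sylA, ← sylA_mul_sylB, mul_neg, ← mul_assoc,
          sylA_mul_self, one_mul]
      rw [this]
      exact Submodule.neg_mem _ (Submodule.subset_span (by simp))

theorem m2Unit_mem (p : ZMod 2 × ZMod 2) : m2Unit p ∈ m2Four p := by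
  rw [m2Four_eq]; exact Submodule.mem_span_singleton_self _

theorem hUnit_mem (p : ZMod 2 × ZMod 2) : hUnit p ∈ hFour p := by
  rw [hFour_eq]; exact Submodule.mem_span_singleton_self _

theorem exists_isUnit_typeI (k : ℕ) (g : ZMod 2 × (Fin k → ZMod 2 × ZMod 2)) :
    ∃ w ∈ typeI k g, IsUnit w ∧ (sylC ⊗ₜ[ℝ] 1) * w ∈ typeI k g := by
  obtain ⟨a, v⟩ := g
  obtain ⟨w, hw, hwu, hcw⟩ := exists_isUnit_m2Two a
  have hv : PiTensorProduct.tprod ℝ (fun j => m2Unit (v j)) ∈ tensorPowerGrading m2Four k v :=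
    tprod_mem_tensorPowerGrading fun j => m2Unit_mem _
  refine ⟨w ⊗ₜ PiTensorProduct.tprod ℝ (fun j => m2Unit (v j)), tmul_mem_tensorGrading hw hv,
    isUnit_tmul hwu (isUnit_tprod fun j => isUnit_m2Unit _), ?_⟩
  rw [Algebra.TensorProduct.tmul_mul_tmul, one_mul]
  exact tmul_mem_tensorGrading hcw hv

theorem exists_isUnit_typeII (k : ℕ)
    (g : (ZMod 2 × (Fin k → ZMod 2 × ZMod 2)) × (ZMod 2 × ZMod 2)) :
    ∃ w ∈ typeII k g, IsUnit w ∧ ((sylC ⊗ₜ[ℝ] 1) ⊗ₜ[ℝ] 1) * w ∈ typeII k g := by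
  obtain ⟨a, p⟩ := g
  obtain ⟨w, hw, hwu, hcw⟩ := exists_isUnit_typeI k a
  refine ⟨w ⊗ₜ hUnit p, tmul_mem_tensorGrading hw (hUnit_mem p),
    isUnit_tmul hwu (isUnit_hUnit p), ?_⟩
  rw [Algebra.TensorProduct.tmul_mul_tmul, one_mul]
  exact tmul_mem_tensorGrading hcw (hUnit_mem p)

variable [FiniteDimensional ℝ R]

/-- In each hyperbolic plane the two coordinate vectors give anticommuting elements of square `1`,
that is, a copy of `M₂(ℝ)`. Copies from different planes commute because the planes are orthogonal,
and they commute with the copy generated by `i` and `u` because their elements are fixed. -/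
theorem IsDivisionGrading.weaklyIsomorphic_typeI (h : IsDivisionGrading 𝒜)
    (h2 : ∀ g, Module.finrank ℝ (𝒜 g) = 2) (hi : IsComplexUnit 𝒜 i)
    (hu : IsConjugation 𝒜 i g₀ u) (huu : u * u = 1) {τ : ZMod 2 →+ G} (hτ : τ 1 = g₀) {k : ℕ}
    {σ : (Fin k → ZMod 2 × ZMod 2) →+ G} {Y : (Fin k → ZMod 2 × ZMod 2) → R}
    (hY : IsFixedSystem 𝒜 i u hyp σ Y) (α : ZMod 2 × (Fin k → ZMod 2 × ZMod 2) ≃+ G)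
    (hα : ∀ p, α p = τ p.1 + σ p.2) : WeaklyIsomorphic 𝒜 (typeI k) := by
  have hone : ∀ j : Fin k, hyp (Pi.single j ((1 : ZMod 2), (0 : ZMod 2))) = 0 :=
    fun j => by rw [hyp_single]; rfl
  have htwo : ∀ j : Fin k, hyp (Pi.single j ((0 : ZMod 2), (1 : ZMod 2))) = 0 :=
    fun j => by rw [hyp_single]; rfl
  let f : Fin k → Matrix (Fin 2) (Fin 2) ℝ →ₐ[ℝ] R := fun j =>
    m2Hom (Y (Pi.single j (1, 0))) (Y (Pi.single j (0, 1))) (hY.sq_one (hone j))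
      (hY.sq_one (htwo j)) (hY.anticommute (by
        rw [← Pi.single_add, hone, htwo, hyp_single]; rfl))
  have hc : ∀ j l, j ≠ l → ∀ p p', Commute (Y (Pi.single j p)) (Y (Pi.single l p')) :=
    fun j l hjl p p' => hY.commute (by rw [hyp_single_add_single hjl, hyp_single, hyp_single])
  have hf : ∀ j l, j ≠ l → ∀ x y, Commute (f j x) (f l y) := fun j l hjl x y =>
    commute_m2Hom (commute_m2Hom (hc l j hjl.symm _ _) (hc l j hjl.symm _ _) x).symm
      (commute_m2Hom (hc l j hjl.symm _ _) (hc l j hjl.symm _ _) x).symm y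
  have hfu : ∀ x y, Commute (conjHom hi hu huu x) (powHom f hf y) := fun x y =>
    commute_powHom (fun j y => commute_m2Hom ((hY.fixed _).commute_conjHom hi hu huu x).symm
      ((hY.fixed _).commute_conjHom hi hu huu x).symm y) y
  have hfσ : ∀ j p, ∀ x ∈ m2Four p, f j x ∈ 𝒜 (σ (Pi.single j p)) := fun j p x hx =>
    m2Hom_mem (σ := σ.comp (AddMonoidHom.single (fun _ : Fin k => ZMod 2 × ZMod 2) j)) h.gradedMonoid (hY.fixed _).mem
      (hY.fixed _).mem p x hx
  refine h.weaklyIsomorphic h2 hi (Algebra.TensorProduct.lift (conjHom hi hu huu) (powHom f hf) hfu)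
    α (fun g x hx => ?_) (c := sylC ⊗ₜ 1) ?_ (exists_isUnit_typeI k) ?_
  · rw [hα]
    refine tensorLift_mem (σ' := σ) h.gradedMonoid (conjHom_mem h hi hu huu hτ)
      (fun v y hy => ?_) g hx
    have := powHom_mem (hf := hf) h.gradedMonoid hfσ v hy
    rwa [← map_sum, Finset.univ_sum_single] at this
  · rw [Algebra.TensorProduct.lift_tmul, map_one, mul_one, conjHom_sylC]
  · rw [finrank_typeI]
    simp only [Nat.card_eq_fintype_card, Fintype.card_prod, ZMod.card, Fintype.card_pi_const]
    ring

/-- On the anisotropic plane both coordinate vectors have value `1` and pair to `1`, so they give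
anticommuting square roots of `-1`: a copy of ℍ commuting with the other factors. -/
theorem IsDivisionGrading.weaklyIsomorphic_typeII (h : IsDivisionGrading 𝒜)
    (h2 : ∀ g, Module.finrank ℝ (𝒜 g) = 2) (hi : IsComplexUnit 𝒜 i)
    (hu : IsConjugation 𝒜 i g₀ u) (huu : u * u = 1) {τ : ZMod 2 →+ G} (hτ : τ 1 = g₀) {k : ℕ}
    {σ : (Fin k → ZMod 2 × ZMod 2) × (ZMod 2 × ZMod 2) →+ G}
    {Y : (Fin k → ZMod 2 × ZMod 2) × (ZMod 2 × ZMod 2) → R}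
    (hY : IsFixedSystem 𝒜 i u (fun v => hyp v.1 + (v.2.1 + v.2.2 + v.2.1 * v.2.2)) σ Y)
    (α : ZMod 2 × ((Fin k → ZMod 2 × ZMod 2) × (ZMod 2 × ZMod 2)) ≃+ G)
    (hα : ∀ p, α p = τ p.1 + σ p.2) : WeaklyIsomorphic 𝒜 (typeII k) := by
  have hone : ∀ j : Fin k, hyp (Pi.single j ((1 : ZMod 2), (0 : ZMod 2))) = 0 :=
    fun j => by rw [hyp_single]; rfl
  have htwo : ∀ j : Fin k, hyp (Pi.single j ((0 : ZMod 2), (1 : ZMod 2))) = 0 :=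
    fun j => by rw [hyp_single]; rfl
  let f : Fin k → Matrix (Fin 2) (Fin 2) ℝ →ₐ[ℝ] R := fun j =>
    m2Hom (Y (Pi.single j (1, 0), 0)) (Y (Pi.single j (0, 1), 0))
      (hY.sq_one (by simp [hone])) (hY.sq_one (by simp [htwo])) (hY.anticommute (by
        simp only [Prod.mk_add_mk, ← Pi.single_add, hone, htwo, hyp_single]; rfl))
  let fH : ℍ[ℝ] →ₐ[ℝ] R := hHom (Y (0, (1, 0))) (Y (0, (0, 1)))
    (hY.sq_neg_one (by simp [hyp_zero])) (hY.sq_neg_one (by simp [hyp_zero])) (hY.anticommute (by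
      simp only [Prod.mk_add_mk, add_zero, hyp_zero]; decide))
  have hc : ∀ j l, j ≠ l → ∀ p p', Commute (Y (Pi.single j p, 0)) (Y (Pi.single l p', 0)) :=
    fun j l hjl p p' => hY.commute (by
      simp only [Prod.mk_add_mk, hyp_single_add_single hjl, hyp_single]; simp)
  have hcH : ∀ j p p', Commute (Y (Pi.single j p, 0)) (Y (0, p')) :=
    fun j p p' => hY.commute (by simp [hyp_zero])
  have hf : ∀ j l, j ≠ l → ∀ x y, Commute (f j x) (f l y) := fun j l hjl x y =>
    commute_m2Hom (commute_m2Hom (hc l j hjl.symm _ _) (hc l j hjl.symm _ _) x).symm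
      (commute_m2Hom (hc l j hjl.symm _ _) (hc l j hjl.symm _ _) x).symm y
  have hfu : ∀ x y, Commute (conjHom hi hu huu x) (powHom f hf y) := fun x y =>
    commute_powHom (fun j y => commute_m2Hom ((hY.fixed _).commute_conjHom hi hu huu x).symm
      ((hY.fixed _).commute_conjHom hi hu huu x).symm y) y
  have hfH : ∀ j x y, Commute (fH y) (f j x) := fun j x y =>
    commute_m2Hom (commute_hHom (hcH j _ _) (hcH j _ _) y).symm
      (commute_hHom (hcH j _ _) (hcH j _ _) y).symm x
  have hlH : ∀ x y, Commute (Algebra.TensorProduct.lift (conjHom hi hu huu) (powHom f hf) hfu x)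
      (fH y) := fun x y => (commute_tensorLift
        (fun x => (commute_hHom ((hY.fixed _).commute_conjHom hi hu huu x).symm
          ((hY.fixed _).commute_conjHom hi hu huu x).symm y).symm)
        (fun x => commute_powHom (fun j x => hfH j x y) x) x).symm
  have hfσ : ∀ j p, ∀ x ∈ m2Four p, f j x ∈ 𝒜 (σ (Pi.single j p, 0)) := fun j p x hx =>
    m2Hom_mem (σ := (σ.comp (AddMonoidHom.inl _ _)).comp (AddMonoidHom.single (fun _ : Fin k => ZMod 2 × ZMod 2) j)) h.gradedMonoid
      (hY.fixed _).mem (hY.fixed _).mem p x hx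
  have hHσ : ∀ p, ∀ x ∈ hFour p, fH x ∈ 𝒜 (σ (0, p)) := fun p x hx =>
    hHom_mem (σ := σ.comp (AddMonoidHom.inr _ _)) h.gradedMonoid
      (hY.fixed _).mem (hY.fixed _).mem p x hx
  refine h.weaklyIsomorphic h2 hi (Algebra.TensorProduct.lift
    (Algebra.TensorProduct.lift (conjHom hi hu huu) (powHom f hf) hfu) fH hlH)
    (AddEquiv.prodAssoc.trans α) (fun g x hx => ?_) (c := (sylC ⊗ₜ 1) ⊗ₜ 1) ?_
    (exists_isUnit_typeII k) ?_
  · have : AddEquiv.prodAssoc.trans α g = τ g.1.1 + σ (g.1.2, 0) + σ (0, g.2) := by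
      rw [add_assoc, ← map_add, Prod.mk_add_mk, add_zero, zero_add]
      exact hα _
    rw [this]
    refine tensorLift_mem (σ := fun g => τ g.1 + σ (g.2, 0)) (σ' := fun p => σ (0, p))
      h.gradedMonoid (fun v y hy => ?_) hHσ g hx
    refine tensorLift_mem (σ' := fun v => σ (v, 0)) h.gradedMonoid (conjHom_mem h hi hu huu hτ)
      (fun v y hy => ?_) v hy
    have := powHom_mem (hf := hf) h.gradedMonoid hfσ v hy
    rw [← map_sum] at this
    have hsum : ∑ j, ((Pi.single j (v j) : Fin k → ZMod 2 × ZMod 2), (0 : ZMod 2 × ZMod 2)) =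
        (v, 0) := by
      rw [← Finset.univ_sum_single v]
      simp [Prod.ext_iff, Prod.fst_sum, Prod.snd_sum]
    rwa [hsum] at this
  · rw [Algebra.TensorProduct.lift_tmul, map_one, mul_one, Algebra.TensorProduct.lift_tmul, map_one,
      mul_one, conjHom_sylC]
  · rw [finrank_typeII]
    simp only [Nat.card_eq_fintype_card, Fintype.card_prod, ZMod.card, Fintype.card_pi_const]
    ring

theorem IsDivisionGrading.weaklyIsomorphic_hTwo (h : IsDivisionGrading 𝒜)
    (h2 : ∀ g, Module.finrank ℝ (𝒜 g) = 2) (hi : IsComplexUnit 𝒜 i)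
    (hu : IsConjugation 𝒜 i g₀ u) (huu : u * u = -1) {τ : ZMod 2 →+ G} (hτ : τ 1 = g₀)
    (α : ZMod 2 ≃+ G) (hα : ∀ a, α a = τ a) : WeaklyIsomorphic 𝒜 hTwo := by
  refine h.weaklyIsomorphic h2 hi (hHom i u hi.sq huu hu.anti) α (fun a x hx => ?_) (c := qI)
    hHom_qI (fun a => ?_) ?_
  · rcases zmod_two_eq a with rfl | rfl
    · rw [map_zero]
      rw [hTwo, if_pos rfl] at hx
      refine map_mem_of_mem_span_pair hx ?_ ?_
      · rw [map_one]; exact h.one_mem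
      · rw [hHom_qI]; exact hi.mem
    · rw [hα, hτ]
      rw [hTwo, if_neg (by decide)] at hx
      refine map_mem_of_mem_span_pair hx ?_ ?_
      · rw [hHom_qJ]; exact hu.mem
      · rw [hHom_qK]; simpa using h.mul_mem hi.mem hu.mem
  · rcases zmod_two_eq a with rfl | rfl
    · refine ⟨1, ?_, isUnit_one, ?_⟩ <;> rw [hTwo, if_pos rfl]
      · exact Submodule.subset_span (by simp)
      · rw [mul_one]; exact Submodule.subset_span (by simp)
    · refine ⟨qJ, ?_, isUnit_of_mul_self (Or.inr qJ_mul_self), ?_⟩ <;>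
        rw [hTwo, if_neg (by decide)]
      · exact Submodule.subset_span (by simp)
      · rw [qI_mul_qJ]; exact Submodule.subset_span (by simp)
  · rw [Quaternion.finrank_eq_four, Nat.card_zmod]

/-- Division gradings with two-dimensional components of a central algebra. -/
theorem IsDivisionGrading.classification [Algebra.IsCentral ℝ R] (h : IsDivisionGrading 𝒜)
    (h2 : ∀ g, Module.finrank ℝ (𝒜 g) = 2) :
    ((∃ u : R, u * u = 1 ∧ u ≠ 1 ∧ u ≠ -1) ∧
      ∃ k, WeaklyIsomorphic 𝒜 (typeI k) ∨ WeaklyIsomorphic 𝒜 (typeII k)) ∨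
    WeaklyIsomorphic 𝒜 hTwo := by
  obtain ⟨i, hi⟩ := h.exists_complexUnit h2
  obtain ⟨g₀, u, hu, huu | ⟨huu, hT⟩⟩ := h.exists_conjugation_sq h2 hi
  · left
    have hi0 : i ≠ 0 := by
      rintro rfl
      exact one_ne_zero_of_finrank_eq_two h2 (by simpa using hi.sq)
    -- An element anticommuting with `i ≠ 0` is not `±1`. This involution is recorded because it
    -- excludes `n = 1` later.
    refine ⟨⟨u, huu, ?_, ?_⟩, ?_⟩
    · rintro rfl
      have := hu.anti
      rw [one_mul, mul_one] at this
      exact hi0 (eq_zero_of_eq_neg this)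
    · rintro rfl
      have := hu.anti
      rw [neg_one_mul, mul_neg_one, neg_neg] at this
      exact hi0 (eq_zero_of_eq_neg this.symm)
    obtain ⟨τ, hτ, α, hα⟩ := h.exists_addEquiv h2 hi hu
    obtain ⟨_, X, β, q, hX⟩ := h.exists_quadraticSystem h2 hi hu
    have := h.finite h2
    obtain ⟨k, ⟨e, he⟩ | ⟨e, he⟩⟩ := hX.form.exists_normal_form _ rfl
    · have hY := hX.isFixedSystem e
      rw [show (fun v => q (e v)) = hyp from funext he] at hY
      exact ⟨k, Or.inl (h.weaklyIsomorphic_typeI h2 hi hu huu hτ hY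
        (((AddEquiv.refl _).prodCongr e).trans α) fun p => hα _)⟩
    · have hY := hX.isFixedSystem e
      rw [show (fun v => q (e v)) = fun v => hyp v.1 + (v.2.1 + v.2.2 + v.2.1 * v.2.2) from
        funext fun v => he v.1 v.2] at hY
      exact ⟨k, Or.inr (h.weaklyIsomorphic_typeII h2 hi hu huu hτ hY
        (((AddEquiv.refl _).prodCongr e).trans α) fun p => hα _)⟩
  · right
    obtain ⟨τ, hτ, α, hα⟩ := h.exists_addEquiv h2 hi hu
    -- All fixed elements have degree zero, so only the degrees `0` and `g₀` remain.
    have hsub : ∀ t : h.commSubgroup h2 hi, t = 0 := by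
      intro t
      obtain ⟨x, hx, hx0⟩ := exists_ne_zero_of_finrank_eq_two h2 t
      obtain ⟨y, hy⟩ := h.exists_isFixed h2 hi hu hx hx0 (t.2 x hx)
      exact Subtype.ext (hT t y hy)
    have : Unique (h.commSubgroup h2 hi) := ⟨⟨0⟩, hsub⟩
    refine h.weaklyIsomorphic_hTwo h2 hi hu huu hτ (AddEquiv.prodUnique.symm.trans α) fun a => ?_
    change α (a, default) = _
    rw [hα, hsub default]
    simp

end Classification

/-! ### Monomials in anticommuting generators -/

/-- Pairwise anticommuting elements with squares `±1`. -/
structure IsCliffordFamily {ι S : Type*} [Ring S] (e : ι → S) : Prop where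
  sq : ∀ i, e i * e i = 1 ∨ e i * e i = -1
  anti : ∀ i j, i ≠ j → e j * e i = -(e i * e j)

/-- The product of a word in the generators. -/
def wordProd {ι S : Type*} [Ring S] (e : ι → S) (l : List ι) : S := (l.map e).prod

theorem wordProd_cons {ι S : Type*} [Ring S] (e : ι → S) (i : ι) (l : List ι) :
    wordProd e (i :: l) = e i * wordProd e l := by
  simp [wordProd]

theorem wordProd_append {ι S : Type*} [Ring S] (e : ι → S) (l l' : List ι) :
    wordProd e (l ++ l') = wordProd e l * wordProd e l' := by
  simp [wordProd]

theorem IsCliffordFamily.isUnit {ι S : Type*} [Ring S] {e : ι → S}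
    (he : IsCliffordFamily e) (i : ι) : IsUnit (e i) :=
  isUnit_of_mul_self (he.sq i)

theorem IsCliffordFamily.wordProd_mul {ι S : Type*} [Ring S] {e : ι → S}
    (he : IsCliffordFamily e) (i : ι) (l : List ι) :
    wordProd e l * e i = e i * wordProd e l ∨ wordProd e l * e i = -(e i * wordProd e l) := by
  induction l with
  | nil => left; simp [wordProd]
  | cons j l ih =>
    have hij : e j * e i = e i * e j ∨ e j * e i = -(e i * e j) := by
      by_cases h : i = j
      · left; rw [h]
      · exact Or.inr (he.anti i j h)
    rw [wordProd_cons, mul_assoc, ← mul_assoc (e i)]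
    rcases ih with ih | ih <;> rcases hij with hij | hij <;>
      simp [ih, ← mul_assoc, hij]

theorem IsCliffordFamily.isUnit_wordProd {ι S : Type*} [Ring S] {e : ι → S}
    (he : IsCliffordFamily e) (l : List ι) : IsUnit (wordProd e l) := by
  induction l with
  | nil => simp [wordProd]
  | cons i l ih => rw [wordProd_cons]; exact (he.isUnit i).mul ih

section Monomials

variable {ι S : Type*} [DecidableEq ι] [Ring S] [Algebra ℝ S]

/-- The degree of a word in the generators. -/
def wordDegree (l : List ι) : ι → ZMod 2 :=
  (l.map fun i => (Pi.single i 1 : ι → ZMod 2)).sum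

/-- The components spanned by the monomials of a given degree. -/
def monomialGrading (e : ι → S) (g : ι → ZMod 2) : Submodule ℝ S :=
  Submodule.span ℝ {t | ∃ l : List ι, wordDegree l = g ∧ t = wordProd e l}

theorem wordDegree_cons (i : ι) (l : List ι) :
    wordDegree (i :: l) = Pi.single i 1 + wordDegree l := by
  simp [wordDegree]

theorem wordDegree_append (l l' : List ι) :
    wordDegree (l ++ l') = wordDegree l + wordDegree l' := by
  simp [wordDegree]

theorem wordDegree_reverse (l : List ι) : wordDegree l.reverse = wordDegree l := by
  simp [wordDegree, List.map_reverse, List.sum_reverse]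

theorem wordDegree_apply_of_notMem {i : ι} {l : List ι} (h : i ∉ l) : wordDegree l i = 0 := by
  induction l with
  | nil => rfl
  | cons j l ih =>
    rw [List.mem_cons, not_or] at h
    rw [wordDegree_cons, Pi.add_apply, ih h.2, Pi.single_eq_of_ne h.1, add_zero]

theorem wordDegree_surjective [Fintype ι] (g : ι → ZMod 2) : ∃ l, wordDegree l = g := by
  refine ⟨(Finset.univ.filter fun i => g i = 1).toList, ?_⟩
  rw [wordDegree, Finset.sum_map_toList, Finset.sum_filter]
  conv_rhs => rw [← Finset.univ_sum_single g]
  refine Finset.sum_congr rfl fun i _ => ?_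
  rcases zmod_two_eq (g i) with h | h <;> simp [h]

namespace IsCliffordFamily

variable {e : ι → S}

/-- In a word of degree zero the first letter must occur again; moving it next to its other
occurrence and using that its square is `±1` shortens the word by two letters at the cost of a sign.
-/
theorem wordProd_of_degree_zero (he : IsCliffordFamily e) (n : ℕ) : ∀ l : List ι, l.length = n →
    wordDegree l = 0 → wordProd e l = 1 ∨ wordProd e l = -1 := by
  induction n using Nat.strong_induction_on with
  | _ n ih =>
  intro l hl h0
  match l, hl, h0 with
  | [], _, _ => left; simp [wordProd]
  | i :: l, hl, h0 =>
    have hmem : i ∈ l := by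
      by_contra hi
      have := congrFun h0 i
      rw [wordDegree_cons, Pi.add_apply, wordDegree_apply_of_notMem hi, Pi.single_eq_same,
        Pi.zero_apply] at this
      exact absurd this (by decide)
    obtain ⟨s, t, rfl⟩ := List.append_of_mem hmem
    have hst : wordDegree (s ++ t) = 0 := by
      rw [wordDegree_cons, wordDegree_append, wordDegree_cons] at h0
      rw [wordDegree_append, ← h0, ← add_assoc, ← add_assoc, add_right_comm _ _ (Pi.single i 1)]
      rw [ZModModule.add_self, zero_add]
    have hlen : (s ++ t).length < n := by
      rw [← hl]; simp
    have key := ih _ hlen _ rfl hst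
    rw [wordProd_append] at key
    rw [wordProd_cons, wordProd_append, wordProd_cons, ← mul_assoc (wordProd e s)]
    rcases he.wordProd_mul i s with h | h <;> rcases he.sq i with h' | h' <;>
      rcases key with key | key <;>
      simp [h, mul_assoc, h', key]

theorem wordProd_eq_of_degree_eq (he : IsCliffordFamily e) {l l' : List ι}
    (h : wordDegree l = wordDegree l') :
    wordProd e l' = wordProd e l ∨ wordProd e l' = -wordProd e l := by
  -- The reversed word has the same degree and a unit as product, so it serves as an inverse up to
  -- sign.
  have h1 := he.wordProd_of_degree_zero _ (l.reverse ++ l) rfl (by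
    rw [wordDegree_append, wordDegree_reverse, ZModModule.add_self])
  have h2 := he.wordProd_of_degree_zero _ (l.reverse ++ l') rfl (by
    rw [wordDegree_append, wordDegree_reverse, h, ZModModule.add_self])
  rw [wordProd_append] at h1 h2
  have hu := he.isUnit_wordProd l.reverse
  rcases h1 with h1 | h1 <;> rcases h2 with h2 | h2
  · exact Or.inl (hu.mul_left_cancel (h2.trans h1.symm))
  · exact Or.inr (hu.mul_left_cancel (by rw [mul_neg, h2, h1]))
  · exact Or.inr (hu.mul_left_cancel (by rw [mul_neg, h2, h1, neg_neg]))
  · exact Or.inl (hu.mul_left_cancel (h2.trans h1.symm))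

theorem monomialGrading_eq (he : IsCliffordFamily e) (l : List ι) :
    monomialGrading e (wordDegree l) = Submodule.span ℝ {wordProd e l} := by
  refine le_antisymm (Submodule.span_le.2 ?_) (Submodule.span_mono ?_)
  · rintro _ ⟨l', hl', rfl⟩
    have hm := Submodule.mem_span_singleton_self (R := ℝ) (wordProd e l)
    rcases he.wordProd_eq_of_degree_eq hl'.symm with h | h
    · rw [SetLike.mem_coe, h]; exact hm
    · rw [SetLike.mem_coe, h]; exact Submodule.neg_mem _ hm
  · rintro _ rfl
    exact ⟨l, rfl, rfl⟩

end IsCliffordFamily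

theorem gradedMonoid_monomialGrading (e : ι → S) : SetLike.GradedMonoid (monomialGrading e) where
  one_mem := Submodule.subset_span ⟨[], rfl, by simp [wordProd]⟩
  mul_mem := by
    intro g g' x y hx hy
    have h1 : monomialGrading e g * monomialGrading e g' ≤ monomialGrading e (g + g') := by
      rw [monomialGrading, monomialGrading, Submodule.span_mul_span]
      refine Submodule.span_mono ?_
      rintro _ ⟨_, ⟨l, hl, rfl⟩, _, ⟨l', hl', rfl⟩, rfl⟩
      exact ⟨l ++ l', by rw [wordDegree_append, hl, hl'], (wordProd_append e l l').symm⟩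
    exact h1 (Submodule.mul_mem_mul hx hy)

theorem iSup_monomialGrading {e : ι → S} (hgen : Algebra.adjoin ℝ (Set.range e) = ⊤) :
    iSup (monomialGrading e) = ⊤ := by
  rw [eq_top_iff, ← Algebra.top_toSubmodule, ← hgen, Algebra.adjoin_eq_span, Submodule.span_le]
  intro x hx
  have : ∃ l, x = wordProd e l := by
    induction hx using Submonoid.closure_induction with
    | mem x hx => obtain ⟨i, rfl⟩ := hx; exact ⟨[i], by simp [wordProd]⟩
    | one => exact ⟨[], by simp [wordProd]⟩
    | mul x y _ _ hx hy =>
      obtain ⟨l, rfl⟩ := hx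
      obtain ⟨l', rfl⟩ := hy
      exact ⟨l ++ l', (wordProd_append e l l').symm⟩
  obtain ⟨l, rfl⟩ := this
  exact Submodule.mem_iSup_of_mem (wordDegree l) (Submodule.subset_span ⟨l, rfl, rfl⟩)

theorem map_monomialGrading {S' : Type*} [Ring S'] [Algebra ℝ S'] (f : S →ₐ[ℝ] S') (e : ι → S)
    (g : ι → ZMod 2) :
    (monomialGrading e g).map f.toLinearMap = monomialGrading (fun i => f (e i)) g := by
  have hf : ∀ l, f (wordProd e l) = wordProd (fun i => f (e i)) l := fun l => by
    rw [wordProd, wordProd, map_list_prod, List.map_map]; rfl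
  rw [monomialGrading, monomialGrading, Submodule.map_span]
  congr 1
  ext t
  constructor
  · rintro ⟨_, ⟨l, hl, rfl⟩, rfl⟩
    exact ⟨l, hl, hf l⟩
  · rintro ⟨l, hl, rfl⟩
    exact ⟨_, ⟨l, hl, rfl⟩, hf l⟩

variable [Fintype ι]

/-- An algebra generated by an anticommuting family of size `n` has dimension at most `2 ^ n`. -/
theorem IsCliffordFamily.finite_and_finrank_le {e : ι → S} (he : IsCliffordFamily e)
    (hgen : Algebra.adjoin ℝ (Set.range e) = ⊤) :
    FiniteDimensional ℝ S ∧ Module.finrank ℝ S ≤ 2 ^ Fintype.card ι := by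
  -- One word per degree suffices for a spanning set, as words of equal degree agree up to sign.
  choose l hl using wordDegree_surjective (ι := ι)
  have htop : Submodule.span ℝ (Set.range fun g => wordProd e (l g)) = ⊤ := by
    rw [eq_top_iff, ← iSup_monomialGrading hgen]
    refine iSup_le fun g => ?_
    rw [← hl g, he.monomialGrading_eq]
    refine Submodule.span_mono ?_
    rintro _ rfl
    exact ⟨g, rfl⟩
  refine ⟨⟨(Submodule.fg_def).2 ⟨_, Set.finite_range _, htop⟩⟩, ?_⟩
  have := finrank_range_le_card (R := ℝ) (fun g => wordProd e (l g))
  rw [Set.finrank, htop, finrank_top] at this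
  simpa using this

end Monomials

/-- A spanning family of subspaces whose dimensions add up to that of the whole space is
independent. -/
theorem isInternal_of_finrank {G M : Type*} [Fintype G] [DecidableEq G] [AddCommGroup M]
    [Module ℝ M] [FiniteDimensional ℝ M] {𝒜 : G → Submodule ℝ M} (htop : iSup 𝒜 = ⊤)
    (hrank : ∑ g, Module.finrank ℝ (𝒜 g) = Module.finrank ℝ M) : DirectSum.IsInternal 𝒜 := by
  have hsurj : Function.Surjective (DirectSum.coeLinearMap 𝒜) := by
    rw [← LinearMap.range_eq_top, DirectSum.range_coeLinearMap, htop]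
  have hdim : Module.finrank ℝ (DirectSum G fun g => 𝒜 g) = Module.finrank ℝ M := by
    rw [Module.finrank_directSum, hrank]
  exact ⟨(LinearMap.injective_iff_surjective_of_finrank_eq_finrank hdim).2 hsurj, hsurj⟩

/-! ### Clifford systems -/

section CliffordSystem

/-- Generators of an algebra of dimension `2 ^ (p + m)` satisfying the relations of `C(p, m)`. -/
structure IsCliffordSystem {p m : ℕ} {S : Type*} [Ring S] [Algebra ℝ S] (e : Fin p ⊕ Fin m → S) :
    Prop where
  sq_inl : ∀ i, e (Sum.inl i) * e (Sum.inl i) = -1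
  sq_inr : ∀ i, e (Sum.inr i) * e (Sum.inr i) = 1
  anti : ∀ i j, i ≠ j → e j * e i = -(e i * e j)
  adjoin_eq_top : Algebra.adjoin ℝ (Set.range e) = ⊤
  finrank_eq : Module.finrank ℝ S = 2 ^ (p + m)

/-- The weights of the standard form. -/
noncomputable abbrev weight (p m : ℕ) : Fin p ⊕ Fin m → ℝ :=
  Sum.elim (fun _ => (1 : ℝ)) (fun _ => (-1 : ℝ))

theorem stdForm_apply (p m : ℕ) (v : Fin p ⊕ Fin m → ℝ) :
    (-stdForm p m) v = -∑ i, weight p m i * (v i * v i) := by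
  rw [neg_apply, stdForm, QuadraticMap.weightedSumSquares_apply]; rfl

theorem stdForm_single (p m : ℕ) (i : Fin p ⊕ Fin m) :
    (-stdForm p m) (Pi.single i 1) = -weight p m i := by
  rw [stdForm_apply, Finset.sum_eq_single i]
  · simp
  · intro j _ hj; rw [Pi.single_eq_of_ne hj]; ring
  · simp

theorem stdForm_single_add_single (p m : ℕ) {i j : Fin p ⊕ Fin m} (hij : i ≠ j) :
    (-stdForm p m) (Pi.single i 1 + Pi.single j 1) = -weight p m i + -weight p m j := by
  rw [← stdForm_single, ← stdForm_single, stdForm_apply, stdForm_apply, stdForm_apply, ← neg_add,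
    ← Finset.sum_add_distrib]
  congr 1
  refine Finset.sum_congr rfl fun l _ => ?_
  rw [Pi.add_apply]
  by_cases hl : l = i
  · subst hl; rw [Pi.single_eq_of_ne hij]; ring
  · rw [Pi.single_eq_of_ne hl]; ring

theorem isCliffordFamily_gen (p m : ℕ) : IsCliffordFamily (gen p m) where
  sq i := by
    rw [gen, CliffordAlgebra.ι_sq_scalar, stdForm_single]
    rcases i with i | i <;> simp [weight]
  anti i j hij := by
    rw [gen, gen, CliffordAlgebra.ι_mul_ι_comm_of_isOrtho]
    rw [QuadraticMap.isOrtho_def, stdForm_single_add_single p m hij.symm, stdForm_single,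
      stdForm_single]

theorem adjoin_gen (p m : ℕ) : Algebra.adjoin ℝ (Set.range (gen p m)) = ⊤ := by
  rw [eq_top_iff, ← CliffordAlgebra.adjoin_range_ι]
  refine Algebra.adjoin_le ?_
  rintro _ ⟨v, rfl⟩
  have hv : v = ∑ i, v i • (Pi.single i 1 : Fin p ⊕ Fin m → ℝ) := by
    conv_lhs => rw [← Finset.univ_sum_single v]
    refine Finset.sum_congr rfl fun i _ => ?_
    rw [← Pi.single_smul, smul_eq_mul, mul_one]
  rw [SetLike.mem_coe, hv, map_sum]
  refine Subalgebra.sum_mem _ fun i _ => ?_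
  rw [map_smul]
  exact Subalgebra.smul_mem _ (Algebra.subset_adjoin (Set.mem_range_self i)) _

variable {p m : ℕ} {S : Type*} [Ring S] [Algebra ℝ S] {e : Fin p ⊕ Fin m → S}

namespace IsCliffordSystem

theorem isCliffordFamily (he : IsCliffordSystem e) : IsCliffordFamily e where
  sq i := by
    rcases i with i | i
    · exact Or.inr (he.sq_inl i)
    · exact Or.inl (he.sq_inr i)
  anti := he.anti

theorem sq_eq (he : IsCliffordSystem e) (i : Fin p ⊕ Fin m) :
    e i * e i = (-weight p m i) • 1 := by
  rcases i with i | i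
  · rw [he.sq_inl]; simp
  · rw [he.sq_inr]; simp

/-- Adding the double sum to its transpose cancels the off-diagonal terms by anticommutation; this
is the relation required by the universal property of the Clifford algebra. -/
theorem linearCombination_sq (he : IsCliffordSystem e) (v : Fin p ⊕ Fin m → ℝ) :
    Fintype.linearCombination ℝ e v * Fintype.linearCombination ℝ e v =
      algebraMap ℝ S ((-stdForm p m) v) := by
  have h1 : Fintype.linearCombination ℝ e v * Fintype.linearCombination ℝ e v =
      ∑ i, ∑ j, (v i * v j) • (e i * e j) := by
    rw [Fintype.linearCombination_apply, Finset.sum_mul_sum]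
    refine Finset.sum_congr rfl fun i _ => Finset.sum_congr rfl fun j _ => ?_
    rw [smul_mul_assoc, mul_smul_comm, smul_smul]
  have h2 : Fintype.linearCombination ℝ e v * Fintype.linearCombination ℝ e v =
      ∑ i, ∑ j, (v i * v j) • (e j * e i) := by
    rw [h1, Finset.sum_comm]
    exact Finset.sum_congr rfl fun i _ => Finset.sum_congr rfl fun j _ => by rw [mul_comm (v j)]
  have h3 : (2 : ℝ) • (Fintype.linearCombination ℝ e v * Fintype.linearCombination ℝ e v) =
      (2 : ℝ) • algebraMap ℝ S ((-stdForm p m) v) := by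
    rw [two_smul]
    nth_rewrite 1 [h1]
    rw [h2, ← Finset.sum_add_distrib, stdForm_apply, Algebra.algebraMap_eq_smul_one, smul_smul,
      ← Finset.sum_neg_distrib, Finset.mul_sum, Finset.sum_smul]
    refine Finset.sum_congr rfl fun i _ => ?_
    rw [← Finset.sum_add_distrib, Finset.sum_eq_single i]
    · rw [he.sq_eq]; module
    · intro j _ hj
      rw [he.anti i j hj.symm, smul_neg, add_neg_cancel]
    · simp
  exact smul_right_injective S two_ne_zero h3

/-- The monomials span one line in each of the `2 ^ (p + m)` degrees, and the dimension hypothesis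
makes the sum of these lines direct. -/
theorem isDivisionGrading (he : IsCliffordSystem e) [Nontrivial S] [FiniteDimensional ℝ S] :
    IsDivisionGrading (monomialGrading e) ∧
      ∀ h, Module.finrank ℝ (monomialGrading e h) = 1 := by
  have hf := he.isCliffordFamily
  have h1 : ∀ h, Module.finrank ℝ (monomialGrading e h) = 1 := by
    intro h
    obtain ⟨l, rfl⟩ := wordDegree_surjective h
    rw [hf.monomialGrading_eq, finrank_span_singleton (hf.isUnit_wordProd l).ne_zero]
  refine ⟨⟨gradedMonoid_monomialGrading e, ?_, ?_⟩, h1⟩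
  · let _ : DecidableEq (Fin p ⊕ Fin m → ZMod 2) := Classical.decEq _
    refine isInternal_of_finrank (iSup_monomialGrading he.adjoin_eq_top) ?_
    simp [h1, he.finrank_eq]
  · intro g x hx hx0
    obtain ⟨l, rfl⟩ := wordDegree_surjective g
    rw [hf.monomialGrading_eq, Submodule.mem_span_singleton] at hx
    obtain ⟨r, rfl⟩ := hx
    have hr : r ≠ 0 := fun h => hx0 (by rw [h, zero_smul])
    exact (hf.isUnit_wordProd l).smul (Units.mk0 r hr)

/-- An algebra with a Clifford system is the Clifford algebra. -/
theorem weaklyIsomorphic (he : IsCliffordSystem e) [FiniteDimensional ℝ S] :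
    WeaklyIsomorphic (monomialGrading e) (cliffordGrading p m) := by
  let f : Cl p m →ₐ[ℝ] S :=
    CliffordAlgebra.lift (-stdForm p m) ⟨Fintype.linearCombination ℝ e, he.linearCombination_sq⟩
  have hfe : ∀ i, f (gen p m i) = e i := by
    intro i
    rw [gen, CliffordAlgebra.lift_ι_apply, Fintype.linearCombination_apply_single, one_smul]
  have hsurj : Function.Surjective f := by
    rw [← AlgHom.range_eq_top, eq_top_iff, ← he.adjoin_eq_top]
    refine Algebra.adjoin_le ?_
    rintro _ ⟨i, rfl⟩
    exact ⟨gen p m i, hfe i⟩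
  obtain ⟨_, hle⟩ := (isCliffordFamily_gen p m).finite_and_finrank_le (adjoin_gen p m)
  -- The Clifford algebra has dimension at most `2 ^ (p + m)` by its spanning monomials, and it
  -- surjects onto an algebra of exactly that dimension.
  have hdim : Module.finrank ℝ (Cl p m) = Module.finrank ℝ S := by
    refine le_antisymm ?_ (LinearMap.finrank_le_finrank_of_surjective (f := f.toLinearMap) hsurj)
    rw [he.finrank_eq]
    simpa using hle
  have hinj : Function.Injective f.toLinearMap :=
    (LinearMap.injective_iff_surjective_of_finrank_eq_finrank hdim).2 hsurj
  let E : Cl p m ≃ₐ[ℝ] S := AlgEquiv.ofBijective f ⟨hinj, hsurj⟩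
  refine ⟨AddEquiv.refl _, E.symm, fun g => ?_⟩
  have h1 : monomialGrading e g = (cliffordGrading p m g).map f.toLinearMap := by
    rw [show cliffordGrading p m g = monomialGrading (gen p m) g from rfl, map_monomialGrading]
    simp only [hfe]
  rw [h1, ← Submodule.map_comp]
  have : E.symm.toLinearMap ∘ₗ f.toLinearMap = LinearMap.id :=
    LinearMap.ext fun x => E.symm_apply_apply x
  rw [this, Submodule.map_id]; rfl

/-- A product of homogeneous elements is homogeneous, so it is enough that the generators are. -/
theorem isCoarseningOfClifford (he : IsCliffordSystem e) {G : Type*} [AddCommGroup G]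
    {𝒜 : G → Submodule ℝ S} (h𝒜 : SetLike.GradedMonoid 𝒜) (hhom : ∀ i, ∃ g, e i ∈ 𝒜 g) :
    IsCoarseningOfClifford 𝒜 p m := by
  have hpos : 0 < Module.finrank ℝ S := by rw [he.finrank_eq]; positivity
  have : FiniteDimensional ℝ S := Module.finite_of_finrank_pos hpos
  have : Nontrivial S := Module.nontrivial_of_finrank_pos hpos
  obtain ⟨h1, h2⟩ := he.isDivisionGrading
  refine ⟨monomialGrading e, h1, h2, he.weaklyIsomorphic, fun h => ?_⟩
  obtain ⟨l, rfl⟩ := wordDegree_surjective h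
  choose d hd using hhom
  refine ⟨(l.map d).sum, ?_⟩
  rw [he.isCliffordFamily.monomialGrading_eq, Submodule.span_singleton_le_iff_mem]
  exact SetLike.list_prod_map_mem_graded l d e fun i _ => hd i

end IsCliffordSystem

end CliffordSystem

/-! ### The building blocks are gradings -/

theorem mem_m2Two_zero {M : Matrix (Fin 2) (Fin 2) ℝ} :
    M ∈ m2Two 0 ↔ M 0 0 = M 1 1 ∧ M 0 1 = -M 1 0 := by
  rw [m2Two, if_pos rfl, Submodule.mem_span_pair]
  constructor
  · rintro ⟨a, b, rfl⟩
    simp [sylC]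
  · rintro ⟨h1, h2⟩
    refine ⟨M 1 1, M 0 1, ?_⟩
    ext i j; fin_cases i <;> fin_cases j <;> simp [sylC, h1, h2]

theorem mem_m2Two_one {M : Matrix (Fin 2) (Fin 2) ℝ} :
    M ∈ m2Two 1 ↔ M 0 0 = -M 1 1 ∧ M 0 1 = M 1 0 := by
  rw [m2Two, if_neg (by decide), Submodule.mem_span_pair]
  constructor
  · rintro ⟨a, b, rfl⟩
    simp [sylA, sylB]
  · rintro ⟨h1, h2⟩
    refine ⟨M 0 0, M 0 1, ?_⟩
    ext i j; fin_cases i <;> fin_cases j <;> simp [sylA, sylB, h1, h2]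

@[simp] theorem qI_re : qI.re = 0 := rfl
@[simp] theorem qI_imI : qI.imI = 1 := rfl
@[simp] theorem qI_imJ : qI.imJ = 0 := rfl
@[simp] theorem qI_imK : qI.imK = 0 := rfl
@[simp] theorem qJ_re : qJ.re = 0 := rfl
@[simp] theorem qJ_imI : qJ.imI = 0 := rfl
@[simp] theorem qJ_imJ : qJ.imJ = 1 := rfl
@[simp] theorem qJ_imK : qJ.imK = 0 := rfl
@[simp] theorem qK_re : qK.re = 0 := rfl
@[simp] theorem qK_imI : qK.imI = 0 := rfl
@[simp] theorem qK_imJ : qK.imJ = 0 := rfl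
@[simp] theorem qK_imK : qK.imK = 1 := rfl

theorem mem_hTwo_zero {x : ℍ[ℝ]} : x ∈ hTwo 0 ↔ x.imJ = 0 ∧ x.imK = 0 := by
  rw [hTwo, if_pos rfl, Submodule.mem_span_pair]
  constructor
  · rintro ⟨a, b, rfl⟩
    simp
  · rintro ⟨h1, h2⟩
    refine ⟨x.re, x.imI, ?_⟩
    ext <;> simp [h1, h2]

theorem mem_hTwo_one {x : ℍ[ℝ]} : x ∈ hTwo 1 ↔ x.re = 0 ∧ x.imI = 0 := by
  rw [hTwo, if_neg (by decide), Submodule.mem_span_pair]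
  constructor
  · rintro ⟨a, b, rfl⟩
    simp
  · rintro ⟨h1, h2⟩
    refine ⟨x.imJ, x.imK, ?_⟩
    ext <;> simp [h1, h2]

theorem gradedMonoid_m2Two : SetLike.GradedMonoid m2Two where
  one_mem := mem_m2Two_zero.2 (by simp)
  mul_mem := by
    intro g h x y hx hy
    rcases zmod_two_eq g with rfl | rfl <;> rcases zmod_two_eq h with rfl | rfl <;>
      simp only [add_zero, zero_add, CharTwo.add_self_eq_zero, mem_m2Two_zero, mem_m2Two_one,
        Matrix.mul_apply, Fin.sum_univ_two] at hx hy ⊢ <;>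
      (rw [hx.1, hx.2, hy.1, hy.2]; constructor <;> ring)

theorem gradedMonoid_hTwo : SetLike.GradedMonoid hTwo where
  one_mem := mem_hTwo_zero.2 (by simp)
  mul_mem := by
    intro g h x y hx hy
    rcases zmod_two_eq g with rfl | rfl <;> rcases zmod_two_eq h with rfl | rfl <;>
      simp only [add_zero, zero_add, CharTwo.add_self_eq_zero, mem_hTwo_zero, mem_hTwo_one,
        Quaternion.re_mul, Quaternion.imI_mul, Quaternion.imJ_mul, Quaternion.imK_mul]
        at hx hy ⊢ <;>
      (rw [hx.1, hx.2, hy.1, hy.2]; constructor <;> ring)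

theorem sylC_mul_sylA : sylC * sylA = -sylB := by
  ext i j; fin_cases i <;> fin_cases j <;> simp [sylA, sylB, sylC, Matrix.mul_apply]

theorem sylA_mul_sylC : sylA * sylC = sylB := by
  ext i j; fin_cases i <;> fin_cases j <;> simp [sylA, sylB, sylC, Matrix.mul_apply]

theorem sylC_mul_sylB : sylC * sylB = sylA := by
  ext i j; fin_cases i <;> fin_cases j <;> simp [sylA, sylB, sylC, Matrix.mul_apply]

theorem sylB_mul_sylC : sylB * sylC = -sylA := by
  ext i j; fin_cases i <;> fin_cases j <;> simp [sylA, sylB, sylC, Matrix.mul_apply]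

theorem qI_mul_qK : qI * qK = -qJ := by
  rw [← qI_mul_qJ, ← mul_assoc, qI_mul_self, neg_one_mul]

theorem qK_mul_qI : qK * qI = qJ := by
  rw [← qI_mul_qJ, mul_assoc, qJ_mul_qI, mul_neg, qI_mul_qK, neg_neg]

theorem qK_mul_qJ : qK * qJ = -qI := by
  rw [← qI_mul_qJ, mul_assoc, qJ_mul_self, mul_neg_one]

theorem qJ_mul_qK : qJ * qK = qI := by
  rw [← qI_mul_qJ, ← mul_assoc, qJ_mul_qI, neg_mul, qK_mul_qJ, neg_neg]

theorem m2Unit_zero_zero : m2Unit (0, 0) = 1 := rfl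
theorem m2Unit_one_zero : m2Unit (1, 0) = sylA := rfl
theorem m2Unit_zero_one : m2Unit (0, 1) = sylB := rfl
theorem m2Unit_one_one : m2Unit (1, 1) = sylC := rfl
theorem hUnit_zero_zero : hUnit (0, 0) = 1 := rfl
theorem hUnit_one_zero : hUnit (1, 0) = qI := rfl
theorem hUnit_zero_one : hUnit (0, 1) = qJ := rfl
theorem hUnit_one_one : hUnit (1, 1) = qK := rfl

theorem m2Unit_mul (p q : ZMod 2 × ZMod 2) :
    m2Unit p * m2Unit q = m2Unit (p + q) ∨ m2Unit p * m2Unit q = -m2Unit (p + q) := by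
  obtain ⟨a, b⟩ := p
  obtain ⟨c, d⟩ := q
  rcases zmod_two_eq a with rfl | rfl <;> rcases zmod_two_eq b with rfl | rfl <;>
    rcases zmod_two_eq c with rfl | rfl <;> rcases zmod_two_eq d with rfl | rfl <;>
    simp only [Prod.mk_add_mk, add_zero, zero_add, CharTwo.add_self_eq_zero, m2Unit_zero_zero,
      m2Unit_one_zero, m2Unit_zero_one, m2Unit_one_one, one_mul, mul_one, sylA_mul_self,
      sylB_mul_self, sylC_mul_self, sylA_mul_sylB, sylB_mul_sylA, sylC_mul_sylA, sylA_mul_sylC,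
      sylC_mul_sylB, sylB_mul_sylC, true_or, or_true]

theorem hUnit_mul (p q : ZMod 2 × ZMod 2) :
    hUnit p * hUnit q = hUnit (p + q) ∨ hUnit p * hUnit q = -hUnit (p + q) := by
  obtain ⟨a, b⟩ := p
  obtain ⟨c, d⟩ := q
  rcases zmod_two_eq a with rfl | rfl <;> rcases zmod_two_eq b with rfl | rfl <;>
    rcases zmod_two_eq c with rfl | rfl <;> rcases zmod_two_eq d with rfl | rfl <;>
    simp only [Prod.mk_add_mk, add_zero, zero_add, CharTwo.add_self_eq_zero, hUnit_zero_zero,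
      hUnit_one_zero, hUnit_zero_one, hUnit_one_one, one_mul, mul_one, qI_mul_self,
      qJ_mul_self, qK_mul_self, qI_mul_qJ, qJ_mul_qI, qK_mul_qI, qI_mul_qK,
      qK_mul_qJ, qJ_mul_qK, true_or, or_true]

theorem gradedMonoid_of_span_singleton {G S : Type*} [AddCommGroup G] [Ring S] [Algebra ℝ S]
    {𝒜 : G → Submodule ℝ S} {w : G → S} (h𝒜 : ∀ g, 𝒜 g = Submodule.span ℝ {w g}) (h0 : w 0 = 1)
    (hw : ∀ g h, w g * w h = w (g + h) ∨ w g * w h = -w (g + h)) : SetLike.GradedMonoid 𝒜 where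
  one_mem := by rw [h𝒜, h0]; exact Submodule.mem_span_singleton_self _
  mul_mem := by
    intro g h x y hx hy
    rw [h𝒜, Submodule.mem_span_singleton] at hx hy
    obtain ⟨r, rfl⟩ := hx
    obtain ⟨s, rfl⟩ := hy
    rw [h𝒜, smul_mul_assoc, mul_smul_comm]
    refine Submodule.smul_mem _ _ (Submodule.smul_mem _ _ ?_)
    rcases hw g h with e | e <;> rw [e]
    · exact Submodule.mem_span_singleton_self _
    · exact Submodule.neg_mem _ (Submodule.mem_span_singleton_self _)

theorem gradedMonoid_m2Four : SetLike.GradedMonoid m2Four :=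
  gradedMonoid_of_span_singleton m2Four_eq rfl m2Unit_mul

theorem gradedMonoid_hFour : SetLike.GradedMonoid hFour :=
  gradedMonoid_of_span_singleton hFour_eq rfl hUnit_mul

theorem gradedMonoid_tensorGrading {G H S S' : Type*} [AddCommGroup G] [AddCommGroup H] [Ring S]
    [Algebra ℝ S] [Ring S'] [Algebra ℝ S'] {𝒜 : G → Submodule ℝ S} {ℬ : H → Submodule ℝ S'}
    (h𝒜 : SetLike.GradedMonoid 𝒜) (hℬ : SetLike.GradedMonoid ℬ) :
    SetLike.GradedMonoid (tensorGrading 𝒜 ℬ) where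
  one_mem := tmul_mem_tensorGrading h𝒜.one_mem hℬ.one_mem
  mul_mem := by
    intro p q x y hx hy
    have h1 : ∀ a ∈ 𝒜 p.1, ∀ b ∈ ℬ p.2, tensorGrading 𝒜 ℬ q ≤
        (tensorGrading 𝒜 ℬ (p + q)).comap (LinearMap.mulLeft ℝ (a ⊗ₜ[ℝ] b)) := by
      intro a ha b hb
      refine Submodule.map₂_le.2 fun c hc d hd => ?_
      simp only [Submodule.mem_comap, TensorProduct.mk_apply, LinearMap.mulLeft_apply,
        Algebra.TensorProduct.tmul_mul_tmul]
      exact tmul_mem_tensorGrading (h𝒜.mul_mem ha hc) (hℬ.mul_mem hb hd)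
    have h2 : tensorGrading 𝒜 ℬ p ≤
        (tensorGrading 𝒜 ℬ (p + q)).comap (LinearMap.mulRight ℝ y) :=
      Submodule.map₂_le.2 fun a ha b hb => h1 a ha b hb hy
    exact h2 hx

theorem gradedMonoid_tensorPowerGrading {G S : Type*} [AddCommGroup G] [Ring S]
    [Algebra ℝ S] {𝒜 : G → Submodule ℝ S} (h𝒜 : SetLike.GradedMonoid 𝒜) (k : ℕ) :
    SetLike.GradedMonoid (tensorPowerGrading 𝒜 k) where
  one_mem := Submodule.subset_span ⟨1, fun _ => h𝒜.one_mem, rfl⟩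
  mul_mem := by
    intro p q x y hx hy
    have h1 : ∀ a : Fin k → S, (∀ j, a j ∈ 𝒜 (p j)) → tensorPowerGrading 𝒜 k q ≤
        (tensorPowerGrading 𝒜 k (p + q)).comap
          (LinearMap.mulLeft ℝ (PiTensorProduct.tprod ℝ a)) := by
      intro a ha
      refine Submodule.span_le.2 ?_
      rintro _ ⟨c, hc, rfl⟩
      simp only [Submodule.comap_coe, Set.mem_preimage, LinearMap.mulLeft_apply, SetLike.mem_coe,
        PiTensorProduct.tprod_mul_tprod]
      exact tprod_mem_tensorPowerGrading fun j => h𝒜.mul_mem (ha j) (hc j)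
    have h2 : tensorPowerGrading 𝒜 k p ≤
        (tensorPowerGrading 𝒜 k (p + q)).comap (LinearMap.mulRight ℝ y) := by
      refine Submodule.span_le.2 ?_
      rintro _ ⟨a, ha, rfl⟩
      exact h1 a ha hy
    exact h2 hx

/-! ### Clifford generators of the two families -/

theorem matrix_eq_sum (M : Matrix (Fin 2) (Fin 2) ℝ) :
    M = ((M 0 0 + M 1 1) / 2) • (1 : Matrix (Fin 2) (Fin 2) ℝ) +
      ((M 0 0 - M 1 1) / 2) • sylA + ((M 0 1 + M 1 0) / 2) • sylB +
      ((M 0 1 - M 1 0) / 2) • sylC := by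
  ext i j
  fin_cases i <;> fin_cases j <;> simp [sylA, sylB, sylC] <;> ring

theorem subalgebra_m2_eq_top {𝔖 : Subalgebra ℝ (Matrix (Fin 2) (Fin 2) ℝ)} (hA : sylA ∈ 𝔖)
    (hC : sylC ∈ 𝔖) : 𝔖 = ⊤ := by
  rw [eq_top_iff]
  intro M _
  have hB : sylB ∈ 𝔖 := sylA_mul_sylC ▸ 𝔖.mul_mem hA hC
  rw [matrix_eq_sum M]
  exact 𝔖.add_mem (𝔖.add_mem (𝔖.add_mem (𝔖.smul_mem 𝔖.one_mem _) (𝔖.smul_mem hA _))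
    (𝔖.smul_mem hB _)) (𝔖.smul_mem hC _)

theorem subalgebra_quaternion_eq_top {𝔖 : Subalgebra ℝ ℍ[ℝ]} (hI : qI ∈ 𝔖)
    (hJ : qJ ∈ 𝔖) : 𝔖 = ⊤ := by
  rw [eq_top_iff]
  intro x _
  have hK : qK ∈ 𝔖 := qI_mul_qJ ▸ 𝔖.mul_mem hI hJ
  have hx : x = x.re • (1 : ℍ[ℝ]) + x.imI • qI + x.imJ • qJ + x.imK • qK := by
    ext <;> simp
  rw [hx]
  exact 𝔖.add_mem (𝔖.add_mem (𝔖.add_mem (𝔖.smul_mem 𝔖.one_mem _) (𝔖.smul_mem hI _))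
    (𝔖.smul_mem hJ _)) (𝔖.smul_mem hK _)

/-- The algebra of `typeI k`. -/
abbrev TypeIAlg (k : ℕ) :=
  Matrix (Fin 2) (Fin 2) ℝ ⊗[ℝ] (⨂[ℝ] _ : Fin k, Matrix (Fin 2) (Fin 2) ℝ)

theorem tmul_mul_tmul_of_ring {S S' : Type*} [Ring S] [Algebra ℝ S] [Ring S'] [Algebra ℝ S']
    (a b : S) (c d : S') : (a ⊗ₜ[ℝ] c) * (b ⊗ₜ[ℝ] d) = (a * b) ⊗ₜ[ℝ] (c * d) :=
  Algebra.TensorProduct.tmul_mul_tmul a b c d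

/-- Pure tensors with `k + 1` factors. -/
noncomputable def pureTensor (k : ℕ) : (Fin (k + 1) → Matrix (Fin 2) (Fin 2) ℝ) →* TypeIAlg k where
  toFun x := x 0 ⊗ₜ PiTensorProduct.tprod ℝ fun j => x j.succ
  map_one' := rfl
  map_mul' x y := by
    have h := tmul_mul_tmul_of_ring (x 0) (y 0) (PiTensorProduct.tprod ℝ fun j : Fin k => x j.succ)
      (PiTensorProduct.tprod ℝ fun j : Fin k => y j.succ)
    rw [PiTensorProduct.tprod_mul_tprod] at h
    exact h.symm

theorem pureTensor_apply {k : ℕ} (x : Fin (k + 1) → Matrix (Fin 2) (Fin 2) ℝ) :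
    pureTensor k x = x 0 ⊗ₜ PiTensorProduct.tprod ℝ fun j => x j.succ := rfl

theorem pureTensor_smul {k : ℕ} (c : Fin (k + 1) → ℝ)
    (x : Fin (k + 1) → Matrix (Fin 2) (Fin 2) ℝ) :
    pureTensor k (fun l => c l • x l) = (∏ l, c l) • pureTensor k x := by
  rw [pureTensor_apply, pureTensor_apply, MultilinearMap.map_smul_univ, Fin.prod_univ_succ,
    TensorProduct.smul_tmul_smul]

/-- Multilinearity lets a sign in one slot pass to the whole tensor; every sign rule for strings
reduces to this. -/
theorem pureTensor_neg {k : ℕ} {x y : Fin (k + 1) → Matrix (Fin 2) (Fin 2) ℝ} (l₀ : Fin (k + 1))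
    (h₀ : y l₀ = -x l₀) (h : ∀ l, l ≠ l₀ → y l = x l) : pureTensor k y = -pureTensor k x := by
  have hy : y = fun l => (if l = l₀ then (-1 : ℝ) else 1) • x l := by
    funext l
    by_cases hl : l = l₀
    · subst hl; simp [h₀]
    · simp [hl, h l hl]
  rw [hy, pureTensor_smul, Finset.prod_ite_eq', if_pos (Finset.mem_univ _)]
  exact neg_one_smul ℝ (pureTensor k x)

/-- The tensor `B ⊗ ⋯ ⊗ B ⊗ M ⊗ 1 ⊗ ⋯ ⊗ 1` with `M` in position `j`, as a family. -/
noncomputable def stringFamily {k : ℕ} (M : Matrix (Fin 2) (Fin 2) ℝ) (j : Fin (k + 1)) :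
    Fin (k + 1) → Matrix (Fin 2) (Fin 2) ℝ :=
  fun l => if l < j then sylB else if l = j then M else 1

theorem stringFamily_self {k : ℕ} (M : Matrix (Fin 2) (Fin 2) ℝ) (j : Fin (k + 1)) :
    stringFamily M j j = M := by
  simp [stringFamily]

theorem stringFamily_of_lt {k : ℕ} (M : Matrix (Fin 2) (Fin 2) ℝ) {j l : Fin (k + 1)} (h : l < j) :
    stringFamily M j l = sylB := by
  simp [stringFamily, h]

theorem stringFamily_of_gt {k : ℕ} (M : Matrix (Fin 2) (Fin 2) ℝ) {j l : Fin (k + 1)} (h : j < l) :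
    stringFamily M j l = 1 := by
  simp [stringFamily, h.not_gt, h.ne']

/-- Only slot `j` contributes a sign: before it both tensors have `B`, after it the string has `1`.
It serves both for longer strings and for `B ⊗ ⋯ ⊗ B`. -/
theorem pureTensor_anticomm_of_lt {k : ℕ} {M : Matrix (Fin 2) (Fin 2) ℝ}
    (hM : sylB * M = -(M * sylB)) {j : Fin (k + 1)}
    {x : Fin (k + 1) → Matrix (Fin 2) (Fin 2) ℝ} (hx : ∀ l ≤ j, x l = sylB) :
    pureTensor k x * pureTensor k (stringFamily M j) =
      -(pureTensor k (stringFamily M j) * pureTensor k x) := by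
  rw [← map_mul, ← map_mul]
  refine pureTensor_neg j ?_ fun l hl => ?_
  · rw [Pi.mul_apply, Pi.mul_apply, stringFamily_self, hx j le_rfl, hM]
  · rw [Pi.mul_apply, Pi.mul_apply]
    rcases lt_or_gt_of_ne hl with h | h
    · rw [stringFamily_of_lt _ h, hx l h.le]
    · rw [stringFamily_of_gt _ h, one_mul, mul_one]

theorem pureTensor_anticomm_same {k : ℕ} {M N : Matrix (Fin 2) (Fin 2) ℝ}
    (hMN : N * M = -(M * N)) (j : Fin (k + 1)) :
    pureTensor k (stringFamily N j) * pureTensor k (stringFamily M j) =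
      -(pureTensor k (stringFamily M j) * pureTensor k (stringFamily N j)) := by
  rw [← map_mul, ← map_mul]
  refine pureTensor_neg j ?_ fun l hl => ?_
  · rw [Pi.mul_apply, Pi.mul_apply, stringFamily_self, stringFamily_self, hMN]
  · rw [Pi.mul_apply, Pi.mul_apply]
    rcases lt_or_gt_of_ne hl with h | h
    · rw [stringFamily_of_lt _ h, stringFamily_of_lt _ h]
    · rw [stringFamily_of_gt _ h, stringFamily_of_gt _ h]

theorem stringFamily_mul_self {k : ℕ} (M : Matrix (Fin 2) (Fin 2) ℝ) (j l : Fin (k + 1))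
    (hl : l ≠ j) : stringFamily M j l * stringFamily M j l = 1 := by
  rcases lt_or_gt_of_ne hl with h | h
  · rw [stringFamily_of_lt _ h, sylB_mul_self]
  · rw [stringFamily_of_gt _ h, one_mul]

/-- The Clifford generators of `typeI k`. -/
noncomputable def typeIGen (k : ℕ) : Fin (k + 1) ⊕ Fin (k + 1) → TypeIAlg k :=
  Sum.elim (fun j => pureTensor k (stringFamily sylC j))
    (fun j => pureTensor k (stringFamily sylA j))

/-- The embedding of the `j`-th factor. -/
noncomputable def factorHom {k : ℕ} (j : Fin (k + 1)) :
    Matrix (Fin 2) (Fin 2) ℝ →ₐ[ℝ] TypeIAlg k :=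
  Fin.cases Algebra.TensorProduct.includeLeft
    (fun j => Algebra.TensorProduct.includeRight.comp
      (PiTensorProduct.singleAlgHom (R := ℝ) (A := fun _ : Fin k => Matrix (Fin 2) (Fin 2) ℝ) j)) j

theorem factorHom_apply {k : ℕ} (j : Fin (k + 1)) (M : Matrix (Fin 2) (Fin 2) ℝ) :
    factorHom j M = pureTensor k (Pi.mulSingle j M) := by
  refine Fin.cases ?_ (fun j => ?_) j
  · change M ⊗ₜ[ℝ] (1 : ⨂[ℝ] _ : Fin k, Matrix (Fin 2) (Fin 2) ℝ) = _
    rw [pureTensor_apply, Pi.mulSingle_eq_same, PiTensorProduct.one_def]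
    congr 2
  · change (1 : Matrix (Fin 2) (Fin 2) ℝ) ⊗ₜ[ℝ] PiTensorProduct.tprod ℝ
      (Pi.mulSingle j M : Fin k → Matrix (Fin 2) (Fin 2) ℝ) = _
    rw [pureTensor_apply, Pi.mulSingle_eq_of_ne (Fin.succ_ne_zero j).symm]
    congr 2
    funext l
    by_cases hl : l = j
    · subst hl; simp
    · rw [Pi.mulSingle_eq_of_ne hl, Pi.mulSingle_eq_of_ne (by simpa using hl)]

/-- The restriction of a family to the first `n` indices, extended by `1`. -/
def truncate {k : ℕ} (x : Fin (k + 1) → Matrix (Fin 2) (Fin 2) ℝ) (n : ℕ) :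
    Fin (k + 1) → Matrix (Fin 2) (Fin 2) ℝ :=
  fun l => if (l : ℕ) < n then x l else 1

/-- Once the first `n` factors are generated, so is the prefix `B ⊗ ⋯ ⊗ B` of the next string; as
`B² = 1`, multiplying by it strips the prefix and leaves `A` and `C` alone in the next slot, where
they generate `M₂(ℝ)`. -/
theorem pureTensor_truncate_mem {k : ℕ} {𝔖 : Subalgebra ℝ (TypeIAlg k)}
    (h𝔖 : ∀ i, typeIGen k i ∈ 𝔖) (n : ℕ) : n ≤ k + 1 →
    ∀ x : Fin (k + 1) → Matrix (Fin 2) (Fin 2) ℝ, pureTensor k (truncate x n) ∈ 𝔖 := by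
  induction n with
  | zero =>
    intro _ x
    rw [show truncate x 0 = 1 from rfl, map_one]
    exact 𝔖.one_mem
  | succ n ih =>
    intro hn x
    set j : Fin (k + 1) := ⟨n, hn⟩ with hj
    have hsingle : ∀ M, pureTensor k (stringFamily M j) ∈ 𝔖 → factorHom j M ∈ 𝔖 := by
      intro M hM
      have : (Pi.mulSingle j M : Fin (k + 1) → Matrix (Fin 2) (Fin 2) ℝ) =
          truncate (fun _ => sylB) n * stringFamily M j := by
        funext l
        rw [Pi.mul_apply]
        rcases lt_trichotomy l j with h | h | h
        · rw [Pi.mulSingle_eq_of_ne h.ne, stringFamily_of_lt _ h, truncate,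
            if_pos (show (l : ℕ) < n from h), sylB_mul_self]
        · subst h
          rw [Pi.mulSingle_eq_same, stringFamily_self, truncate, if_neg (lt_irrefl n), one_mul]
        · rw [Pi.mulSingle_eq_of_ne h.ne', stringFamily_of_gt _ h, truncate,
            if_neg (show ¬(l : ℕ) < n from (show n < (l : ℕ) from h).not_gt), one_mul]
      rw [factorHom_apply, this, map_mul]
      exact 𝔖.mul_mem (ih (by omega) _) hM
    have htop : 𝔖.comap (factorHom j) = ⊤ :=
      subalgebra_m2_eq_top (hsingle _ (h𝔖 (Sum.inr j))) (hsingle _ (h𝔖 (Sum.inl j)))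
    have hx : truncate x (n + 1) = truncate x n * Pi.mulSingle j (x j) := by
      funext l
      rw [Pi.mul_apply, truncate, truncate]
      rcases lt_trichotomy l j with h | h | h
      · have hl : (l : ℕ) < n := h
        rw [Pi.mulSingle_eq_of_ne h.ne, if_pos hl, if_pos (by omega), mul_one]
      · subst h
        rw [Pi.mulSingle_eq_same, if_neg (lt_irrefl n), if_pos (Nat.lt_succ_self n), one_mul]
      · have hl : n < (l : ℕ) := h
        rw [Pi.mulSingle_eq_of_ne h.ne', if_neg (by omega), if_neg (by omega), one_mul]
    rw [hx, map_mul, ← factorHom_apply]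
    refine 𝔖.mul_mem (ih (by omega) _) ?_
    have : x j ∈ 𝔖.comap (factorHom j) := htop ▸ Algebra.mem_top
    exact this

theorem subalgebra_typeI_eq_top {k : ℕ} {𝔖 : Subalgebra ℝ (TypeIAlg k)}
    (h𝔖 : ∀ i, typeIGen k i ∈ 𝔖) : 𝔖 = ⊤ := by
  have hpure : ∀ x, pureTensor k x ∈ 𝔖 := by
    intro x
    have := pureTensor_truncate_mem h𝔖 (k + 1) le_rfl x
    rwa [show truncate x (k + 1) = x from funext fun l => if_pos l.2] at this
  rw [eq_top_iff]
  rintro t -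
  induction t using TensorProduct.induction_on with
  | zero => exact 𝔖.zero_mem
  | tmul m y =>
    induction y using PiTensorProduct.induction_on with
    | smul_tprod r x =>
      rw [TensorProduct.tmul_smul]
      exact 𝔖.smul_mem (hpure (Fin.cons m x)) r
    | add x y hx hy => rw [TensorProduct.tmul_add]; exact 𝔖.add_mem hx hy
  | add x y hx hy => exact 𝔖.add_mem hx hy

theorem sylB_anti_sylA : sylB * sylA = -(sylA * sylB) := by
  rw [sylB_mul_sylA, sylA_mul_sylB]

theorem sylB_anti_sylC : sylB * sylC = -(sylC * sylB) := by
  rw [sylB_mul_sylC, sylC_mul_sylB]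

theorem sylA_anti_sylC : sylA * sylC = -(sylC * sylA) := by
  rw [sylA_mul_sylC, sylC_mul_sylA, neg_neg]

theorem sylC_anti_sylA : sylC * sylA = -(sylA * sylC) := by
  rw [sylA_mul_sylC, sylC_mul_sylA]

theorem stringFamily_anticomm_of_ne {k : ℕ} {M N : Matrix (Fin 2) (Fin 2) ℝ}
    (hM : sylB * M = -(M * sylB)) (hN : sylB * N = -(N * sylB)) {j l : Fin (k + 1)} (hjl : j ≠ l) :
    pureTensor k (stringFamily N l) * pureTensor k (stringFamily M j) =
      -(pureTensor k (stringFamily M j) * pureTensor k (stringFamily N l)) := by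
  rcases lt_or_gt_of_ne hjl with h | h
  · exact pureTensor_anticomm_of_lt hM fun m hm => stringFamily_of_lt _ (hm.trans_lt h)
  · rw [pureTensor_anticomm_of_lt hN fun m hm => stringFamily_of_lt _ (hm.trans_lt h), neg_neg]

theorem isCliffordSystem_typeIGen (k : ℕ) : IsCliffordSystem (typeIGen k) where
  sq_inl j := by
    rw [typeIGen, Sum.elim_inl, ← map_mul, ← map_one (pureTensor k)]
    refine pureTensor_neg j ?_ fun l hl => stringFamily_mul_self _ _ _ hl
    rw [Pi.mul_apply, stringFamily_self, sylC_mul_self, Pi.one_apply]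
  sq_inr j := by
    rw [typeIGen, Sum.elim_inr, ← map_mul, ← map_one (pureTensor k)]
    congr 1
    funext l
    by_cases hl : l = j
    · subst hl; rw [Pi.mul_apply, stringFamily_self, sylA_mul_self, Pi.one_apply]
    · exact stringFamily_mul_self _ _ _ hl
  anti := by
    rintro (i | i) (j | j) hij
    · exact stringFamily_anticomm_of_ne sylB_anti_sylC sylB_anti_sylC fun h => hij (by rw [h])
    · by_cases h : i = j
      · subst h; exact pureTensor_anticomm_same sylA_anti_sylC i
      · exact stringFamily_anticomm_of_ne sylB_anti_sylC sylB_anti_sylA h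
    · by_cases h : i = j
      · subst h; exact pureTensor_anticomm_same sylC_anti_sylA i
      · exact stringFamily_anticomm_of_ne sylB_anti_sylA sylB_anti_sylC h
    · exact stringFamily_anticomm_of_ne sylB_anti_sylA sylB_anti_sylA fun h => hij (by rw [h])
  adjoin_eq_top := subalgebra_typeI_eq_top fun i => Algebra.subset_adjoin (Set.mem_range_self i)
  finrank_eq := by
    rw [finrank_typeI, show k + 1 + (k + 1) = 2 * (k + 1) by ring, pow_mul, pow_succ]
    norm_num; ring

theorem gradedMonoid_typeI (k : ℕ) : SetLike.GradedMonoid (typeI k) :=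
  gradedMonoid_tensorGrading gradedMonoid_m2Two
    (gradedMonoid_tensorPowerGrading gradedMonoid_m2Four k)

theorem m2Unit_mem_m2Two (p : ZMod 2 × ZMod 2) : ∃ a, m2Unit p ∈ m2Two a := by
  -- The element `C` of degree `(1, 1)` acquires degree zero in `M₂⁽²⁾`, so degrees are reduced
  -- modulo `(1, 1)`.
  refine ⟨p.1 + p.2, ?_⟩
  obtain ⟨a, b⟩ := p
  rcases zmod_two_eq a with rfl | rfl <;> rcases zmod_two_eq b with rfl | rfl <;>
    simp only [add_zero, zero_add, CharTwo.add_self_eq_zero, m2Unit_zero_zero,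
      m2Unit_one_zero, m2Unit_zero_one, m2Unit_one_one, mem_m2Two_zero, mem_m2Two_one] <;>
    simp [sylA, sylB, sylC]

theorem pureTensor_mem_typeI {k : ℕ} {x : Fin (k + 1) → Matrix (Fin 2) (Fin 2) ℝ}
    (hx : ∀ l, ∃ p, x l = m2Unit p) : ∃ g, pureTensor k x ∈ typeI k g := by
  choose p hp using hx
  obtain ⟨a, ha⟩ := m2Unit_mem_m2Two (p 0)
  refine ⟨(a, fun j => p j.succ), tmul_mem_tensorGrading (hp 0 ▸ ha)
    (tprod_mem_tensorPowerGrading fun j => ?_)⟩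
  rw [hp]
  exact m2Unit_mem _

theorem stringFamily_eq_m2Unit {k : ℕ} (p : ZMod 2 × ZMod 2) (j l : Fin (k + 1)) :
    ∃ q, stringFamily (m2Unit p) j l = m2Unit q := by
  unfold stringFamily
  split_ifs
  · exact ⟨(0, 1), rfl⟩
  · exact ⟨p, rfl⟩
  · exact ⟨(0, 0), rfl⟩

theorem typeIGen_mem (k : ℕ) (i : Fin (k + 1) ⊕ Fin (k + 1)) :
    ∃ g, typeIGen k i ∈ typeI k g := by
  rcases i with j | j
  · exact pureTensor_mem_typeI fun l => stringFamily_eq_m2Unit (1, 1) j l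
  · exact pureTensor_mem_typeI fun l => stringFamily_eq_m2Unit (1, 0) j l

theorem isCoarseningOfClifford_typeI (k : ℕ) :
    IsCoarseningOfClifford (typeI k) (k + 1) (k + 1) :=
  (isCliffordSystem_typeIGen k).isCoarseningOfClifford (gradedMonoid_typeI k) (typeIGen_mem k)

/-! ### Tensoring with the quaternions -/

/-- The Clifford generators of `S ⊗ ℍ`. -/
noncomputable def quaternionGen {p m : ℕ} {S : Type*} [Ring S] [Algebra ℝ S]
    (e : Fin p ⊕ Fin m → S) (ω : S) : Fin (p + 2) ⊕ Fin m → S ⊗[ℝ] ℍ[ℝ] :=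
  Sum.elim (Fin.append (fun i => e (Sum.inl i) ⊗ₜ 1) ![ω ⊗ₜ qI, ω ⊗ₜ qJ])
    (fun i => e (Sum.inr i) ⊗ₜ 1)

/-- The reindexing separates the old generators from the two new ones, so anticommutation needs only
four cases. -/
theorem quaternionGen_cases {p m : ℕ} {S : Type*} [Ring S] [Algebra ℝ S]
    (e : Fin p ⊕ Fin m → S) (ω : S) : ∃ σ : Fin (p + 2) ⊕ Fin m ≃ (Fin p ⊕ Fin m) ⊕ Fin 2,
      ∀ i, quaternionGen e ω i = Sum.elim (fun i => e i ⊗ₜ 1) ![ω ⊗ₜ qI, ω ⊗ₜ qJ] (σ i) := by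
  refine ⟨((Equiv.sumCongr finSumFinEquiv.symm (Equiv.refl _)).trans
    (Equiv.sumAssoc _ _ _)).trans (((Equiv.refl _).sumCongr (Equiv.sumComm _ _)).trans
      (Equiv.sumAssoc _ _ _).symm), ?_⟩
  rintro (i | i)
  · refine Fin.addCases (fun i => ?_) (fun i => ?_) i
    · simp [quaternionGen]
    · simp [quaternionGen]
  · simp [quaternionGen]

/-- Multiplying `qI` and `qJ` by an `ω` that anticommutes with the old generators makes the new ones
anticommute with them, and `ω² = 1` preserves the squares `-1`. This raises `p` by two. -/
theorem IsCliffordSystem.tensorQuaternion {p m : ℕ} {S : Type*} [Ring S] [Algebra ℝ S]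
    {e : Fin p ⊕ Fin m → S} (he : IsCliffordSystem e) {ω : S} (hω : ω * ω = 1)
    (hωe : ∀ i, ω * e i = -(e i * ω)) : IsCliffordSystem (quaternionGen e ω) where
  sq_inl := by
    refine Fin.addCases (fun i => ?_) (fun i => ?_)
    · simp only [quaternionGen, Sum.elim_inl, Fin.append_left,
        Algebra.TensorProduct.tmul_mul_tmul, he.sq_inl, one_mul, TensorProduct.neg_tmul]
      rfl
    · simp only [quaternionGen, Sum.elim_inl, Fin.append_right]
      fin_cases i
      · simp [hω, qI_mul_self, TensorProduct.tmul_neg, Algebra.TensorProduct.one_def]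
      · simp [hω, qJ_mul_self, TensorProduct.tmul_neg, Algebra.TensorProduct.one_def]
  sq_inr i := by
    simp only [quaternionGen, Sum.elim_inr, Algebra.TensorProduct.tmul_mul_tmul, he.sq_inr, one_mul]
    rfl
  anti := by
    obtain ⟨σ, hσ⟩ := quaternionGen_cases e ω
    have key : ∀ i j : (Fin p ⊕ Fin m) ⊕ Fin 2, i ≠ j →
        (Sum.elim (fun i => e i ⊗ₜ 1) ![ω ⊗ₜ qI, ω ⊗ₜ qJ] j : S ⊗[ℝ] ℍ[ℝ]) *
          Sum.elim (fun i => e i ⊗ₜ 1) ![ω ⊗ₜ qI, ω ⊗ₜ qJ] i =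
        -(Sum.elim (fun i => e i ⊗ₜ 1) ![ω ⊗ₜ qI, ω ⊗ₜ qJ] i *
          Sum.elim (fun i => e i ⊗ₜ 1) ![ω ⊗ₜ qI, ω ⊗ₜ qJ] j) := by
      rintro (i | i) (j | j) hij
      · have : i ≠ j := fun h => hij (by rw [h])
        simp [he.anti i j this, TensorProduct.neg_tmul]
      · fin_cases j <;> simp [hωe i, TensorProduct.neg_tmul]
      · fin_cases i <;> simp [hωe j, TensorProduct.neg_tmul]
      · fin_cases i <;> fin_cases j <;>
          first
            | exact absurd rfl hij
            | simp [hω, qI_mul_qJ, qJ_mul_qI, TensorProduct.tmul_neg]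
    intro i j hij
    rw [hσ, hσ]
    exact key _ _ fun h => hij (σ.injective h)
  adjoin_eq_top := by
    set 𝔖 := Algebra.adjoin ℝ (Set.range (quaternionGen e ω))
    have hmem : ∀ i, quaternionGen e ω i ∈ 𝔖 := fun i =>
      Algebra.subset_adjoin (Set.mem_range_self i)
    have hleft : 𝔖.comap (Algebra.TensorProduct.includeLeft (R := ℝ) (S := ℝ) (B := ℍ[ℝ])) = ⊤ := by
      rw [eq_top_iff, ← he.adjoin_eq_top]
      refine Algebra.adjoin_le ?_
      rintro _ ⟨i | i, rfl⟩
      · have := hmem (Sum.inl (Fin.castAdd 2 i))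
        rw [quaternionGen, Sum.elim_inl, Fin.append_left] at this
        exact this
      · exact hmem (Sum.inr i)
    have hl : ∀ x, x ⊗ₜ 1 ∈ 𝔖 := fun x => by
      have : x ∈ 𝔖.comap (Algebra.TensorProduct.includeLeft (R := ℝ) (S := ℝ) (B := ℍ[ℝ])) :=
        hleft ▸ Algebra.mem_top
      exact this
    -- Since `ω ⊗ 1` is already generated and `ω² = 1`, the factor `ω` can be removed.
    have hq : ∀ q : ℍ[ℝ], ω ⊗ₜ q ∈ 𝔖 → 1 ⊗ₜ q ∈ 𝔖 := fun q hq => by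
      have := 𝔖.mul_mem (hl ω) hq
      rwa [Algebra.TensorProduct.tmul_mul_tmul, hω, one_mul] at this
    have hright : 𝔖.comap (Algebra.TensorProduct.includeRight (R := ℝ) (A := S)) = ⊤ := by
      refine subalgebra_quaternion_eq_top (hq _ ?_) (hq _ ?_)
      · have := hmem (Sum.inl (Fin.natAdd p 0))
        rwa [quaternionGen, Sum.elim_inl, Fin.append_right] at this
      · have := hmem (Sum.inl (Fin.natAdd p 1))
        rwa [quaternionGen, Sum.elim_inl, Fin.append_right] at this
    have hr : ∀ y : ℍ[ℝ], 1 ⊗ₜ y ∈ 𝔖 := fun y => by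
      have : y ∈ 𝔖.comap (Algebra.TensorProduct.includeRight (R := ℝ) (A := S)) :=
        hright ▸ Algebra.mem_top
      exact this
    rw [eq_top_iff]
    rintro t -
    induction t using TensorProduct.induction_on with
    | zero => exact 𝔖.zero_mem
    | tmul x y =>
      have := 𝔖.mul_mem (hl x) (hr y)
      rwa [Algebra.TensorProduct.tmul_mul_tmul, one_mul, mul_one] at this
    | add x y hx hy => exact 𝔖.add_mem hx hy
  finrank_eq := by
    rw [Module.finrank_tensorProduct, he.finrank_eq, Quaternion.finrank_eq_four]
    rw [show p + 2 + m = p + m + 2 by ring, pow_add _ (p + m) 2]; norm_num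

theorem quaternionGen_mem {p m : ℕ} {G S : Type*} [AddCommGroup G] [Ring S] [Algebra ℝ S]
    {𝒜 : G → Submodule ℝ S} {e : Fin p ⊕ Fin m → S} {ω : S} (he : ∀ i, ∃ g, e i ∈ 𝒜 g)
    (hω : ∃ g, ω ∈ 𝒜 g) (i : Fin (p + 2) ⊕ Fin m) :
    ∃ g, quaternionGen e ω i ∈ tensorGrading 𝒜 hFour g := by
  obtain ⟨σ, hσ⟩ := quaternionGen_cases e ω
  rw [hσ]
  obtain ⟨g, hg⟩ := hω
  rcases σ i with j | j
  · obtain ⟨g', hg'⟩ := he j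
    exact ⟨_, tmul_mem_tensorGrading hg' (hUnit_mem (0, 0))⟩
  · fin_cases j
    · exact ⟨_, tmul_mem_tensorGrading hg (hUnit_mem (1, 0))⟩
    · exact ⟨_, tmul_mem_tensorGrading hg (hUnit_mem (0, 1))⟩

theorem isCoarseningOfClifford_typeII (k : ℕ) :
    IsCoarseningOfClifford (typeII k) (k + 3) (k + 1) := by
  -- The full string `B ⊗ ⋯ ⊗ B` plays the role of `ω`: it anticommutes with every generator of the
  -- first family.
  have hω : pureTensor k (fun _ => sylB) * pureTensor k (fun _ => sylB) = 1 := by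
    rw [← map_mul, ← map_one (pureTensor k)]
    congr 1
    funext l
    exact sylB_mul_self
  have hωe : ∀ i, pureTensor k (fun _ => sylB) * typeIGen k i =
      -(typeIGen k i * pureTensor k fun _ => sylB) := by
    rintro (j | j)
    · exact pureTensor_anticomm_of_lt sylB_anti_sylC fun _ _ => rfl
    · exact pureTensor_anticomm_of_lt sylB_anti_sylA fun _ _ => rfl
  exact ((isCliffordSystem_typeIGen k).tensorQuaternion hω hωe).isCoarseningOfClifford
    (gradedMonoid_tensorGrading (gradedMonoid_typeI k) gradedMonoid_hFour)
    (quaternionGen_mem (typeIGen_mem k) (pureTensor_mem_typeI fun _ => ⟨(0, 1), rfl⟩))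

theorem isCoarseningOfClifford_hTwo : IsCoarseningOfClifford hTwo 2 0 := by
  have he : IsCliffordSystem (p := 2) (m := 0) (Sum.elim ![qI, qJ] Fin.elim0) := by
    refine ⟨fun i => ?_, fun i => i.elim0, ?_, ?_, ?_⟩
    · fin_cases i
      · exact qI_mul_self
      · exact qJ_mul_self
    · rintro (i | i) (j | j) hij
      · fin_cases i <;> fin_cases j <;>
          first
            | exact absurd rfl hij
            | simp [qI_mul_qJ, qJ_mul_qI]
      all_goals first | exact i.elim0 | exact j.elim0
    · exact subalgebra_quaternion_eq_top (Algebra.subset_adjoin ⟨Sum.inl 0, rfl⟩)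
        (Algebra.subset_adjoin ⟨Sum.inl 1, rfl⟩)
    · rw [Quaternion.finrank_eq_four]; norm_num
  refine he.isCoarseningOfClifford gradedMonoid_hTwo ?_
  rintro (i | i)
  · fin_cases i
    · exact ⟨0, mem_hTwo_zero.2 ⟨rfl, rfl⟩⟩
    · exact ⟨1, mem_hTwo_one.2 ⟨rfl, rfl⟩⟩
  · exact i.elim0

/-! ### Central division algebras over the reals -/

section Frobenius

variable {D : Type*} [DivisionRing D] [Algebra ℝ D]

/-- The minimal polynomial is irreducible over ℝ, so of degree at most two; completing the square
gives `a`. -/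
theorem exists_sub_sq_eq_real [FiniteDimensional ℝ D] (x : D) :
    ∃ a r : ℝ, (x - a • 1) * (x - a • 1) = r • 1 := by
  have hx : IsIntegral ℝ x := Algebra.IsIntegral.isIntegral x
  have hdeg := (minpoly.irreducible hx).degree_le_two
  have h0 := minpoly.aeval ℝ x
  have hne := minpoly.ne_zero hx
  rw [Polynomial.eq_quadratic_of_degree_le_two hdeg] at h0 hne
  generalize (minpoly ℝ x).coeff 2 = a at h0 hne
  generalize (minpoly ℝ x).coeff 1 = b at h0 hne
  generalize (minpoly ℝ x).coeff 0 = c at h0 hne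
  simp only [map_add, map_mul, Polynomial.aeval_C, Polynomial.aeval_X,
    Algebra.algebraMap_eq_smul_one, smul_mul_assoc, one_mul, pow_two] at h0
  by_cases ha : a = 0
  · subst ha
    rw [zero_smul, zero_add] at h0
    by_cases hb : b = 0
    · subst hb
      rw [zero_smul, zero_add, smul_eq_zero, or_iff_left one_ne_zero] at h0
      subst h0
      simp at hne
    · refine ⟨-(b⁻¹ * c), 0, ?_⟩
      have : x - (-(b⁻¹ * c)) • (1 : D) = b⁻¹ • (b • x + c • (1 : D)) := by
        rw [smul_add, smul_smul, smul_smul, inv_mul_cancel₀ hb]; module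
      rw [this, h0]; simp
  · refine ⟨-(b / (2 * a)), (b / (2 * a)) ^ 2 - c / a, ?_⟩
    have h1 : x * x = -(a⁻¹ * b) • x - (a⁻¹ * c) • (1 : D) := by
      have : a⁻¹ • (a • (x * x) + b • x + c • (1 : D)) = 0 := by rw [h0, smul_zero]
      rw [smul_add, smul_add, smul_smul, smul_smul, smul_smul, inv_mul_cancel₀ ha, one_smul] at this
      rw [← sub_eq_zero, ← this]; module
    simp only [sub_mul, mul_sub, smul_mul_assoc, mul_smul_comm, one_mul, mul_one, h1]
    match_scalars <;> field_simp <;> ring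

theorem eq_real_of_sq_eq {w : D} {r : ℝ} (hr : 0 ≤ r) (hw : w * w = r • 1) :
    ∃ s : ℝ, w = s • 1 := by
  obtain ⟨s, rfl⟩ : ∃ s : ℝ, r = s * s := ⟨Real.sqrt r, (Real.mul_self_sqrt hr).symm⟩
  have h0 : (w - s • (1 : D)) * (w + s • (1 : D)) = 0 := by
    simp only [sub_mul, mul_add, smul_mul_assoc, mul_smul_comm, one_mul, mul_one, hw]
    module
  rcases mul_eq_zero.1 h0 with h | h
  · exact ⟨_, sub_eq_zero.1 h⟩
  · exact ⟨-s, by rw [neg_smul]; exact eq_neg_of_add_eq_zero_left h⟩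

theorem exists_sq_eq_neg_one_of_sq {w : D} {r : ℝ} (hr : r < 0) (hw : w * w = r • 1) :
    ∃ s : ℝ, s ≠ 0 ∧ (s • w) * (s • w) = -1 := by
  obtain ⟨c, hc, h | h⟩ := exists_smul_mul_self_eq hr.ne hw
  · rw [smul_mul_assoc, mul_smul_comm, hw, smul_smul, smul_smul] at h
    have h2 := sub_eq_zero.2 h
    rw [← one_smul ℝ (1 : D), smul_smul, ← sub_smul, smul_eq_zero, or_iff_left one_ne_zero] at h2
    nlinarith [mul_self_nonneg c]
  · exact ⟨c, hc, h⟩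

variable [FiniteDimensional ℝ D]

/-- The centraliser of `i` is ℂ: after a real shift `x` has a real square, and a negative one
factors as `(w - s i)(w + s i) = 0`. -/
theorem eq_complex_of_commute {i x : D} (hi : i * i = -1) (hx : x * i = i * x) :
    ∃ p q : ℝ, x = p • 1 + q • i := by
  obtain ⟨a, r, h⟩ := exists_sub_sq_eq_real x
  rcases le_or_gt 0 r with hr | hr
  · obtain ⟨s, hs⟩ := eq_real_of_sq_eq hr h
    exact ⟨s + a, 0, by rw [zero_smul, add_zero, add_smul, ← hs, sub_add_cancel]⟩
  · have hs := Real.mul_self_sqrt (show 0 ≤ -r by linarith)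
    set s := Real.sqrt (-r)
    set w := x - a • (1 : D) with hw
    have hwi : w * i = i * w := by simp [hw, sub_mul, mul_sub, hx]
    have h0 : (w - s • i) * (w + s • i) = 0 := by
      simp only [sub_mul, mul_add, smul_mul_assoc, mul_smul_comm, h, hi, hwi]
      rw [show r = -(s * s) by linarith]; module
    rcases mul_eq_zero.1 h0 with h1 | h1
    · refine ⟨a, s, ?_⟩
      rw [← sub_eq_zero.1 h1, hw]; abel
    · refine ⟨a, -s, ?_⟩
      rw [neg_smul, ← eq_neg_of_add_eq_zero_left h1, hw]; abel

/-- A central division algebra over `ℝ` other than `ℝ` is the quaternions. -/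
theorem nonempty_algEquiv_quaternion [Algebra.IsCentral ℝ D] (hd : Module.finrank ℝ D ≠ 1) :
    Nonempty (ℍ[ℝ] ≃ₐ[ℝ] D) := by
  obtain ⟨x, hx⟩ : ∃ x : D, ∀ r : ℝ, x ≠ r • 1 := by
    by_contra! hc
    refine hd (le_antisymm (finrank_le_one (1 : D) fun w => ?_) Module.finrank_pos)
    obtain ⟨r, hr⟩ := hc w
    exact ⟨r, hr.symm⟩
  obtain ⟨i, hi⟩ : ∃ i : D, i * i = -1 := by
    obtain ⟨a, r, h⟩ := exists_sub_sq_eq_real x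
    have hr : r < 0 := by
      by_contra! hr
      obtain ⟨s, hs⟩ := eq_real_of_sq_eq hr h
      exact hx (s + a) (by rw [add_smul, ← hs, sub_add_cancel])
    obtain ⟨s, -, hs⟩ := exists_sq_eq_neg_one_of_sq hr h
    exact ⟨_, hs⟩
  have hireal : ∀ r : ℝ, i ≠ r • 1 := by
    rintro r rfl
    rw [smul_mul_assoc, one_mul, smul_smul, ← neg_one_smul ℝ, ← sub_eq_zero, ← sub_smul,
      smul_eq_zero, or_iff_left one_ne_zero] at hi
    nlinarith [mul_self_nonneg r]
  obtain ⟨y, hy⟩ : ∃ y : D, y * i ≠ i * y := by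
    by_contra! hc
    obtain ⟨r, hr⟩ := IsDivisionGrading.exists_real_of_commute hc
    exact hireal r hr
  -- `z + i z i` is twice the part of `z` anticommuting with `i`, and `z - i z i` twice the
  -- commuting part.
  have hanti : ∀ z, (z + i * z * i) * i = -(i * (z + i * z * i)) := by
    intro z
    rw [add_mul, mul_add, mul_assoc (i * z), hi, mul_assoc i z i, ← mul_assoc i i, hi]
    simp
  obtain ⟨j, hj0, hji⟩ : ∃ j : D, j ≠ 0 ∧ j * i = -(i * j) := by
    refine ⟨y + i * y * i, fun h => hy ?_, hanti y⟩
    have h2 : i * (y + i * y * i) = 0 := by rw [h, mul_zero]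
    rw [mul_add, ← mul_assoc, ← mul_assoc, hi, neg_one_mul, neg_mul] at h2
    exact (sub_eq_zero.1 (by rw [sub_eq_add_neg]; exact h2)).symm
  -- `j²` commutes with `i`, hence is complex; it commutes with `j`, hence is real. It is negative,
  -- since otherwise `j` would be real and could not anticommute with `i`. Rescaling gives `k`.
  obtain ⟨k, hk, hki⟩ : ∃ k : D, k * k = -1 ∧ k * i = -(i * k) := by
    have hjj : j * j * i = i * (j * j) := by
      rw [mul_assoc, hji, mul_neg, ← mul_assoc, hji, neg_mul, neg_neg, mul_assoc]
    obtain ⟨p, q, hpq⟩ := eq_complex_of_commute hi hjj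
    have hq : q = 0 := by
      have h1 : j * (j * j) = (j * j) * j := (mul_assoc j j j).symm
      rw [hpq, mul_add, add_mul, mul_smul_comm, mul_smul_comm, mul_one, smul_mul_assoc,
        smul_mul_assoc, one_mul, hji] at h1
      have h2 : q • (i * j) = 0 := eq_zero_of_eq_neg (by
        rw [← smul_neg]; exact (add_left_cancel h1).symm)
      have hi0 : i ≠ 0 := by rintro rfl; simp at hi
      exact (smul_eq_zero.1 h2).resolve_right (mul_ne_zero hi0 hj0)
    subst hq
    rw [zero_smul, add_zero] at hpq
    have hp : p < 0 := by
      by_contra! hp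
      obtain ⟨s, rfl⟩ := eq_real_of_sq_eq hp hpq
      have h1 : i = 0 ∨ s = 0 := by
        have := eq_zero_of_eq_neg (show s • i = -(s • i) by simpa using hji)
        rw [smul_eq_zero] at this
        exact this.symm
      rcases h1 with rfl | rfl
      · simp at hi
      · simp at hj0
    obtain ⟨s, -, hs⟩ := exists_sq_eq_neg_one_of_sq hp hpq
    exact ⟨s • j, hs, by rw [smul_mul_assoc, hji, mul_smul_comm, smul_neg]⟩
  let f : ℍ[ℝ] →ₐ[ℝ] D := hHom i k hi hk hki
  refine ⟨AlgEquiv.ofBijective f ⟨f.toRingHom.injective, ?_⟩⟩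
  rw [← AlgHom.range_eq_top, eq_top_iff]
  rintro z -
  have hi' : i ∈ f.range := ⟨qI, hHom_qI⟩
  have hk' : k ∈ f.range := ⟨qJ, hHom_qJ⟩
  have hcomplex : ∀ w : D, w * i = i * w → w ∈ f.range := by
    intro w hw
    obtain ⟨p, q, rfl⟩ := eq_complex_of_commute hi hw
    exact f.range.add_mem (f.range.smul_mem f.range.one_mem _) (f.range.smul_mem hi' _)
  have h1 : z - i * z * i ∈ f.range := hcomplex _ (by
    rw [sub_mul, mul_sub, mul_assoc (i * z), hi, mul_assoc i z i, ← mul_assoc i i, hi]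
    simp [add_comm])
  have h2 : z + i * z * i ∈ f.range := by
    -- The product of two elements anticommuting with `i` commutes with `i`, so it is complex.
    have h3 : (z + i * z * i) * k ∈ f.range := hcomplex _ (by
      rw [mul_assoc, hki, mul_neg, ← mul_assoc, hanti, neg_mul, neg_neg, mul_assoc])
    have h4 := f.range.mul_mem h3 hk'
    rw [mul_assoc, hk, mul_neg_one] at h4
    simpa using f.range.neg_mem h4
  have h5 := f.range.smul_mem (f.range.add_mem h1 h2) (1 / 2 : ℝ)
  have : (1 / 2 : ℝ) • (z - i * z * i + (z + i * z * i)) = z := by module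
  rwa [this] at h5

end Frobenius

/-! ### Existence -/

/-- There is a division grading with two-dimensional components. -/
def HasTwoDimGrading (R : Type*) [Ring R] [Algebra ℝ R] : Prop :=
  ∃ (G : Type) (_ : AddCommGroup G) (𝒜 : G → Submodule ℝ R),
    IsDivisionGrading 𝒜 ∧ ∀ g, Module.finrank ℝ (𝒜 g) = 2

theorem isDivisionGrading_of_finrank {G R : Type*} [AddCommGroup G] [Finite G] [Ring R]
    [Algebra ℝ R] [FiniteDimensional ℝ R] {𝒜 : G → Submodule ℝ R} (hg : SetLike.GradedMonoid 𝒜)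
    (htop : iSup 𝒜 = ⊤) (h2 : ∀ g, Module.finrank ℝ (𝒜 g) = 2)
    (hrank : Module.finrank ℝ R = Nat.card G * 2)
    (hunit : ∀ g, ∀ x ∈ 𝒜 g, x ≠ 0 → IsUnit x) : IsDivisionGrading 𝒜 where
  gradedMonoid := hg
  isInternal := by
    let _ : DecidableEq G := Classical.decEq G
    let _ := Fintype.ofFinite G
    refine isInternal_of_finrank htop ?_
    rw [hrank, Nat.card_eq_fintype_card]
    simp [h2]
  isUnit_of_mem := hunit

theorem HasTwoDimGrading.congr {R S : Type*} [Ring R] [Algebra ℝ R] [Ring S] [Algebra ℝ S]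
    [FiniteDimensional ℝ R] (e : R ≃ₐ[ℝ] S) (h : HasTwoDimGrading R) : HasTwoDimGrading S := by
  obtain ⟨G, _, 𝒜, h𝒜, h2⟩ := h
  have := h𝒜.finite h2
  have : FiniteDimensional ℝ S := Module.Finite.equiv e.toLinearEquiv
  have h2' : ∀ g, Module.finrank ℝ ((𝒜 g).map e.toLinearMap) = 2 := fun g => by
    rw [← h2 g]
    exact LinearEquiv.finrank_map_eq e.toLinearEquiv (𝒜 g)
  have hg : SetLike.GradedMonoid fun g => (𝒜 g).map e.toLinearMap :=
    { one_mem := ⟨1, h𝒜.one_mem, map_one e⟩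
      mul_mem := by
        rintro g g' _ _ ⟨x, hx, rfl⟩ ⟨y, hy, rfl⟩
        exact ⟨x * y, h𝒜.mul_mem hx hy, map_mul e x y⟩ }
  refine ⟨G, _, fun g => (𝒜 g).map e.toLinearMap, isDivisionGrading_of_finrank hg ?_ h2' ?_ ?_, h2'⟩
  · rw [← Submodule.map_iSup, h𝒜.iSup_eq_top, Submodule.map_top, LinearMap.range_eq_top]
    exact e.surjective
  · rw [← e.toLinearEquiv.finrank_eq, h𝒜.finrank_eq h2]
  · rintro g _ ⟨x, hx, rfl⟩ h0
    have hx0 : x ≠ 0 := by rintro rfl; exact h0 (map_zero e)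
    exact (h𝒜.isUnit_of_mem g x hx hx0).map e

theorem iSup_m2Four : iSup m2Four = ⊤ := by
  rw [eq_top_iff]
  rintro M -
  have hm : ∀ p, m2Unit p ∈ iSup m2Four := fun p => Submodule.mem_iSup_of_mem p (m2Unit_mem p)
  rw [matrix_eq_sum M]
  exact Submodule.add_mem _ (Submodule.add_mem _ (Submodule.add_mem _
    (Submodule.smul_mem _ _ (hm (0, 0))) (Submodule.smul_mem _ _ (hm (1, 0))))
    (Submodule.smul_mem _ _ (hm (0, 1)))) (Submodule.smul_mem _ _ (hm (1, 1)))

theorem HasTwoDimGrading.tensor_m2 {R : Type*} [Ring R] [Algebra ℝ R] [FiniteDimensional ℝ R]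
    (h : HasTwoDimGrading R) : HasTwoDimGrading (R ⊗[ℝ] Matrix (Fin 2) (Fin 2) ℝ) := by
  obtain ⟨G, _, 𝒜, h𝒜, h2⟩ := h
  have := h𝒜.finite h2
  -- The components of `M₂⁽⁴⁾` are lines spanned by units, so every homogeneous element of the
  -- product is a pure tensor `y ⊗ w`; dimension and invertibility are inherited from `y`.
  have hcomp : ∀ g, tensorGrading 𝒜 m2Four g =
      (𝒜 g.1).map ((TensorProduct.mk ℝ R (Matrix (Fin 2) (Fin 2) ℝ)).flip (m2Unit g.2)) := by
    intro g
    rw [tensorGrading, m2Four_eq, Submodule.map₂_span_singleton_eq_map_flip]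
  have hinj : ∀ p, Function.Injective
      ((TensorProduct.mk ℝ R (Matrix (Fin 2) (Fin 2) ℝ)).flip (m2Unit p)) := by
    intro p x y hxy
    obtain ⟨w, hw⟩ := isUnit_m2Unit p
    have h1 : x ⊗ₜ[ℝ] m2Unit p = y ⊗ₜ[ℝ] m2Unit p := hxy
    have h3 := congrArg (· * ((1 : R) ⊗ₜ[ℝ] (↑w⁻¹ : Matrix (Fin 2) (Fin 2) ℝ))) h1
    simp only [Algebra.TensorProduct.tmul_mul_tmul, mul_one, ← hw, Units.mul_inv] at h3
    exact Algebra.TensorProduct.includeLeft_injective (S := ℝ)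
      (algebraMap ℝ (Matrix (Fin 2) (Fin 2) ℝ)).injective h3
  have h2' : ∀ g, Module.finrank ℝ (tensorGrading 𝒜 m2Four g) = 2 := by
    intro g
    rw [hcomp, ← (Submodule.equivMapOfInjective _ (hinj g.2) (𝒜 g.1)).finrank_eq, h2]
  refine ⟨G × (ZMod 2 × ZMod 2), inferInstance, tensorGrading 𝒜 m2Four,
    isDivisionGrading_of_finrank
      (gradedMonoid_tensorGrading h𝒜.gradedMonoid gradedMonoid_m2Four) ?_ h2' ?_ ?_, h2'⟩
  · have : (⊤ : Submodule ℝ (R ⊗[ℝ] Matrix (Fin 2) (Fin 2) ℝ)) =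
        Submodule.map₂ (TensorProduct.mk ℝ R (Matrix (Fin 2) (Fin 2) ℝ)) (iSup 𝒜) (iSup m2Four) := by
      rw [h𝒜.iSup_eq_top, iSup_m2Four, TensorProduct.map₂_mk_top_top_eq_top]
    rw [this, Submodule.map₂_iSup_left, iSup_prod]
    refine iSup_congr fun g => ?_
    rw [Submodule.map₂_iSup_right]; rfl
  · rw [Module.finrank_tensorProduct, h𝒜.finrank_eq h2, finrank_m2, Nat.card_prod, Nat.card_prod,
      Nat.card_zmod]
    ring
  · intro g x hx hx0
    rw [hcomp] at hx
    obtain ⟨y, hy, rfl⟩ := hx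
    have hy0 : y ≠ 0 := by rintro rfl; exact hx0 (map_zero _)
    exact isUnit_tmul (h𝒜.isUnit_of_mem _ _ hy hy0) (isUnit_m2Unit _)

theorem finrank_span_pair {M : Type*} [AddCommGroup M] [Module ℝ M] {x y : M}
    (h : ∀ s t : ℝ, s • x + t • y = 0 → s = 0 ∧ t = 0) :
    Module.finrank ℝ (Submodule.span ℝ {x, y}) = 2 := by
  have hli : LinearIndependent ℝ ![x, y] := LinearIndependent.pair_iff.2 h
  have := finrank_span_eq_card hli
  rwa [Matrix.range_cons, Matrix.range_cons, Matrix.range_empty, Set.union_empty,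
    Set.singleton_union, Fintype.card_fin] at this

theorem hasTwoDimGrading_m2 : HasTwoDimGrading (Matrix (Fin 2) (Fin 2) ℝ) := by
  have h2 : ∀ a, Module.finrank ℝ (m2Two a) = 2 := by
    intro a
    rcases zmod_two_eq a with rfl | rfl
    · rw [m2Two, if_pos rfl]
      refine finrank_span_pair fun s t h => ?_
      have h0 := congrFun (congrFun h 0) 0
      have h1 := congrFun (congrFun h 0) 1
      simp [sylC] at h0 h1
      exact ⟨h0, h1⟩
    · rw [m2Two, if_neg (by decide)]
      refine finrank_span_pair fun s t h => ?_
      have h0 := congrFun (congrFun h 0) 0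
      have h1 := congrFun (congrFun h 0) 1
      simp [sylA, sylB] at h0 h1
      exact ⟨h0, h1⟩
  refine ⟨ZMod 2, inferInstance, m2Two, isDivisionGrading_of_finrank gradedMonoid_m2Two ?_ h2 ?_ ?_,
    h2⟩
  · rw [eq_top_iff]
    rintro M -
    have hm : ∀ p, m2Unit p ∈ iSup m2Two := fun p =>
      let ⟨a, ha⟩ := m2Unit_mem_m2Two p
      Submodule.mem_iSup_of_mem a ha
    rw [matrix_eq_sum M]
    exact Submodule.add_mem _ (Submodule.add_mem _ (Submodule.add_mem _
      (Submodule.smul_mem _ _ (hm (0, 0))) (Submodule.smul_mem _ _ (hm (1, 0))))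
      (Submodule.smul_mem _ _ (hm (0, 1)))) (Submodule.smul_mem _ _ (hm (1, 1)))
  · rw [finrank_m2, Nat.card_zmod]
  · intro a M hM hM0
    -- On the two components the determinant is plus or minus a sum of two squares of entries, so it
    -- vanishes only at zero.
    rw [Matrix.isUnit_iff_isUnit_det, isUnit_iff_ne_zero, Matrix.det_fin_two]
    intro hdet
    refine hM0 ?_
    rcases zmod_two_eq a with rfl | rfl
    · obtain ⟨h1, h2⟩ := mem_m2Two_zero.1 hM
      rw [h1, h2] at hdet
      have e1 : M 1 1 = 0 := by nlinarith [sq_nonneg (M 1 1), sq_nonneg (M 1 0)]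
      have e2 : M 1 0 = 0 := by nlinarith [sq_nonneg (M 1 1), sq_nonneg (M 1 0)]
      ext i j
      fin_cases i <;> fin_cases j <;> simp [h1, h2, e1, e2]
    · obtain ⟨h1, h2⟩ := mem_m2Two_one.1 hM
      rw [h1, h2] at hdet
      have e1 : M 1 1 = 0 := by nlinarith [sq_nonneg (M 1 1), sq_nonneg (M 1 0)]
      have e2 : M 1 0 = 0 := by nlinarith [sq_nonneg (M 1 1), sq_nonneg (M 1 0)]
      ext i j
      fin_cases i <;> fin_cases j <;> simp [h1, h2, e1, e2]

theorem hasTwoDimGrading_quaternion : HasTwoDimGrading ℍ[ℝ] := by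
  have h2 : ∀ a, Module.finrank ℝ (hTwo a) = 2 := by
    intro a
    rcases zmod_two_eq a with rfl | rfl
    · rw [hTwo, if_pos rfl]
      refine finrank_span_pair fun s t h => ?_
      have h0 := congrArg QuaternionAlgebra.re h
      have h1 := congrArg QuaternionAlgebra.imI h
      exact ⟨by simpa using h0, by simpa using h1⟩
    · rw [hTwo, if_neg (by decide)]
      refine finrank_span_pair fun s t h => ?_
      have h0 := congrArg QuaternionAlgebra.imJ h
      have h1 := congrArg QuaternionAlgebra.imK h
      exact ⟨by simpa using h0, by simpa using h1⟩
  refine ⟨ZMod 2, inferInstance, hTwo, isDivisionGrading_of_finrank gradedMonoid_hTwo ?_ h2 ?_ ?_,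
    h2⟩
  · rw [eq_top_iff]
    rintro x -
    have hx : x = (⟨x.re, x.imI, 0, 0⟩ : ℍ[ℝ]) + (⟨0, 0, x.imJ, x.imK⟩ : ℍ[ℝ]) := by
      ext
      exacts [(add_zero _).symm, (add_zero _).symm, (zero_add _).symm, (zero_add _).symm]
    rw [hx]
    exact Submodule.add_mem _ (Submodule.mem_iSup_of_mem 0 (mem_hTwo_zero.2 ⟨rfl, rfl⟩))
      (Submodule.mem_iSup_of_mem 1 (mem_hTwo_one.2 ⟨rfl, rfl⟩))
  · rw [Quaternion.finrank_eq_four, Nat.card_zmod]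
  · intro a x _ hx0
    exact hx0.isUnit

/-- Matrices of size one are scalars. -/
def matrixOneEquiv (D : Type*) [Ring D] [Algebra ℝ D] : Matrix (Fin 1) (Fin 1) D ≃ₐ[ℝ] D where
  toFun M := M 0 0
  invFun d := Matrix.of fun _ _ => d
  left_inv M := by
    ext i j
    rw [Subsingleton.elim i 0, Subsingleton.elim j 0]; rfl
  right_inv _ := rfl
  map_mul' M N := by simp [Matrix.mul_apply]
  map_add' _ _ := rfl
  commutes' r := by simp [Matrix.algebraMap_matrix_apply]

/-! ### Existence for matrices of size a power of two. -/

section Matrices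

variable (D : Type*) [DivisionRing D] [Algebra ℝ D] [FiniteDimensional ℝ D]

/-- `M_n(D) ⊗ M₂(ℝ) ≅ M₂(M_n(D)) ≅ M_{2n}(D)`. -/
theorem HasTwoDimGrading.matrix_double {n : ℕ} (h : HasTwoDimGrading (Matrix (Fin n) (Fin n) D)) :
    HasTwoDimGrading (Matrix (Fin (2 * n)) (Fin (2 * n)) D) :=
  h.tensor_m2.congr (((matrixEquivTensor (Fin 2) ℝ (Matrix (Fin n) (Fin n) D)).symm.trans
    (Matrix.compAlgEquiv (Fin 2) (Fin n) D ℝ)).trans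
      (Matrix.reindexAlgEquiv ℝ D finProdFinEquiv))

theorem HasTwoDimGrading.matrix_pow {k₀ : ℕ}
    (h : HasTwoDimGrading (Matrix (Fin (2 ^ k₀)) (Fin (2 ^ k₀)) D)) (k : ℕ) (hk : k₀ ≤ k) :
    HasTwoDimGrading (Matrix (Fin (2 ^ k)) (Fin (2 ^ k)) D) := by
  induction k, hk using Nat.le_induction with
  | base => exact h
  | succ k _ ih => rw [pow_succ']; exact ih.matrix_double

theorem exists_grading [Algebra.IsCentral ℝ D] (k : ℕ)
    (hk : ¬(2 ^ k = 1 ∧ Module.finrank ℝ D = 1)) :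
    HasTwoDimGrading (Matrix (Fin (2 ^ k)) (Fin (2 ^ k)) D) := by
  -- For `D = ℝ` the construction starts at size two with `M₂⁽²⁾`, otherwise at size one with
  -- `ℍ⁽²⁾`.
  by_cases hd : Module.finrank ℝ D = 1
  · have hk1 : 1 ≤ k := by
      rcases Nat.eq_zero_or_pos k with rfl | h
      · exact absurd ⟨pow_zero 2, hd⟩ hk
      · exact h
    have hsurj : Function.Surjective (Algebra.ofId ℝ D) := by
      rw [← AlgHom.range_eq_top, eq_top_iff, ← Subalgebra.bot_eq_top_of_finrank_eq_one hd]
      exact bot_le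
    let e : ℝ ≃ₐ[ℝ] D := AlgEquiv.ofBijective (Algebra.ofId ℝ D)
      ⟨(algebraMap ℝ D).injective, hsurj⟩
    have h1 : HasTwoDimGrading (Matrix (Fin (2 ^ 1)) (Fin (2 ^ 1)) D) :=
      hasTwoDimGrading_m2.congr e.mapMatrix
    exact h1.matrix_pow D k hk1
  · obtain ⟨e⟩ := nonempty_algEquiv_quaternion hd
    have h0 : HasTwoDimGrading (Matrix (Fin (2 ^ 0)) (Fin (2 ^ 0)) D) :=
      hasTwoDimGrading_quaternion.congr (e.trans (matrixOneEquiv D).symm)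
    exact h0.matrix_pow D k (Nat.zero_le k)

end Matrices

/-! ### Constraints on the size of the matrices. -/

section Matrices

variable {D : Type*} [DivisionRing D] [Algebra ℝ D] {n : ℕ}
  {G : Type*} [AddCommGroup G] {𝒜 : G → Submodule ℝ (Matrix (Fin n) (Fin n) D)}

theorem size_ne_zero (h2 : ∀ g, Module.finrank ℝ (𝒜 g) = 2) : n ≠ 0 := by
  rintro rfl
  exact one_ne_zero_of_finrank_eq_two h2 (Subsingleton.elim _ _)

theorem IsDivisionGrading.exists_size_eq_two_pow [FiniteDimensional ℝ D]
    [Algebra.IsCentral ℝ D] (h : IsDivisionGrading 𝒜) (h2 : ∀ g, Module.finrank ℝ (𝒜 g) = 2) : ∃ k : ℕ, n = 2 ^ k := by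
  have : NeZero n := ⟨size_ne_zero h2⟩
  have := h.finite h2
  let _ : Module (ZMod 2) G := AddCommGroup.zmodModule fun g => by
    rw [two_nsmul]; exact h.add_self_eq_zero h2 g
  have hr := h.finrank_eq h2
  -- As `G` is a vector space over ℤ/2, the equation `n² dim D = 2 |G|` makes `n` a divisor of a
  -- power of two.
  rw [Module.finrank_matrix, Fintype.card_fin, Module.natCard_eq_pow_finrank (K := ZMod 2),
    Nat.card_zmod, ← pow_succ, mul_assoc] at hr
  obtain ⟨k, -, hk⟩ := (Nat.dvd_prime_pow Nat.prime_two).1 (Dvd.intro _ hr)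
  exact ⟨k, hk⟩

theorem IsDivisionGrading.finrank_ne_one [FiniteDimensional ℝ D]
    (h : IsDivisionGrading 𝒜) (h2 : ∀ g, Module.finrank ℝ (𝒜 g) = 2) : ¬(n = 1 ∧ Module.finrank ℝ D = 1) := by
  rintro ⟨rfl, hd⟩
  have hr := h.finrank_eq h2
  rw [Module.finrank_matrix, Fintype.card_fin, hd] at hr
  omega

/-- For `n ≥ 2` a matrix unit off the diagonal is a nonzero element of square zero, impossible in ℍ.
-/
theorem eq_one_of_algEquiv_quaternion (hn : n ≠ 0)
    (e : Matrix (Fin n) (Fin n) D ≃ₐ[ℝ] ℍ[ℝ]) : n = 1 := by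
  by_contra hn1
  let i : Fin n := ⟨0, by omega⟩
  let j : Fin n := ⟨1, by omega⟩
  have hji : j ≠ i := by simp [i, j]
  have h0 : Matrix.single i j (1 : D) * Matrix.single i j 1 = 0 :=
    Matrix.single_mul_single_of_ne _ _ _ _ hji _
  have h1 := congrArg e h0
  rw [map_mul, map_zero, mul_self_eq_zero, map_eq_zero_iff e e.injective] at h1
  simpa using congrFun (congrFun h1 i) j

theorem eq_one_or_neg_one_of_mul_self {u : Matrix (Fin 1) (Fin 1) D} (hu : u * u = 1) :
    u = 1 ∨ u = -1 := by
  let e := matrixOneEquiv D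
  have h1 := congrArg e hu
  rw [map_mul, map_one, mul_self_eq_one_iff] at h1
  rcases h1 with h1 | h1
  · exact Or.inl (e.injective (by rw [h1, map_one]))
  · exact Or.inr (e.injective (by rw [h1, map_neg, map_one]))

end Matrices

end RealDivGrading

theorem mainTheorem4 (D : Type*) [DivisionRing D] [Algebra ℝ D] [FiniteDimensional ℝ D]
    [Algebra.IsCentral ℝ D] (n : ℕ) :
    -- existence
    ((∃ (G : Type) (_ : AddCommGroup G) (𝒜 : G → Submodule ℝ (Matrix (Fin n) (Fin n) D)),
        RealDivGrading.IsDivisionGrading 𝒜 ∧ ∀ g, Module.finrank ℝ (𝒜 g) = 2) ↔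
      (∃ k : ℕ, n = 2 ^ k) ∧ ¬ (n = 1 ∧ Module.finrank ℝ D = 1)) ∧
    -- classification up to weak isomorphism
    (∀ (G : Type*) [AddCommGroup G] (𝒜 : G → Submodule ℝ (Matrix (Fin n) (Fin n) D)),
      RealDivGrading.IsDivisionGrading 𝒜 → (∀ g, Module.finrank ℝ (𝒜 g) = 2) →
        (n ≠ 1 → ∃ k : ℕ, RealDivGrading.WeaklyIsomorphic 𝒜 (RealDivGrading.typeI k) ∨
          RealDivGrading.WeaklyIsomorphic 𝒜 (RealDivGrading.typeII k)) ∧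
        (n = 1 → RealDivGrading.WeaklyIsomorphic 𝒜 RealDivGrading.hTwo)) ∧
    -- all these gradings are coarsenings of fine Clifford gradings
    (∀ k : ℕ, RealDivGrading.IsCoarseningOfClifford (RealDivGrading.typeI k) (k + 1) (k + 1)) ∧
    (∀ k : ℕ, RealDivGrading.IsCoarseningOfClifford (RealDivGrading.typeII k) (k + 3) (k + 1)) ∧
    RealDivGrading.IsCoarseningOfClifford RealDivGrading.hTwo 2 0 := by
  refine ⟨⟨?_, ?_⟩, ?_, RealDivGrading.isCoarseningOfClifford_typeI,
    RealDivGrading.isCoarseningOfClifford_typeII, RealDivGrading.isCoarseningOfClifford_hTwo⟩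
  · rintro ⟨G, _, 𝒜, h, h2⟩
    exact ⟨h.exists_size_eq_two_pow h2, h.finrank_ne_one h2⟩
  · rintro ⟨⟨k, rfl⟩, hk⟩
    exact RealDivGrading.exists_grading D k hk
  · intro G _ 𝒜 h h2
    have : NeZero n := ⟨RealDivGrading.size_ne_zero h2⟩
    refine ⟨fun hn => ?_, ?_⟩
    · rcases h.classification h2 with ⟨-, hk⟩ | ⟨-, e, -⟩
      · exact hk
      · exact absurd (RealDivGrading.eq_one_of_algEquiv_quaternion (NeZero.ne n) e) hn
    · rintro rfl
      rcases h.classification h2 with ⟨⟨u, hu, hu1, hu2⟩, -⟩ | hw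
      -- Over a division ring `u² = 1` forces `u = ±1`, so the types with `M₂⁽²⁾` cannot occur at
      -- size one.
      · exact absurd (RealDivGrading.eq_one_or_neg_one_of_mul_self hu) (not_or.2 ⟨hu1, hu2⟩)
      · exact hw
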